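/- Let $X$ be a smooth, proper (for example projective), irreducible algebraic surface over $\mathbb{C}$, let $f_1,f_2,f_3$ be non-zero rational functions on $X$, and let $C_0,\dots,C_N$ be the pairwise different irreducible components of the divisors of $f_1,f_2,f_3$. Assume that every $C_i$ is a non-singular curve and that the $C_i$ have normal crossings: at a common point of two of them these two meet transversally and no third one passes through it. Fix a rational function $x_0$ on $X$ with $\operatorname{ord}_{C_0}x_0=1$, and put $m_k=\operatorname{ord}_{C_0}f_k$ $(k=1,2,3)$. For a (closed) point $P\in C_0$ let $n_k=n_k(P)$ be the order at $P$ of the rational function $(x_0^{-m_k}f_k)|_{C_0}$ on $C_0$. Choose a rational function $y_P$ on $X$ with $\operatorname{ord}_{C_0}y_P=0$ whose restriction to $C_0$ has a simple zero at $P$. Define $g_k$ by $f_k=x_0^{m_k}y_P^{n_k}g_k$, so that $g_k|_{C_0}$ is regular and non-zero at $P$, and let $g_k(P)$ be its value there. The refined symbol is $$(f_1,f_2,f_3)^{x_0}_{C_0,P}=(-1)^{n_1n_3m_2-m_1m_3n_2}\left(\frac{g_1(P)^{n_3}}{g_3(P)^{n_1}}\right)^{m_2}.$$ (1) For every choice of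 the functions $y_P$, the symbol is different from $1$ at only finitely many points $P\in C_0$, and $$\prod_{P\in C_0}(f_1,f_2,f_3)^{x_0}_{C_0,P}=1,$$ the product being over all points $P$ of $C_0$. (2) Let $P\in C_0$ be a point at which $x_0$ is a local equation of $C_0$ (that is, $x_0$ is regular at $P$ and generates the ideal of $C_0$ in $\mathcal{O}_{X,P}$). If $P\in C_0\cap C_j$ with $j\neq 0$ and $x_j$ is any rational function on $X$ that is a local equation of $C_j$ at $P$, then the functions $\tilde g_k$ given by $f_k=x_0^{m_k}x_j^{\operatorname{ord}_{C_j}f_k}\tilde g_k$ are regular and non-zero at the point $P$ of $X$, and the symbol $(f_1,f_2,f_3)^{x_0}_{C_0,P}$ (for any choice of $y_P$) equals the expression displayed above with $n_k$ replaced by $\operatorname{ord}_{C_j}f_k$ and $g_k(P)$ by $\tilde g_k(P)$. If $P$ lies on no $C_j$ with $j\neq 0$, then the symbol is $1$. -/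

import Mathlib

open CategoryTheory AlgebraicGeometry

noncomputable section

namespace RefinedParshin

/-- The base scheme `Spec ℂ`. -/
abbrev SpecC : Scheme.{0} := Spec (CommRingCat.of ℂ)

/-- A complex scheme locally of finite type is locally Noetherian. -/
instance instLocNoeth (Y : Scheme.{0}) [Y.Over SpecC] [LocallyOfFiniteType (Y ↘ SpecC)] :
    IsLocallyNoetherian Y :=
  LocallyOfFiniteType.isLocallyNoetherian (Y ↘ SpecC)

/-- The value at a closed point `P` of a rational function `g` that is regular at `P`, as a
complex number through the canonical identification of the residue field at `P` with `ℂ`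
(`0` if `g` is not regular at `P`). -/
def valueAt {Y : Scheme.{0}} [IsIntegral Y] [Y.Over SpecC] [LocallyOfFiniteType (Y ↘ SpecC)]
    (P : closedPoints Y) (g : Y.functionField) : ℂ :=
  open Classical in
  if h : ∃ a : Y.presheaf.stalk (P : Y), algebraMap _ Y.functionField a = g then
    (residueFieldIsoBase (Y ↘ SpecC) (P : Y) P.2).hom.hom ((Y.residue (P : Y)).hom h.choose)
  else 0

/-- `g` is well defined and non-zero at `Q`: it is a unit of the local ring at `Q`. -/
def IsUnitAt {Y : Scheme.{0}} [IsIntegral Y] (Q : Y) (g : Y.functionField) : Prop :=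
  ∃ u : (Y.presheaf.stalk Q)ˣ, algebraMap (Y.presheaf.stalk Q) Y.functionField u = g

/-- A non-singular irreducible closed curve on the complex scheme `X`. -/
structure SmoothCurve (X : Scheme.{0}) [X.Over SpecC] where
  /-- the curve as a scheme -/
  C : Scheme.{0}
  /-- its inclusion into `X` -/
  ι : C ⟶ X
  isIntegral : IsIntegral C
  isClosedImmersion : IsClosedImmersion ι
  smooth : SmoothOfRelativeDimension 1 (ι ≫ X ↘ SpecC)

namespace SmoothCurve

section
variable {X : Scheme.{0}} [X.Over SpecC] (c : SmoothCurve X)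

instance : IsIntegral c.C := c.isIntegral

instance : IsClosedImmersion c.ι := c.isClosedImmersion

instance : c.C.Over SpecC := ⟨c.ι ≫ X ↘ SpecC⟩

instance : SmoothOfRelativeDimension 1 (c.C ↘ SpecC) := c.smooth

instance : LocallyOfFiniteType (c.C ↘ SpecC) :=
  haveI : Smooth (c.C ↘ SpecC) := SmoothOfRelativeDimension.smooth 1 (c.C ↘ SpecC)
  inferInstance

/-- The generic point of the curve, as a point of `X`. -/
def genericPt : X := c.ι (genericPoint c.C)

end

section
variable {X : Scheme.{0}} [X.Over SpecC] [IsIntegral X] (c : SmoothCurve X)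

/-- The restriction to the curve (reduction modulo the ideal sheaf of the curve) of a rational
function on `X` that is regular at the generic point of the curve (`0` for other functions). -/
def restrict (f : X.functionField) : c.C.functionField :=
  open Classical in
  if h : ∃ a : X.presheaf.stalk (c.ι (genericPoint c.C)), algebraMap _ X.functionField a = f then
    (c.ι.stalkMap (genericPoint c.C)).hom h.choose
  else 0

/-- The prime ideal of the curve in the local ring of `X` at a point `Q` of the curve:
the germs that vanish at the generic point of the curve. -/
def idealAt {Q : X} (h : c.genericPt ⤳ Q) : Ideal (X.presheaf.stalk Q) :=
  (IsLocalRing.maximalIdeal (X.presheaf.stalk c.genericPt)).comap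
    (X.presheaf.stalkSpecializes h).hom

/-- The point `Q` lies on the curve, and the rational function `x` on `X` is regular at `Q` and
defines the curve in a neighbourhood of `Q`. -/
def IsLocalEquation (Q : X) (x : X.functionField) : Prop :=
  ∃ h : c.genericPt ⤳ Q, ∃ a : X.presheaf.stalk Q,
    algebraMap _ X.functionField a = x ∧ c.idealAt h = Ideal.span {a}

end

end SmoothCurve

section
variable {X : Scheme.{0}} [X.Over SpecC] [IsIntegral X]

/-- Normal crossings: at a common point of two different curves of the family the two curves meet
transversally (their ideals generate the maximal ideal of the local ring of `X`), and no third
curve of the family passes through that point. -/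
def NormalCrossings {N : ℕ} (C : Fin (N + 1) → SmoothCurve X) : Prop :=
  ∀ (i j : Fin (N + 1)) (Q : X) (hi : (C i).genericPt ⤳ Q) (hj : (C j).genericPt ⤳ Q), i ≠ j →
    (C i).idealAt hi ⊔ (C j).idealAt hj = IsLocalRing.maximalIdeal (X.presheaf.stalk Q) ∧
    ∀ l, (C l).genericPt ⤳ Q → l = i ∨ l = j

variable [LocallyOfFiniteType (X ↘ SpecC)]

/-- The curves `C 0, …, C N` are pairwise different and are exactly the components (prime
divisors occurring with non-zero multiplicity) of the divisors of `f 0, f 1, f 2`. -/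
def AreComponents {N : ℕ} (C : Fin (N + 1) → SmoothCurve X) (f : Fin 3 → X.functionField) :
    Prop :=
  Function.Injective (fun i => (C i).genericPt) ∧
    ∀ z : X, (∃ k, Scheme.ord (f k) z ≠ 0) ↔ ∃ i, z = (C i).genericPt

/-- The expression `(-1)^(n₁n₃m₂ - m₁m₃n₂) (g₁^n₃ / g₃^n₁)^m₂`, where the indices `1, 2, 3` are
written as `0, 1, 2`. -/
def symbolExpr (m n : Fin 3 → ℤ) (g : Fin 3 → ℂ) : ℂ :=
  (-1) ^ (n 0 * n 2 * m 1 - m 0 * m 2 * n 1) * ((g 0) ^ (n 2) / (g 2) ^ (n 0)) ^ (m 1)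

/-- The refined symbol `(f₁, f₂, f₃)^{x₀}_{C₀, P}` at a closed point `P` of `C₀`, computed with
the rational function `y` on `X` as second coordinate. With `m_k = ord_{C₀} f_k`,
`n_k` is the order at `P` of the restriction to `C₀` of `x₀^{-m_k} f_k`, and `g_k(P)` is the value
at `P` of the restriction to `C₀` of `g_k = x₀^{-m_k} y^{-n_k} f_k`. -/
def refinedSymbol (c : SmoothCurve X) (x₀ : X.functionField) (f : Fin 3 → X.functionField)
    (y : X.functionField) (P : closedPoints c.C) : ℂ :=
  let m : Fin 3 → ℤ := fun k => Scheme.ord (f k) c.genericPt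
  let n : Fin 3 → ℤ := fun k => Scheme.ord (c.restrict (x₀ ^ (-m k) * f k)) (P : c.C)
  let g : Fin 3 → X.functionField := fun k => x₀ ^ (-m k) * y ^ (-n k) * f k
  symbolExpr m n fun k => valueAt P (c.restrict (g k))

/-- The cofactor `g_k` in `f_k = x^{m_k} y^{n_k} g_k`, where `m_k = ord_c f_k` and
`n_k = ord_d f_k`. -/
def cofactor (c d : SmoothCurve X) (x y : X.functionField) (f : Fin 3 → X.functionField)
    (k : Fin 3) : X.functionField :=
  x ^ (-Scheme.ord (f k) c.genericPt) * y ^ (-Scheme.ord (f k) d.genericPt) * f k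

/-- The refined symbol at a crossing point `Q` of the curves `c` and `d`, computed on the
surface: `m_k = ord_c f_k`, `n_k = ord_d f_k`, `f_k = x^{m_k} y^{n_k} g_k`. -/
def crossingSymbol (c d : SmoothCurve X) (x y : X.functionField) (f : Fin 3 → X.functionField)
    (Q : closedPoints X) : ℂ :=
  symbolExpr (fun k => Scheme.ord (f k) c.genericPt) (fun k => Scheme.ord (f k) d.genericPt)
    fun k => valueAt Q (cofactor c d x y f k)

end

end RefinedParshin

end

/-! Everything rests on one identity on the curve `C 0`. Number the functions from 1 and let h_k be
the restriction to `C 0` of x₀^{-m_k} f_k, a non-zero rational function on the curve. The refined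
symbol at P is the product of the tame symbols at P of the pairs (h₁^{m₂}, h₃) and ((-1)^{m₁m₃}, h₂)
(`refinedSymbol_eq_tame`). Tame symbols do not involve y_P, so the choice of y_P is immaterial, and
part (1) is Weil reciprocity for two pairs of functions on a smooth complete curve.

Weil reciprocity (`Place.Complete.finprod_tame`) is proved for a function field K in one variable
over an algebraically closed field k of characteristic zero, the points being replaced by a family
of places containing each non-trivial valuation ring of K / k exactly once. A transcendental f makes
K a finite separable extension of k(X), with X mapping to f. The projection formula
(`Place.Complete.tame_norm`) collects the symbols (f, g) at the places over one point of the
projective line into the symbol (X, N g) there, and reciprocity for (X, h) on the line is checked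
for constants and for X - a. If only g is transcendental, antisymmetry applies; two constants have
trivial symbols.

The projection formula is local. The integral closure of the valuation ring below is a principal
ideal domain with finitely many primes, so by multiplicativity only its units and primes need be
treated. Units are handled by computing the norm modulo a uniformizer as a determinant
(`Complete.res_norm`), primes by the reduced characteristic polynomial (`Complete.norm_prime`).

The closed points of `C 0` form a complete family by the valuative criterion
(`complete_closedPlace`); their local rings are discrete valuation rings because of étale
coordinates.

For part (2), the local ring of the surface at P is factorial: modulo x₀ it becomes the discrete
valuation ring of `C 0` at P. Hence a rational function without zero or pole along the curves
through P is a unit at P, and so are the cofactors. By transversality x_j restricts to a uniformizer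
of `C 0` at P and can replace y_P, which gives the expression on the surface. If no second component
passes through P, the h_k are units at P and both tame symbols are 1. -/

noncomputable section

namespace RefinedParshin

/-! ### Rational places of a field extension -/

/-- A discrete place of `K / k` with residue field `k`: a surjective additive valuation `ord`
(with the convention `ord 0 = 0`) together with the evaluation `res` of regular elements. -/
structure Place (k K : Type*) [Field k] [Field K] [Algebra k K] where
  ord : K → ℤ
  res : K → k
  -- With this value `0 ≤ ord x` is membership in the valuation ring, zero included; it is also the
  -- value of `Scheme.ord` at zero on the schemes considered here.
  ord_zero : ord 0 = 0
  ord_mul : ∀ {x y}, x ≠ 0 → y ≠ 0 → ord (x * y) = ord x + ord y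
  exists_ord_one : ∃ x, ord x = 1
  add_nonneg : ∀ {x y}, 0 ≤ ord x → 0 ≤ ord y → 0 ≤ ord (x + y)
  res_add : ∀ {x y}, 0 ≤ ord x → 0 ≤ ord y → res (x + y) = res x + res y
  res_mul : ∀ {x y}, 0 ≤ ord x → 0 ≤ ord y → res (x * y) = res x * res y
  ord_algebraMap : ∀ c, ord (algebraMap k K c) = 0
  res_algebraMap : ∀ c, res (algebraMap k K c) = c
  res_eq_zero_iff : ∀ {x}, x ≠ 0 → 0 ≤ ord x → (res x = 0 ↔ 0 < ord x)

namespace Place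

variable {k K : Type*} [Field k] [Field K] [Algebra k K] (P : Place k K)

@[simp] lemma res_zero : P.res 0 = 0 := by simpa using P.res_algebraMap 0

@[simp] lemma res_one : P.res 1 = 1 := by simpa using P.res_algebraMap 1

@[simp] lemma ord_one : P.ord 1 = 0 := by simpa using P.ord_algebraMap 1

@[simp] lemma ord_neg (x : K) : P.ord (-x) = P.ord x := by
  rcases eq_or_ne x 0 with rfl | hx
  · simp
  · have h := P.ord_mul (x := algebraMap k K (-1)) (y := x) (by simp) hx
    rw [P.ord_algebraMap] at h
    simpa using h

lemma ord_inv (x : K) : P.ord x⁻¹ = -P.ord x := by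
  rcases eq_or_ne x 0 with rfl | hx
  · simp [P.ord_zero]
  · have h := P.ord_mul (x := x) (y := x⁻¹) hx (inv_ne_zero hx)
    rw [mul_inv_cancel₀ hx, ord_one] at h
    omega

lemma ord_div {x y : K} (hx : x ≠ 0) (hy : y ≠ 0) : P.ord (x / y) = P.ord x - P.ord y := by
  rw [div_eq_mul_inv, P.ord_mul hx (inv_ne_zero hy), ord_inv]; ring

lemma ord_pow (x : K) (n : ℕ) : P.ord (x ^ n) = n * P.ord x := by
  rcases eq_or_ne x 0 with rfl | hx
  · rcases eq_or_ne n 0 with rfl | hn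
    · simp
    · simp [hn, P.ord_zero]
  · induction n with
    | zero => simp
    | succ n ih => rw [pow_succ, P.ord_mul (pow_ne_zero _ hx) hx, ih]; push_cast; ring

lemma ord_zpow (x : K) (n : ℤ) : P.ord (x ^ n) = n * P.ord x := by
  cases n with
  | ofNat n => simpa using P.ord_pow x n
  | negSucc n =>
    rw [zpow_negSucc, ord_inv, ord_pow, Int.negSucc_eq]; push_cast; ring

lemma ne_zero_of_ord_ne {x : K} (h : P.ord x ≠ 0) : x ≠ 0 := by
  rintro rfl; exact h P.ord_zero

lemma mul_nonneg {x y : K} (hx : 0 ≤ P.ord x) (hy : 0 ≤ P.ord y) : 0 ≤ P.ord (x * y) := by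
  rcases eq_or_ne x 0 with rfl | hx0
  · simp [P.ord_zero]
  rcases eq_or_ne y 0 with rfl | hy0
  · simp [P.ord_zero]
  rw [P.ord_mul hx0 hy0]; omega

lemma res_ne_zero {x : K} (hx : x ≠ 0) (h : P.ord x = 0) : P.res x ≠ 0 := fun h0 => by
  have := (P.res_eq_zero_iff hx h.ge).1 h0
  omega

lemma ord_eq_zero_of_res_ne_zero {x : K} (hx : 0 ≤ P.ord x) (h : P.res x ≠ 0) : P.ord x = 0 := by
  have hx0 : x ≠ 0 := by rintro rfl; simp at h
  have := mt (P.res_eq_zero_iff hx0 hx).2 h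
  omega

lemma res_neg {x : K} (hx : 0 ≤ P.ord x) : P.res (-x) = -P.res x := by
  have h := P.res_mul (x := algebraMap k K (-1)) (y := x) (P.ord_algebraMap _).ge hx
  rw [P.res_algebraMap] at h
  simpa using h

lemma res_inv {x : K} (hx : P.ord x = 0) : P.res x⁻¹ = (P.res x)⁻¹ := by
  rcases eq_or_ne x 0 with rfl | hx0
  · simp
  · have h := P.res_mul (x := x) (y := x⁻¹) hx.ge (by rw [ord_inv, hx]; simp)
    rw [mul_inv_cancel₀ hx0, res_one] at h
    exact eq_inv_of_mul_eq_one_right h.symm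

lemma res_div {x y : K} (hx : 0 ≤ P.ord x) (hy : P.ord y = 0) :
    P.res (x / y) = P.res x / P.res y := by
  rw [div_eq_mul_inv, P.res_mul hx (by rw [ord_inv, hy]; simp), P.res_inv hy, div_eq_mul_inv]

lemma res_pow {x : K} (hx : 0 ≤ P.ord x) (n : ℕ) : P.res (x ^ n) = P.res x ^ n := by
  induction n with
  | zero => simp
  | succ n ih =>
    rw [pow_succ, P.res_mul (by rw [ord_pow]; positivity) hx, ih, pow_succ]

lemma res_zpow {x : K} (hx : P.ord x = 0) (n : ℤ) : P.res (x ^ n) = P.res x ^ n := by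
  cases n with
  | ofNat n => simpa using P.res_pow hx.ge n
  | negSucc n =>
    rw [zpow_negSucc, zpow_negSucc, P.res_inv (by rw [ord_pow, hx]; simp), P.res_pow hx.ge]

/-- The ring of regular elements of a place. -/
def ring : Subalgebra k K where
  carrier := {x | 0 ≤ P.ord x}
  mul_mem' hx hy := P.mul_nonneg hx hy
  add_mem' hx hy := P.add_nonneg hx hy
  algebraMap_mem' c := (P.ord_algebraMap c).ge

lemma mem_ring {x : K} : x ∈ P.ring ↔ 0 ≤ P.ord x := Iff.rfl

/-- Evaluation at a place as an algebra homomorphism. -/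
def resHom : P.ring →ₐ[k] k where
  toFun x := P.res x
  map_one' := P.res_one
  map_mul' x y := P.res_mul x.2 y.2
  map_zero' := P.res_zero
  map_add' x y := P.res_add x.2 y.2
  commutes' c := P.res_algebraMap c

@[simp] lemma resHom_apply (x : P.ring) : P.resHom x = P.res x := rfl

/-- The valuation ring of a place. -/
def valuationSubring : ValuationSubring K where
  __ := P.ring.toSubring
  mem_or_inv_mem' x := by
    change 0 ≤ P.ord x ∨ 0 ≤ P.ord x⁻¹
    rw [ord_inv]; omega

lemma mem_valuationSubring {x : K} : x ∈ P.valuationSubring ↔ 0 ≤ P.ord x := Iff.rfl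

lemma res_sum {ι : Type*} (s : Finset ι) (f : ι → K) (h : ∀ i ∈ s, 0 ≤ P.ord (f i)) :
    P.res (∑ i ∈ s, f i) = ∑ i ∈ s, P.res (f i) ∧ 0 ≤ P.ord (∑ i ∈ s, f i) := by
  classical
  induction s using Finset.induction_on with
  | empty => simp [P.ord_zero]
  | insert a s ha ih =>
    obtain ⟨h1, h2⟩ := ih fun i hi => h i (Finset.mem_insert_of_mem hi)
    have h3 := h a (Finset.mem_insert_self _ _)
    rw [Finset.sum_insert ha, Finset.sum_insert ha, P.res_add h3 h2, h1]
    exact ⟨rfl, P.add_nonneg h3 h2⟩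

/-! ### The tame symbol -/

/-- The tame symbol at a place. -/
def tame (f g : K) : k :=
  (-1) ^ (P.ord f * P.ord g) * P.res (f ^ P.ord g / g ^ P.ord f)

lemma ord_tame_aux {f g : K} (hf : f ≠ 0) (hg : g ≠ 0) :
    P.ord (f ^ P.ord g / g ^ P.ord f) = 0 := by
  rw [P.ord_div (zpow_ne_zero _ hf) (zpow_ne_zero _ hg), ord_zpow, ord_zpow]; ring

lemma tame_swap {f g : K} (hf : f ≠ 0) (hg : g ≠ 0) : P.tame g f = (P.tame f g)⁻¹ := by
  unfold tame
  rw [mul_inv, ← P.res_inv (P.ord_tame_aux hf hg), inv_div, mul_comm (P.ord g)]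
  congr 1
  -- The sign is its own inverse.
  rcases Int.even_or_odd (P.ord f * P.ord g) with h | h <;>
    simp [h.neg_one_zpow]

lemma tame_mul_left {f f' g : K} (hf : f ≠ 0) (hf' : f' ≠ 0) (hg : g ≠ 0) :
    P.tame (f * f') g = P.tame f g * P.tame f' g := by
  have h : (f * f') ^ P.ord g / g ^ P.ord (f * f') =
      (f ^ P.ord g / g ^ P.ord f) * (f' ^ P.ord g / g ^ P.ord f') := by
    rw [P.ord_mul hf hf', zpow_add₀ hg, mul_zpow, mul_div_mul_comm]
  unfold tame
  rw [h, P.res_mul (P.ord_tame_aux hf hg).ge (P.ord_tame_aux hf' hg).ge, P.ord_mul hf hf', add_mul,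
    zpow_add₀ (by simp)]
  ring

lemma tame_mul_right {f g g' : K} (hf : f ≠ 0) (hg : g ≠ 0) (hg' : g' ≠ 0) :
    P.tame f (g * g') = P.tame f g * P.tame f g' := by
  rw [P.tame_swap (mul_ne_zero hg hg') hf, P.tame_mul_left hg hg' hf, mul_inv,
    ← P.tame_swap hg hf, ← P.tame_swap hg' hf]

@[simp] lemma tame_one_left (g : K) : P.tame 1 g = 1 := by simp [tame]

@[simp] lemma tame_one_right (f : K) : P.tame f 1 = 1 := by simp [tame]

lemma tame_inv_left {f g : K} (hf : f ≠ 0) (hg : g ≠ 0) : P.tame f⁻¹ g = (P.tame f g)⁻¹ := by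
  apply eq_inv_of_mul_eq_one_left
  rw [← P.tame_mul_left (inv_ne_zero hf) hf hg, inv_mul_cancel₀ hf, tame_one_left]

lemma tame_inv_right {f g : K} (hf : f ≠ 0) (hg : g ≠ 0) : P.tame f g⁻¹ = (P.tame f g)⁻¹ := by
  apply eq_inv_of_mul_eq_one_left
  rw [← P.tame_mul_right hf (inv_ne_zero hg) hg, inv_mul_cancel₀ hg, tame_one_right]

lemma tame_zpow_left {f g : K} (hf : f ≠ 0) (hg : g ≠ 0) (n : ℤ) :
    P.tame (f ^ n) g = P.tame f g ^ n := by
  have aux : ∀ n : ℕ, P.tame (f ^ n) g = P.tame f g ^ n := fun n => by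
    induction n with
    | zero => simp
    | succ n ih => rw [pow_succ, P.tame_mul_left (pow_ne_zero _ hf) hf hg, ih, pow_succ]
  cases n with
  | ofNat n => simpa using aux n
  | negSucc n =>
    rw [zpow_negSucc, zpow_negSucc, P.tame_inv_left (pow_ne_zero _ hf) hg, aux]

lemma tame_of_ord_left_eq_zero {f g : K} (hf : P.ord f = 0) :
    P.tame f g = P.res f ^ P.ord g := by
  simp [tame, hf, P.res_zpow hf]

lemma tame_of_ord_eq_zero {f g : K} (hf : P.ord f = 0) (hg : P.ord g = 0) :
    P.tame f g = 1 := by simp [tame, hf, hg]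

/-- The tame symbol computed through a uniformizer. -/
lemma tame_eq_of_uniformizer {f g y : K} (hf : f ≠ 0) (hg : g ≠ 0) (hy : P.ord y = 1) :
    P.tame f g = (-1) ^ (P.ord f * P.ord g) *
      (P.res (y ^ (-P.ord f) * f) ^ P.ord g / P.res (y ^ (-P.ord g) * g) ^ P.ord f) := by
  have hy0 : y ≠ 0 := P.ne_zero_of_ord_ne (by omega)
  have h1 : P.ord (y ^ (-P.ord f) * f) = 0 := by
    rw [P.ord_mul (zpow_ne_zero _ hy0) hf, ord_zpow, hy]; ring
  have h2 : P.ord (y ^ (-P.ord g) * g) = 0 := by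
    rw [P.ord_mul (zpow_ne_zero _ hy0) hg, ord_zpow, hy]; ring
  rw [tame, ← P.res_zpow h1, ← P.res_zpow h2, ← P.res_div]
  · congr 2
    -- The same power of `y` occurs in numerator and denominator; this cancellation is why the
    -- uniformizer does not matter.
    rw [mul_zpow, mul_zpow, ← zpow_mul, ← zpow_mul, mul_div_mul_comm,
      show -P.ord g * P.ord f = -P.ord f * P.ord g by ring, div_self (zpow_ne_zero _ hy0), one_mul]
  · rw [ord_zpow, h1]; simp
  · rw [ord_zpow, h2]; simp

end Place

end RefinedParshin

end

/-! ### Determinants of multiplication maps and reduction of norms -/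

noncomputable section

namespace RefinedParshin

/-- Multiplicativity of the determinant in a short exact sequence. -/
lemma det_eq_mul_of_exact {k V₁ V V₂ : Type*} [Field k] [AddCommGroup V₁] [AddCommGroup V]
    [AddCommGroup V₂] [Module k V₁] [Module k V] [Module k V₂] [FiniteDimensional k V₁]
    [FiniteDimensional k V₂] (i : V₁ →ₗ[k] V) (p : V →ₗ[k] V₂) (hi : Function.Injective i)
    (hp : Function.Surjective p) (hip : LinearMap.range i = LinearMap.ker p)
    (e₁ : V₁ →ₗ[k] V₁) (e : V →ₗ[k] V) (e₂ : V₂ →ₗ[k] V₂)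
    (h₁ : ∀ x, e (i x) = i (e₁ x)) (h₂ : ∀ x, p (e x) = e₂ (p x)) :
    FiniteDimensional k V ∧ LinearMap.det e = LinearMap.det e₁ * LinearMap.det e₂ := by
  let W := LinearMap.range i
  let E₁ : V₁ ≃ₗ[k] W := LinearEquiv.ofInjective i hi
  let E₂ : (V ⧸ W) ≃ₗ[k] V₂ := (Submodule.quotEquivOfEq _ _ hip).trans (p.quotKerEquivOfSurjective hp)
  have : FiniteDimensional k W := E₁.finiteDimensional
  have : FiniteDimensional k (V ⧸ W) := E₂.symm.finiteDimensional
  have hV : FiniteDimensional k V := Module.Finite.of_submodule_quotient W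
  have he : W ≤ W.comap e := by
    rintro _ ⟨x, rfl⟩
    exact ⟨e₁ x, (h₁ x).symm⟩
  refine ⟨hV, ?_⟩
  rw [LinearMap.det_eq_det_mul_det W e he, ← LinearMap.det_conj e₁ E₁, ← LinearMap.det_conj e₂ E₂.symm]
  congr 2
  · ext x
    obtain ⟨x, rfl⟩ := E₁.surjective x
    change e (i x) = i (e₁ (E₁.symm (E₁ x)))
    rw [E₁.symm_apply_apply, h₁]
  · ext x
    apply E₂.injective
    simp [E₂, h₂]

section

variable {k B ι : Type*} [Field k] [CommRing B] [Algebra k B]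

/-- Through `ρ` the quotient is the line `k`, on which `b` acts as the scalar `ρ b`. -/
lemma det_mulLeft_of_finrank_one (ρ : B →ₐ[k] k) (q : B) (hq : RingHom.ker ρ = Ideal.span {q})
    (b : B) : FiniteDimensional k (B ⧸ Ideal.span {q}) ∧
      LinearMap.det (LinearMap.mulLeft k (Ideal.Quotient.mk (Ideal.span {q}) b)) = ρ b := by
  have hs : Function.Surjective ρ := fun c => ⟨algebraMap k B c, by simp⟩
  let E : (B ⧸ Ideal.span {q}) ≃ₐ[k] k :=
    (Ideal.quotientEquivAlgOfEq k hq.symm).trans (Ideal.quotientKerAlgEquivOfSurjective hs)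
  have hE : ∀ x, E (Ideal.Quotient.mk _ x) = ρ x := fun x => rfl
  refine ⟨E.symm.toLinearEquiv.finiteDimensional, ?_⟩
  rw [← LinearMap.det_conj _ E.toLinearEquiv]
  have : (E.toLinearEquiv : _ →ₗ[k] k) ∘ₗ
      LinearMap.mulLeft k (Ideal.Quotient.mk (Ideal.span {q}) b) ∘ₗ
        (E.toLinearEquiv.symm : k →ₗ[k] _) = ρ b • LinearMap.id := by
    ext
    simp [hE]
  rw [this]
  simp

/-- The determinant of the multiplication by `b` on `B / (x)`, in terms of the values of `b` at the
prime divisors of `x`. -/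
lemma det_mulLeft_quotient [IsDomain B] [UniqueFactorizationMonoid B] (s : Finset ι) (ρ : ι → B →ₐ[k] k)
    (m : ι → B → ℕ)
    (hmul : ∀ i ∈ s, ∀ x y, x ≠ 0 → y ≠ 0 → m i (x * y) = m i x + m i y)
    (hunit : ∀ i ∈ s, ∀ x, IsUnit x → m i x = 0)
    (hprime : ∀ q : B, Prime q → ∃ i ∈ s, RingHom.ker (ρ i) = Ideal.span {q} ∧ m i q = 1 ∧
      ∀ j ∈ s, j ≠ i → m j q = 0) (b x : B) (hx : x ≠ 0) :
    FiniteDimensional k (B ⧸ Ideal.span {x}) ∧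
      LinearMap.det (LinearMap.mulLeft k (Ideal.Quotient.mk (Ideal.span {x}) b)) =
        ∏ i ∈ s, ρ i b ^ m i x := by
  classical
  induction x using UniqueFactorizationMonoid.induction_on_prime with
  | h₁ => exact absurd rfl hx
  | h₂ x hu =>
    have : Subsingleton (B ⧸ Ideal.span {x}) :=
      Ideal.Quotient.subsingleton_iff.2 (Ideal.span_singleton_eq_top.2 hu)
    refine ⟨inferInstance, ?_⟩
    rw [Finset.prod_eq_one fun i hi => by rw [hunit i hi x hu, pow_zero]]
    rw [Subsingleton.elim (LinearMap.mulLeft k _) (LinearMap.id), LinearMap.det_id]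
  | h₃ x q hx0 hq ih =>
    obtain ⟨i, hi, hker, hm1, hm0⟩ := hprime q hq
    obtain ⟨hfin, hdet⟩ := ih hx0
    obtain ⟨hfin', hdet'⟩ := det_mulLeft_of_finrank_one (ρ i) q hker b
    -- Induction along the exact sequence 0 → B/(x) → B/(qx) → B/(q) → 0, whose first map is
    -- multiplication by `q`. The quotient B/(q) contributes the single factor `ρ i b`, matching `m
    -- i q = 1`.
    let I : (B ⧸ Ideal.span {x}) →ₗ[k] (B ⧸ Ideal.span {q * x}) :=
      ((Ideal.span {x}).restrictScalars k).mapQ ((Ideal.span {q * x}).restrictScalars k)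
        (LinearMap.mulLeft k q) (by
          intro y hy
          obtain ⟨z, rfl⟩ := Ideal.mem_span_singleton'.1 hy
          exact Ideal.mem_span_singleton'.2 ⟨z, by simp; ring⟩)
    have hI : ∀ y, I (Ideal.Quotient.mk _ y) = Ideal.Quotient.mk _ (q * y) := fun y => rfl
    let p : (B ⧸ Ideal.span {q * x}) →ₐ[k] (B ⧸ Ideal.span {q}) :=
      Ideal.Quotient.factorₐ k (Ideal.span_singleton_le_span_singleton.2 (dvd_mul_right q x))
    have hp : ∀ y, p (Ideal.Quotient.mk _ y) = Ideal.Quotient.mk _ y := fun y => rfl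
    have key := det_eq_mul_of_exact I p.toLinearMap ?_ ?_ ?_
      (LinearMap.mulLeft k (Ideal.Quotient.mk _ b)) (LinearMap.mulLeft k (Ideal.Quotient.mk _ b))
      (LinearMap.mulLeft k (Ideal.Quotient.mk _ b)) ?_ ?_
    · refine ⟨key.1, ?_⟩
      rw [key.2, hdet, hdet', ← Finset.mul_prod_erase s _ hi, ← Finset.mul_prod_erase s _ hi,
        hmul i hi q x hq.ne_zero hx0, hm1, mul_right_comm]
      congr 1
      · ring
      · refine Finset.prod_congr rfl fun j hj => ?_
        rw [hmul j (Finset.mem_of_mem_erase hj) q x hq.ne_zero hx0,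
          hm0 j (Finset.mem_of_mem_erase hj) (Finset.ne_of_mem_erase hj), zero_add]
    · rw [injective_iff_map_eq_zero]
      intro y hy
      obtain ⟨y, rfl⟩ := Ideal.Quotient.mk_surjective y
      rw [hI, Ideal.Quotient.eq_zero_iff_mem, Ideal.mem_span_singleton] at hy
      rw [Ideal.Quotient.eq_zero_iff_mem, Ideal.mem_span_singleton]
      exact (mul_dvd_mul_iff_left hq.ne_zero).1 hy
    · intro y
      obtain ⟨y, rfl⟩ := Ideal.Quotient.mk_surjective y
      exact ⟨Ideal.Quotient.mk _ y, rfl⟩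
    · ext y
      obtain ⟨y, rfl⟩ := Ideal.Quotient.mk_surjective y
      rw [LinearMap.mem_ker, AlgHom.toLinearMap_apply, hp, Ideal.Quotient.eq_zero_iff_mem,
        Ideal.mem_span_singleton]
      constructor
      · rintro ⟨z, hz⟩
        obtain ⟨z, rfl⟩ := Ideal.Quotient.mk_surjective z
        rw [hI, Ideal.Quotient.eq, Ideal.mem_span_singleton] at hz
        have := (dvd_mul_right q x).trans hz
        exact (dvd_sub_right (dvd_mul_right q z)).1 this
      · rintro ⟨z, rfl⟩
        exact ⟨Ideal.Quotient.mk _ z, hI z⟩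
    · intro y
      obtain ⟨y, rfl⟩ := Ideal.Quotient.mk_surjective y
      simp only [LinearMap.mulLeft_apply, hI, ← map_mul]
      congr 1; ring
    · intro y
      obtain ⟨y, rfl⟩ := Ideal.Quotient.mk_surjective y
      simp only [LinearMap.mulLeft_apply, AlgHom.toLinearMap_apply, hp, ← map_mul]

/-- Reduction of the norm modulo a principal maximal ideal with residue field `k`. -/
lemma map_norm_eq_det_quotient {A : Type*} [CommRing A] [Algebra k A] [Algebra A B]
    [IsScalarTower k A B] [Module.Free A B] [Module.Finite A B] (ρ : A →ₐ[k] k) (τ : A)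
    (hτ : RingHom.ker ρ = Ideal.span {τ}) (b : B) :
    ρ (Algebra.norm A b) = LinearMap.det
      (LinearMap.mulLeft k (Ideal.Quotient.mk (Ideal.span {algebraMap A B τ}) b)) := by
  classical
  let β := Module.Free.chooseBasis A B
  let n := Module.Free.ChooseBasisIndex A B
  let π := Ideal.Quotient.mk (Ideal.span {algebraMap A B τ})
  have hρ : ∀ a : A, ∃ a', a = algebraMap k A (ρ a) + τ * a' := fun a => by
    have : a - algebraMap k A (ρ a) ∈ RingHom.ker ρ := by simp [RingHom.mem_ker]
    rw [hτ, Ideal.mem_span_singleton] at this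
    obtain ⟨a', ha'⟩ := this
    exact ⟨a', by rw [← ha']; ring⟩
  have hsmul : ∀ (a : A) (x : B), π (a • x) = ρ a • π x := fun a x => by
    obtain ⟨a', ha'⟩ := hρ a
    have h0 : π (algebraMap A B τ) = 0 :=
      Ideal.Quotient.eq_zero_iff_mem.2 (Ideal.mem_span_singleton_self _)
    conv_lhs => rw [ha']
    rw [Algebra.smul_def, map_add, map_mul, ← IsScalarTower.algebraMap_apply, map_mul, map_add,
      map_mul, h0, zero_mul, add_zero, Algebra.smul_def]
    rfl
  have hexp : ∀ x : B, π x = ∑ j, ρ (β.repr x j) • π (β j) := fun x => by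
    conv_lhs => rw [← β.sum_repr x]
    rw [map_sum]
    exact Finset.sum_congr rfl fun j _ => hsmul _ _
  -- Since `A / (τ)` is `k`, an `A`-basis of `B` reduces to a `k`-basis of `B / (τ)`. The matrix of
  -- multiplication by `b` reduces entrywise, and so does its determinant.
  let β' : Module.Basis n k (B ⧸ Ideal.span {algebraMap A B τ}) := Module.Basis.mk (v := fun j => π (β j)) (by
      rw [Fintype.linearIndependent_iff]
      intro c hc j
      have h1 : π (∑ j, algebraMap k A (c j) • β j) = 0 := by
        rw [map_sum, ← hc]
        exact Finset.sum_congr rfl fun j _ => by rw [hsmul]; simp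
      rw [Ideal.Quotient.eq_zero_iff_mem, Ideal.mem_span_singleton] at h1
      obtain ⟨z, hz⟩ := h1
      have h2 := congrArg (fun x => β.repr x j) hz
      rw [← Algebra.smul_def] at h2
      have h3 := congrArg ρ h2
      simp only [map_smul, Finsupp.smul_apply] at h3
      rw [β.repr_sum_self] at h3
      have h4 : ρ τ = 0 := by
        rw [← RingHom.mem_ker, hτ]; exact Ideal.mem_span_singleton_self _
      simpa [h4] using h3) (by
      rintro y -
      obtain ⟨y, rfl⟩ := Ideal.Quotient.mk_surjective y
      have := hexp y
      change π y ∈ _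
      rw [this]
      exact Submodule.sum_mem _ fun j _ => Submodule.smul_mem _ _ (Submodule.subset_span ⟨j, rfl⟩))
  have hβ' : ∀ j, β' j = π (β j) := fun j => by simp [β']
  have hrepr : ∀ x j, β'.repr (π x) j = ρ (β.repr x j) := fun x j => by
    have : π x = ∑ j, ρ (β.repr x j) • β' j := by simp only [hβ']; exact hexp x
    rw [this, β'.repr_sum_self]
  rw [Algebra.norm_apply, ← LinearMap.det_toMatrix β, ← LinearMap.det_toMatrix β',
    ← RingHom.coe_coe, RingHom.map_det]
  congr 1
  ext i j
  simp only [RingHom.mapMatrix_apply, Matrix.map_apply, LinearMap.toMatrix_apply,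
    LinearMap.mulLeft_apply, hβ']
  exact (hrepr _ _).symm

end

end RefinedParshin

end

/-! ### The valuation ring of a place and its integral closure in a finite extension -/

noncomputable section

namespace RefinedParshin

namespace Place

section Ring

variable {k F : Type*} [Field k] [Field F] [Algebra k F] (v : Place k F)

lemma isUnit_ring_iff {x : v.ring} : IsUnit x ↔ (x : F) ≠ 0 ∧ v.ord x = 0 := by
  constructor
  · rintro ⟨u, rfl⟩
    have h := congrArg (Subtype.val) (u.mul_inv)
    have h0 : ((u : v.ring) : F) ≠ 0 := left_ne_zero_of_mul_eq_one h
    have h1 : (((u⁻¹ : v.ringˣ) : v.ring) : F) ≠ 0 := right_ne_zero_of_mul_eq_one h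
    have h2 := v.ord_mul h0 h1
    have h3 : v.ord (((u : v.ring) : F) * ((u⁻¹ : v.ringˣ) : v.ring)) = 0 := by
      rw [show ((u : v.ring) : F) * ((u⁻¹ : v.ringˣ) : v.ring) = 1 from h]; simp
    have h4 := v.mem_ring.1 (u : v.ring).2
    have h5 := v.mem_ring.1 ((u⁻¹ : v.ringˣ) : v.ring).2
    exact ⟨h0, by omega⟩
  · rintro ⟨h0, h1⟩
    exact IsUnit.of_mul_eq_one (⟨(x : F)⁻¹, v.mem_ring.2 (by rw [v.ord_inv, h1]; simp)⟩ : v.ring)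
      (Subtype.ext (mul_inv_cancel₀ h0))

instance : IsDiscreteValuationRing v.ring := by
  obtain ⟨τ, hτ⟩ := v.exists_ord_one
  have hτ0 : τ ≠ 0 := v.ne_zero_of_ord_ne (by omega)
  let t : v.ring := ⟨τ, v.mem_ring.2 (by omega)⟩
  refine IsDiscreteValuationRing.ofHasUnitMulPowIrreducibleFactorization ⟨t, ⟨?_, ?_⟩, ?_⟩
  · rw [v.isUnit_ring_iff]
    rintro ⟨-, h⟩
    change v.ord τ = 0 at h
    omega
  · intro a b hab
    have h : τ = (a : F) * b := congrArg Subtype.val hab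
    have ha : (a : F) ≠ 0 := by rintro h0; exact hτ0 (by rw [h, h0, zero_mul])
    have hb : (b : F) ≠ 0 := by rintro h0; exact hτ0 (by rw [h, h0, mul_zero])
    have h1 := v.ord_mul ha hb
    rw [← h, hτ] at h1
    have h2 := v.mem_ring.1 a.2
    have h3 := v.mem_ring.1 b.2
    rw [v.isUnit_ring_iff, v.isUnit_ring_iff]
    rcases (show v.ord (a : F) = 0 ∨ v.ord (b : F) = 0 by omega) with h4 | h4
    · exact .inl ⟨ha, h4⟩
    · exact .inr ⟨hb, h4⟩
  · intro x hx
    have hx0 : (x : F) ≠ 0 := fun h => hx (Subtype.ext h)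
    obtain ⟨n, hn⟩ := Int.eq_ofNat_of_zero_le (v.mem_ring.1 x.2)
    have hu : v.ord ((x : F) / τ ^ n) = 0 := by
      rw [v.ord_div hx0 (pow_ne_zero _ hτ0), v.ord_pow, hτ, hn]; simp
    refine ⟨n, ?_⟩
    have hiu : IsUnit (⟨(x : F) / τ ^ n, v.mem_ring.2 hu.ge⟩ : v.ring) :=
      v.isUnit_ring_iff.2 ⟨div_ne_zero hx0 (pow_ne_zero _ hτ0), hu⟩
    exact ⟨hiu.unit, Subtype.ext (mul_div_cancel₀ (x : F) (pow_ne_zero n hτ0))⟩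

instance : IsFractionRing v.ring F := by
  refine IsFractionRing.of_field _ _ fun z => ?_
  rcases le_total 0 (v.ord z) with h | h
  · exact ⟨⟨z, h⟩, 1, by simp⟩
  · exact ⟨1, ⟨z⁻¹, v.mem_ring.2 (by rw [v.ord_inv]; omega)⟩, by simp⟩

lemma ker_resHom {τ : v.ring} (hτ : v.ord (τ : F) = 1) :
    RingHom.ker v.resHom = Ideal.span {τ} := by
  have hτ0 : (τ : F) ≠ 0 := v.ne_zero_of_ord_ne (by omega)
  ext x
  rw [RingHom.mem_ker, Ideal.mem_span_singleton, resHom_apply]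
  constructor
  · intro hx
    rcases eq_or_ne (x : F) 0 with h0 | h0
    · exact (Subtype.ext h0 : x = 0) ▸ dvd_zero _
    · have h1 := (v.res_eq_zero_iff h0 x.2).1 hx
      exact ⟨⟨(x : F) / τ, v.mem_ring.2 (by rw [v.ord_div h0 hτ0]; omega)⟩,
        Subtype.ext (mul_div_cancel₀ _ hτ0).symm⟩
  · rintro ⟨y, rfl⟩
    change v.res ((τ : F) * y) = 0
    rw [v.res_mul (by omega) y.2, (v.res_eq_zero_iff hτ0 (by omega)).2 (by omega), zero_mul]

end Ring

variable {k F K ι : Type*} [Field k] [Field F] [Field K] [Algebra k F] [Algebra k K] [Algebra F K]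

/-- The place `P` of `K` lies over the place `v` of `F`. -/
def LiesOver (P : Place k K) (v : Place k F) : Prop :=
  ∀ x : F, 0 ≤ v.ord x → 0 ≤ P.ord (algebraMap F K x) ∧ P.res (algebraMap F K x) = v.res x

/-- A family of places of `K / k` containing each non-trivial valuation ring of `K / k`
exactly once. -/
def Complete (p : ι → Place k K) : Prop :=
  Function.Injective (fun i => (p i).valuationSubring) ∧
    ∀ V : ValuationSubring K, (∀ c, algebraMap k K c ∈ V) → V ≠ ⊤ →
      ∃ i, (p i).valuationSubring = V

lemma ord_ring_eq {v : Place k F} {τ : F} (hτ : v.ord τ = 1) {x : F} (hx : x ≠ 0) :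
    ∃ u : F, v.ord u = 0 ∧ u ≠ 0 ∧ x = τ ^ v.ord x * u := by
  have hτ0 : τ ≠ 0 := v.ne_zero_of_ord_ne (by omega)
  refine ⟨x / τ ^ v.ord x, ?_, div_ne_zero hx (zpow_ne_zero _ hτ0),
    (mul_div_cancel₀ _ (zpow_ne_zero _ hτ0)).symm⟩
  rw [v.ord_div hx (zpow_ne_zero _ hτ0), v.ord_zpow, hτ]; ring

namespace LiesOver

variable {P : Place k K} {v : Place k F} (h : P.LiesOver v)
include h

lemma ord_eq_zero {u : F} (hu0 : u ≠ 0) (hu : v.ord u = 0) : P.ord (algebraMap F K u) = 0 := by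
  refine P.ord_eq_zero_of_res_ne_zero (h u hu.ge).1 ?_
  rw [(h u hu.ge).2]
  exact v.res_ne_zero hu0 hu

/-- The factor `P.ord (algebraMap F K τ)` is the ramification index of `P` over `v`. -/
lemma ord_eq {τ : F} (hτ : v.ord τ = 1) (x : F) :
    P.ord (algebraMap F K x) = P.ord (algebraMap F K τ) * v.ord x := by
  rcases eq_or_ne x 0 with rfl | hx
  · simp [ord_zero]
  have hτ0 : algebraMap F K τ ≠ 0 := by
    simpa using v.ne_zero_of_ord_ne (x := τ) (by omega)
  obtain ⟨u, hu, hu0, hxu⟩ := ord_ring_eq hτ hx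
  conv_lhs => rw [hxu]
  rw [map_mul, map_zpow₀, P.ord_mul (zpow_ne_zero _ hτ0) (by simpa), P.ord_zpow,
    h.ord_eq_zero hu0 hu]
  ring

lemma ord_pos {τ : F} (hτ : v.ord τ = 1) : 0 < P.ord (algebraMap F K τ) := by
  have hτ0 : algebraMap F K τ ≠ 0 := by
    simpa using v.ne_zero_of_ord_ne (x := τ) (by omega)
  rw [← P.res_eq_zero_iff hτ0 (h τ (by omega)).1, (h τ (by omega)).2,
    v.res_eq_zero_iff (by simpa using hτ0) (by omega)]
  omega

/-- The valuation ring of `P` contains the image of `v.ring` and is integrally closed. -/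
lemma nonneg_of_isIntegral {b : K} (hb : IsIntegral v.ring b) : 0 ≤ P.ord b := by
  let φ : v.ring →+* P.valuationSubring :=
    { toFun := fun x => ⟨algebraMap F K x, (h x x.2).1⟩
      map_one' := Subtype.ext (by simp)
      map_mul' := fun x y => Subtype.ext (by simp)
      map_zero' := Subtype.ext (by simp)
      map_add' := fun x y => Subtype.ext (by simp) }
  have h1 : IsIntegral P.valuationSubring b := by
    refine RingHom.IsIntegralElem.of_comp (f := φ) (g := algebraMap P.valuationSubring K) ?_
    exact hb
  obtain ⟨y, rfl⟩ := (IsIntegrallyClosed.isIntegral_iff (R := P.valuationSubring)).1 h1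
  exact y.2

/-- Evaluation at a place lying over `v`, on the integral closure of the ring of `v`. -/
def evalHom : integralClosure v.ring K →+* k where
  toFun b := P.res (b : K)
  map_one' := P.res_one
  map_mul' x y := P.res_mul (h.nonneg_of_isIntegral x.2) (h.nonneg_of_isIntegral y.2)
  map_zero' := P.res_zero
  map_add' x y := P.res_add (h.nonneg_of_isIntegral x.2) (h.nonneg_of_isIntegral y.2)

end LiesOver

section IntegralClosure

variable [IsScalarTower k F K] [FiniteDimensional F K] [Algebra.IsSeparable F K] (v : Place k F)

instance : IsFractionRing (integralClosure v.ring K) K :=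
  integralClosure.isFractionRing_of_finite_extension F K

instance : IsDedekindDomain (integralClosure v.ring K) :=
  integralClosure.isDedekindDomain v.ring F K

instance : Module.Finite v.ring (integralClosure v.ring K) :=
  IsIntegralClosure.finite v.ring F K _

instance : Module.Free v.ring (integralClosure v.ring K) :=
  have : Module.IsTorsionFree v.ring K :=
    Module.isTorsionFree_iff_algebraMap_injective.2
      ((algebraMap F K).injective.comp Subtype.val_injective)
  IsIntegralClosure.module_free v.ring F K _

-- A non-zero prime lies over the maximal ideal of `v.ring`, and a finite algebra has only finitely
-- many such primes.
variable (K) in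
lemma finite_primes_integralClosure :
    {I : Ideal (integralClosure v.ring K) | I.IsPrime}.Finite := by
  have hfin := (Algebra.QuasiFinite.finite_primesOver (S := integralClosure v.ring K)
    (IsLocalRing.maximalIdeal v.ring)).union (Set.finite_singleton ⊥)
  refine hfin.subset fun I (hI : I.IsPrime) => ?_
  by_cases hb : I = ⊥
  · exact .inr hb
  · have : I.IsMaximal := hI.isMaximal hb
    have h2 : (I.comap (algebraMap v.ring (integralClosure v.ring K))).IsMaximal :=
      Ideal.isMaximal_comap_of_isIntegral_of_isMaximal I
    exact .inl ⟨hI, ⟨(IsLocalRing.eq_maximalIdeal h2).symm⟩⟩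

/-- Dedekind with finitely many primes. Unique factorization into elements is what later reduces the
projection formula to units and primes. -/
instance : IsPrincipalIdealRing (integralClosure v.ring K) :=
  IsPrincipalIdealRing.of_finite_primes (finite_primes_integralClosure K v)

-- Some non-zero element of `v.ring` is a multiple of `q`, which forces `τ` to have positive order
-- at `P`. An element regular at `v` differs from its residue by an element of positive order at
-- `v`, hence also at `P`, so the residues agree.
omit [FiniteDimensional F K] [Algebra.IsSeparable F K] in
lemma liesOver_of_nonneg_of_pos {τ : F} (hτ : v.ord τ = 1) {P : Place k K}
    (hP : ∀ b : integralClosure v.ring K, 0 ≤ P.ord (b : K)) {q : integralClosure v.ring K}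
    (hq0 : q ≠ 0) (hq : 0 < P.ord (q : K)) : P.LiesOver v := by
  have hreg : ∀ x : F, 0 ≤ v.ord x → 0 ≤ P.ord (algebraMap F K x) := fun x hx =>
    hP (algebraMap v.ring _ ⟨x, hx⟩)
  have hunit : ∀ x : F, x ≠ 0 → v.ord x = 0 → P.ord (algebraMap F K x) = 0 := fun x hx0 hx => by
    have h1 := hreg x hx.ge
    have h2 := hreg x⁻¹ (by rw [ord_inv, hx]; simp)
    rw [map_inv₀, ord_inv] at h2
    omega
  have hτ0 : τ ≠ 0 := v.ne_zero_of_ord_ne (by omega)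
  have hτ0' : algebraMap F K τ ≠ 0 := by simpa
  have hτpos : 0 < P.ord (algebraMap F K τ) := by
    -- By integrality a non-zero ideal of the integral closure meets `v.ring` in a non-zero ideal.
    have hne := Ideal.comap_ne_bot_of_integral_mem (R := v.ring) (I := Ideal.span {q}) hq0
      (Ideal.mem_span_singleton_self q) (Algebra.IsIntegral.isIntegral q)
    obtain ⟨a, ha, ha0⟩ := Submodule.exists_mem_ne_zero_of_ne_bot hne
    obtain ⟨c, hc⟩ := Ideal.mem_span_singleton.1 (Ideal.mem_comap.1 ha)
    have hc' : algebraMap F K a = q * c := congrArg Subtype.val hc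
    have ha0' : (a : F) ≠ 0 := fun h => ha0 (Subtype.ext h)
    have hc0 : (c : K) ≠ 0 := by
      intro h
      rw [h, mul_zero] at hc'
      exact ha0' (by simpa using hc')
    have h1 : 0 < P.ord (algebraMap F K a) := by
      rw [hc', P.ord_mul (fun h => hq0 (Subtype.ext h)) hc0]
      have := hP c
      omega
    obtain ⟨u, hu, hu0, hau⟩ := ord_ring_eq hτ ha0'
    rw [hau, map_mul, map_zpow₀, P.ord_mul (zpow_ne_zero _ hτ0') (by simpa), ord_zpow,
      hunit u hu0 hu, add_zero] at h1
    have h2 := hreg τ (by omega)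
    rcases h2.eq_or_lt with h3 | h3
    · rw [← h3] at h1; simp at h1
    · exact h3
  intro x hx
  refine ⟨hreg x hx, ?_⟩
  have hd : v.res (x - algebraMap k F (v.res x)) = 0 := by
    rw [sub_eq_add_neg, v.res_add hx (by simp [ord_algebraMap]), v.res_neg (by simp [ord_algebraMap]),
      res_algebraMap, add_neg_cancel]
  have hdr : 0 ≤ v.ord (x - algebraMap k F (v.res x)) := by
    rw [sub_eq_add_neg]
    exact v.add_nonneg hx (by simp [ord_algebraMap])
  have hdP : P.res (algebraMap F K (x - algebraMap k F (v.res x))) = 0 := by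
    rcases eq_or_ne (x - algebraMap k F (v.res x)) 0 with h0 | h0
    · rw [h0, map_zero, res_zero]
    · have h1 := (v.res_eq_zero_iff h0 hdr).1 hd
      rw [P.res_eq_zero_iff ((map_ne_zero _).2 h0) (hreg _ hdr)]
      obtain ⟨u, hu, hu0, hau⟩ := ord_ring_eq hτ h0
      rw [hau, map_mul, map_zpow₀, P.ord_mul (zpow_ne_zero _ hτ0') (by simpa), ord_zpow,
        hunit u hu0 hu, add_zero]
      positivity
  have hsplit : algebraMap F K x = algebraMap F K (x - algebraMap k F (v.res x)) +
      algebraMap k K (v.res x) := by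
    rw [IsScalarTower.algebraMap_apply k F K, ← map_add, sub_add_cancel]
  rw [hsplit, P.res_add (hreg _ hdr) (by simp [ord_algebraMap]), hdP, res_algebraMap, zero_add]

omit [FiniteDimensional F K] [Algebra.IsSeparable F K] in
/-- Every prime of the integral closure is the centre of some place of a complete family. -/
lemma Complete.exists_liesOver {p : ι → Place k K} (hp : Complete p)
    {q : integralClosure v.ring K} (hq : Prime q) :
    ∃ i, (p i).LiesOver v ∧ (p i).res (q : K) = 0 := by
  obtain ⟨τ, hτ⟩ := v.exists_ord_one
  have hne : Ideal.span {q} ≠ ⊤ := by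
    rw [Ne, Ideal.span_singleton_eq_top]; exact hq.not_isUnit
  -- Extension of valuations: a proper ideal of a subring of `K` consists of non-units of some
  -- valuation ring containing the subring. As `q⁻¹ ∉ V`, the ring `V` is not all of `K`, and
  -- completeness provides its place.
  obtain ⟨V, hV, hqV⟩ := Ideal.image_subset_nonunits_valuationSubring
    (A := (integralClosure v.ring K).toSubring) (Ideal.span {q}) hne
  have hq0 : (q : K) ≠ 0 := fun h => hq.ne_zero (Subtype.ext h)
  have hqn : (q : K) ∈ V.nonunits := hqV ⟨q, Ideal.mem_span_singleton_self q, rfl⟩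
  have hqinv : (q : K)⁻¹ ∉ V := fun h => by
    rw [ValuationSubring.mem_nonunits_iff] at hqn
    have h1 := (V.valuation_le_one_iff _).2 h
    rw [map_inv₀] at h1
    have h2 : V.valuation (q : K) ≠ 0 := by simpa using hq0
    exact h1.not_gt ((one_lt_inv₀ (zero_lt_iff.2 h2)).2 hqn)
  obtain ⟨i, hi⟩ := hp.2 V (fun c => hV (by
    have := (algebraMap v.ring (integralClosure v.ring K) (algebraMap k v.ring c)).2
    rwa [show ((algebraMap v.ring (integralClosure v.ring K) (algebraMap k v.ring c) :
      integralClosure v.ring K) : K) = algebraMap k K c from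
        (IsScalarTower.algebraMap_apply k F K c).symm] at this)) (by rintro rfl; exact hqinv trivial)
  have hord : ∀ b : integralClosure v.ring K, 0 ≤ (p i).ord (b : K) := fun b => by
    rw [← mem_valuationSubring, hi]; exact hV b.2
  have hqpos : 0 < (p i).ord (q : K) := by
    rw [← hi, mem_valuationSubring, ord_inv] at hqinv
    omega
  exact ⟨i, liesOver_of_nonneg_of_pos v hτ hord hq.ne_zero hqpos,
    ((p i).res_eq_zero_iff hq0 (hord q)).2 hqpos⟩

end IntegralClosure

end Place

end RefinedParshin

end

/-! ### Places over a given place and primes of the integral closure -/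

noncomputable section

set_option linter.unusedSectionVars false

namespace RefinedParshin

namespace Place

variable {k F K ι : Type*} [Field k] [Field F] [Field K] [Algebra k F] [Algebra k K] [Algebra F K]
  [IsScalarTower k F K] [FiniteDimensional F K] [Algebra.IsSeparable F K] {v : Place k F}

lemma exists_eq_zpow_mul_div {q : integralClosure v.ring K} (hq : Prime q) {x : K} (hx : x ≠ 0) :
    ∃ (n : ℤ) (c d : integralClosure v.ring K), ¬ q ∣ c ∧ ¬ q ∣ d ∧
      x = (q : K) ^ n * (c / d) := by
  obtain ⟨a, b, hb, rfl⟩ := IsFractionRing.div_surjective (A := integralClosure v.ring K) x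
  have hb0 : b ≠ 0 := nonZeroDivisors.ne_zero hb
  have ha0 : a ≠ 0 := by rintro rfl; simp at hx
  obtain ⟨m, c, hc, rfl⟩ := WfDvdMonoid.max_power_factor ha0 hq.irreducible
  obtain ⟨n, d, hd, rfl⟩ := WfDvdMonoid.max_power_factor hb0 hq.irreducible
  have hq0 : (q : K) ≠ 0 := fun h => hq.ne_zero (Subtype.ext h)
  refine ⟨m - n, c, d, hc, hd, ?_⟩
  simp only [map_mul, map_pow]
  rw [zpow_sub₀ hq0, zpow_natCast, zpow_natCast, mul_div_mul_comm]
  rfl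

namespace LiesOver

variable {P P' : Place k K} (h : P.LiesOver v) {q : integralClosure v.ring K} (hq : Prime q)
  (hqP : P.res (q : K) = 0)
include h hq hqP

/-- In a Dedekind domain the ideal `(q)` is already maximal, and it is contained in the proper ideal
on the left. -/
lemma ker_evalHom : RingHom.ker h.evalHom = Ideal.span {q} := by
  have h1 : (Ideal.span {q}).IsMaximal :=
    ((Ideal.span_singleton_prime hq.ne_zero).2 hq).isMaximal
      (by simpa [Ideal.span_singleton_eq_bot] using hq.ne_zero)
  refine (h1.eq_of_le (RingHom.ker_ne_top _) ?_).symm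
  rw [Ideal.span_singleton_le_iff_mem]
  exact hqP

lemma res_eq_zero_iff_dvd (b : integralClosure v.ring K) : P.res (b : K) = 0 ↔ q ∣ b := by
  rw [← Ideal.mem_span_singleton, ← h.ker_evalHom hq hqP]
  rfl

lemma ord_eq_zero_of_not_dvd {b : integralClosure v.ring K} (hb : ¬ q ∣ b) : P.ord (b : K) = 0 :=
  P.ord_eq_zero_of_res_ne_zero (h.nonneg_of_isIntegral b.2)
    (mt (h.res_eq_zero_iff_dvd hq hqP b).1 hb)

lemma ord_zpow_mul_div {c d : integralClosure v.ring K} (hc : ¬ q ∣ c) (hd : ¬ q ∣ d) (n : ℤ) :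
    P.ord ((q : K) ^ n * (c / d)) = n * P.ord (q : K) := by
  have h0 : ∀ {b : integralClosure v.ring K}, ¬ q ∣ b → (b : K) ≠ 0 := fun hb h => by
    obtain rfl : _ = 0 := Subtype.ext h
    exact hb (dvd_zero q)
  have hq0 : (q : K) ≠ 0 := fun h => hq.ne_zero (Subtype.ext h)
  rw [P.ord_mul (zpow_ne_zero _ hq0) (div_ne_zero (h0 hc) (h0 hd)), P.ord_zpow,
    P.ord_div (h0 hc) (h0 hd), h.ord_eq_zero_of_not_dvd hq hqP hc,
    h.ord_eq_zero_of_not_dvd hq hqP hd]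
  ring

/-- Every order is a multiple of `P.ord q`, and the value 1 is taken; so `P.ord q` divides 1, and it
is positive. -/
lemma ord_prime : P.ord (q : K) = 1 := by
  obtain ⟨x, hx⟩ := P.exists_ord_one
  obtain ⟨n, c, d, hc, hd, rfl⟩ := exists_eq_zpow_mul_div hq (P.ne_zero_of_ord_ne (x := x) (by omega))
  rw [h.ord_zpow_mul_div hq hqP hc hd] at hx
  have hq0 : (q : K) ≠ 0 := fun h => hq.ne_zero (Subtype.ext h)
  have hpos := (P.res_eq_zero_iff hq0 (h.nonneg_of_isIntegral q.2)).1 hqP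
  rcases Int.eq_one_or_neg_one_of_mul_eq_one' hx with h1 | h1 <;> omega

lemma ord_eq_ord (h' : P'.LiesOver v) (hqP' : P'.res (q : K) = 0) (x : K) :
    P.ord x = P'.ord x := by
  rcases eq_or_ne x 0 with rfl | hx
  · simp [ord_zero]
  obtain ⟨n, c, d, hc, hd, rfl⟩ := exists_eq_zpow_mul_div hq hx
  rw [h.ord_zpow_mul_div hq hqP hc hd, h'.ord_zpow_mul_div hq hqP' hc hd, h.ord_prime hq hqP,
    h'.ord_prime hq hqP']

end LiesOver

/-- Both orders are the exponent of `q`, so the two valuation rings coincide, and a complete family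
contains each only once. -/
lemma Complete.eq_of_res_eq_zero {p : ι → Place k K} (hp : Complete p) {i j : ι}
    (hi : (p i).LiesOver v) (hj : (p j).LiesOver v) {q : integralClosure v.ring K} (hq : Prime q)
    (hqi : (p i).res (q : K) = 0) (hqj : (p j).res (q : K) = 0) : i = j := by
  apply hp.1
  ext x
  simp only [mem_valuationSubring]
  rw [hi.ord_eq_ord hq hqi hj hqj]

/-- The kernel of the evaluation is a principal prime ideal, non-zero because it contains the image
of `τ`. -/
lemma LiesOver.exists_prime {P : Place k K} (h : P.LiesOver v) :
    ∃ q : integralClosure v.ring K, Prime q ∧ P.res (q : K) = 0 := by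
  obtain ⟨τ, hτ⟩ := v.exists_ord_one
  let t : integralClosure v.ring K := algebraMap v.ring _ ⟨τ, v.mem_ring.2 (by omega)⟩
  have ht : (t : K) = algebraMap F K τ := rfl
  have ht0 : (t : K) ≠ 0 := P.ne_zero_of_ord_ne (by have := h.ord_pos hτ; rw [ht]; omega)
  have htm : t ∈ RingHom.ker h.evalHom :=
    (P.res_eq_zero_iff ht0 (h.nonneg_of_isIntegral t.2)).2 (h.ord_pos hτ)
  have hprime : (RingHom.ker h.evalHom).IsPrime := RingHom.ker_isPrime _
  obtain ⟨q, hq⟩ := IsPrincipalIdealRing.principal (RingHom.ker h.evalHom)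
  rw [Ideal.submodule_span_eq] at hq
  have hq0 : q ≠ 0 := by
    rintro rfl
    rw [hq, Ideal.mem_span_singleton, zero_dvd_iff] at htm
    exact ht0 (by rw [htm]; rfl)
  refine ⟨q, (Ideal.span_singleton_prime hq0).1 (hq ▸ hprime), ?_⟩
  have : q ∈ RingHom.ker h.evalHom := hq ▸ Ideal.mem_span_singleton_self q
  exact this

-- A place over `v` is determined by the kernel of its evaluation, one of the finitely many primes
-- of the integral closure.
variable (v) in
lemma Complete.finite_liesOver {p : ι → Place k K} (hp : Complete p) :
    {i | (p i).LiesOver v}.Finite := by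
  classical
  let f : ι → Ideal (integralClosure v.ring K) := fun i =>
    if h : (p i).LiesOver v then RingHom.ker h.evalHom else ⊥
  have hf : ∀ i (h : (p i).LiesOver v), f i = RingHom.ker h.evalHom := fun i h => dif_pos h
  refine Set.Finite.of_injOn (f := f) (t := {I | I.IsPrime}) ?_ ?_ (finite_primes_integralClosure K v)
  · intro i hi
    rw [hf i hi]
    exact RingHom.ker_isPrime _
  · intro i hi j hj hij
    rw [hf i hi, hf j hj] at hij
    obtain ⟨q, hq, hqi⟩ := LiesOver.exists_prime hi
    refine hp.eq_of_res_eq_zero hi hj hq hqi ?_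
    have : q ∈ RingHom.ker (LiesOver.evalHom hi) := hqi
    rw [hij] at this
    exact this

variable (v) in
/-- The finite set of places of a complete family lying over a given place. -/
def Complete.over {p : ι → Place k K} (hp : Complete p) : Finset ι :=
  (hp.finite_liesOver v).toFinset

@[simp] lemma Complete.mem_over {p : ι → Place k K} (hp : Complete p) {i : ι} :
    i ∈ hp.over v ↔ (p i).LiesOver v := by simp [Complete.over]

/-- Evaluation as a homomorphism of `k`-algebras. -/
def LiesOver.evalAlgHom {P : Place k K} (h : P.LiesOver v) : integralClosure v.ring K →ₐ[k] k where
  __ := h.evalHom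
  commutes' c := by
    exact P.res_algebraMap c

/-- The norm of `b`, evaluated at `v`, is the product of the values of `b` at the places over `v`,
raised to the ramification indices. -/
lemma Complete.res_norm {p : ι → Place k K} (hp : Complete p) {τ : F} (hτ : v.ord τ = 1)
    (b : integralClosure v.ring K) :
    v.res (Algebra.norm v.ring b : v.ring) =
      ∏ i ∈ hp.over v, (p i).res (b : K) ^ ((p i).ord (algebraMap F K τ)).toNat := by
  classical
  let t : v.ring := ⟨τ, v.mem_ring.2 (by omega)⟩
  have ht : RingHom.ker v.resHom = Ideal.span {t} := v.ker_resHom hτ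
  let s := hp.over v
  have hs : ∀ i : s, (p i).LiesOver v := fun i => hp.mem_over.1 i.2
  have hn : ∀ (i : s) (b : integralClosure v.ring K), 0 ≤ (p i).ord (b : K) := fun i b =>
    (hs i).nonneg_of_isIntegral b.2
  have hne : ∀ b : integralClosure v.ring K, b ≠ 0 → (b : K) ≠ 0 := fun b hb h =>
    hb (Subtype.ext h)
  have hτ0 : algebraMap v.ring (integralClosure v.ring K) t ≠ 0 := fun h => by
    have h1 : algebraMap F K τ = 0 := congrArg Subtype.val h
    rw [map_eq_zero] at h1
    rw [h1, ord_zero] at hτ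
    omega
  -- The reduced norm is a determinant on the integral closure modulo `τ`. There `τ` is a unit times
  -- the product of the primes over `v` with their ramification indices as exponents.
  have h1 := map_norm_eq_det_quotient v.resHom t ht b
  have h2 := (det_mulLeft_quotient (Finset.univ : Finset s) (fun i => (hs i).evalAlgHom)
    (fun i b => ((p i).ord (b : K)).toNat) ?_ ?_ ?_ b _ hτ0).2
  · rw [← resHom_apply, h1, h2, ← Finset.prod_coe_sort s]
    rfl
  · intro i _ x y hx hy
    have := (p i).ord_mul (hne x hx) (hne y hy)
    have h3 := hn i x
    have h4 := hn i y
    change ((p i).ord ((x : K) * y)).toNat = _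
    rw [this]
    omega
  · intro i _ x hx
    have h3 : (hs i).evalHom x ≠ 0 := (hx.map (hs i).evalHom).ne_zero
    rw [(p i).ord_eq_zero_of_res_ne_zero (hn i x) h3]
    rfl
  · intro q hq
    obtain ⟨i, hi, hqi⟩ := hp.exists_liesOver v hq
    refine ⟨⟨i, hp.mem_over.2 hi⟩, Finset.mem_univ _, hi.ker_evalHom hq hqi, ?_, ?_⟩
    · rw [hi.ord_prime hq hqi]; rfl
    · intro j _ hji
      rw [(p j).ord_eq_zero_of_res_ne_zero (hn j q) fun h0 => hji (Subtype.ext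
        (hp.eq_of_res_eq_zero (hs j) hi hq h0 hqi))]
      rfl

end Place

end RefinedParshin

end

/-! ### The projection formula for tame symbols -/

noncomputable section

set_option linter.unusedSectionVars false

namespace RefinedParshin

section

variable {A B : Type*} [CommRing A] [CommRing B] [Algebra A B] [Module.Free A B] [Module.Finite A B]

lemma eval_charpoly_lmul (b : B) (c : A) :
    (LinearMap.charpoly (Algebra.lmul A B b)).eval c = Algebra.norm A (algebraMap A B c - b) := by
  have h : algebraMap A _ c - Algebra.lmul A B b = Algebra.lmul A B (algebraMap A B c - b) := by
    rw [map_sub]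
    congr 1
    ext x
    simp [Algebra.smul_def]
  rw [LinearMap.eval_charpoly, Algebra.norm_apply, h]

lemma aeval_charpoly_lmul (b : B) :
    Polynomial.aeval b (LinearMap.charpoly (Algebra.lmul A B b)) = 0 := by
  apply Algebra.lmul_injective (R := A)
  rw [← Polynomial.aeval_algHom_apply, map_zero]
  exact LinearMap.aeval_self_charpoly _

end

namespace Place

lemma res_eq_zero_of_pos {k K : Type*} [Field k] [Field K] [Algebra k K] (P : Place k K) {x : K}
    (hx : x = 0 ∨ 0 < P.ord x) : 0 ≤ P.ord x ∧ P.res x = 0 := by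
  rcases hx with rfl | hx
  · simp [P.ord_zero]
  · exact ⟨hx.le, (P.res_eq_zero_iff (P.ne_zero_of_ord_ne hx.ne') hx.le).2 hx⟩

variable {k F K ι : Type*} [Field k] [Field F] [Field K] [Algebra k F] [Algebra k K] [Algebra F K]
  [IsScalarTower k F K] [FiniteDimensional F K] [Algebra.IsSeparable F K] {v : Place k F}

lemma norm_coe_integralClosure (b : integralClosure v.ring K) :
    Algebra.norm F (b : K) = (Algebra.norm v.ring b : v.ring) := by
  have h := Algebra.algebraMap_intNorm (A := v.ring) (K := F) (L := K) (B := integralClosure v.ring K) b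
  rw [Algebra.intNorm_eq_norm] at h
  exact h.symm

section

variable {p : ι → Place k K} (hp : Complete p) {τ : F} (hτ : v.ord τ = 1)
include hp hτ

-- At a constant `c` the characteristic polynomial has the value N(c - q), which `Complete.res_norm`
-- evaluates at `v`. As `k` is infinite, these values determine the polynomial.
open Polynomial in
lemma Complete.map_charpoly [Infinite k] (q : integralClosure v.ring K) :
    (LinearMap.charpoly (Algebra.lmul v.ring _ q)).map (v.resHom : v.ring →+* k) =
      ∏ i ∈ hp.over v, (X - C ((p i).res (q : K))) ^ ((p i).ord (algebraMap F K τ)).toNat := by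
  apply Polynomial.funext
  intro c
  have h1 : (c : k) = (v.resHom : v.ring →+* k) (algebraMap k v.ring c) := by simp
  conv_lhs => rw [h1]
  rw [Polynomial.eval_map_apply, eval_charpoly_lmul]
  change v.res (Algebra.norm v.ring (algebraMap v.ring _ (algebraMap k v.ring c) - q) : v.ring) = _
  rw [hp.res_norm hτ, Polynomial.eval_prod]
  refine Finset.prod_congr rfl fun i hi => ?_
  have hi := hp.mem_over.1 hi
  rw [Polynomial.eval_pow, Polynomial.eval_sub, Polynomial.eval_X, Polynomial.eval_C]
  congr 1
  have h3 : (p i).res (algebraMap k K c) = c := (p i).res_algebraMap c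
  conv_rhs => rw [← h3]
  rw [IsScalarTower.algebraMap_apply k F K c]
  have h4 := hi.evalHom.map_sub (algebraMap v.ring _ (algebraMap k v.ring c)) q
  exact h4

/-- The prime `q` vanishes at a single place i over `v`. With e the ramification index there, the
characteristic polynomial χ of `q` reduces to X^e G with G(0) ≠ 0. In χ(q)/q^e = 0 only the terms of
degree 0 and e have non-zero residue at i, so χ(0)/q^e has residue -G(0). Since N q = ±χ(0), this
gives both its order and its leading coefficient. -/
lemma Complete.norm_prime [Infinite k] {q : integralClosure v.ring K} (hq : Prime q) :
    v.ord (Algebra.norm F (q : K)) = ∑ i ∈ hp.over v, (p i).ord (q : K) ∧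
      v.tame τ (Algebra.norm F (q : K)) =
        ∏ i ∈ hp.over v, (p i).tame (algebraMap F K τ) (q : K) := by
  classical
  obtain ⟨i, hi, hqi⟩ := hp.exists_liesOver v hq
  have his : i ∈ hp.over v := hp.mem_over.2 hi
  have hordi := hi.ord_prime hq hqi
  have hqj : ∀ j ∈ (hp.over v).erase i, (p j).ord (q : K) = 0 := fun j hj => by
    have hj' := hp.mem_over.1 (Finset.mem_of_mem_erase hj)
    exact (p j).ord_eq_zero_of_res_ne_zero (hj'.nonneg_of_isIntegral q.2) fun h0 =>
      Finset.ne_of_mem_erase hj (hp.eq_of_res_eq_zero hj' hi hq h0 hqi)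
  have hq0 : (q : K) ≠ 0 := fun h => hq.ne_zero (Subtype.ext h)
  set t := algebraMap F K τ with ht
  have ht0 : t ≠ 0 := by
    rw [ht]; simpa using v.ne_zero_of_ord_ne (x := τ) (by omega)
  have hpos : 0 < (p i).ord t := hi.ord_pos hτ
  obtain ⟨e, he⟩ := Int.eq_ofNat_of_zero_le hpos.le
  let χ := LinearMap.charpoly (Algebra.lmul v.ring _ q)
  let G : Polynomial k := ∏ j ∈ (hp.over v).erase i,
    (Polynomial.X - Polynomial.C ((p j).res (q : K))) ^ ((p j).ord t).toNat
  have hχ : χ.map (v.resHom : v.ring →+* k) = Polynomial.X ^ e * G := by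
    rw [hp.map_charpoly hτ, ← Finset.mul_prod_erase _ _ his, hqi, map_zero, sub_zero, ← ht, he]
    rfl
  let M := ∑ j ∈ (hp.over v).erase i, ((p j).ord t).toNat
  have hN : χ.natDegree = e + M := by
    rw [← (LinearMap.charpoly_monic _).natDegree_map (v.resHom : v.ring →+* k)]
    change (χ.map _).natDegree = _
    have hmonic : ∀ j ∈ (hp.over v).erase i,
        ((Polynomial.X - Polynomial.C ((p j).res (q : K))) ^ ((p j).ord t).toNat).Monic :=
      fun j _ => (Polynomial.monic_X_sub_C _).pow _
    rw [hχ, (Polynomial.monic_X_pow e).natDegree_mul (Polynomial.monic_prod_of_monic _ _ hmonic),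
      Polynomial.natDegree_X_pow, Polynomial.natDegree_prod_of_monic _ _ hmonic]
    congr 1
    refine Finset.sum_congr rfl fun j _ => ?_
    rw [(Polynomial.monic_X_sub_C _).natDegree_pow, Polynomial.natDegree_X_sub_C, mul_one]
  let R := ∏ j ∈ (hp.over v).erase i, (p j).res (q : K) ^ ((p j).ord t).toNat
  have hG0 : G.coeff 0 = (-1) ^ M * R := by
    rw [Polynomial.coeff_zero_eq_eval_zero, Polynomial.eval_prod, ← Finset.prod_pow_eq_pow_sum,
      ← Finset.prod_mul_distrib]
    refine Finset.prod_congr rfl fun j _ => ?_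
    simp [← neg_pow]
  have hR0 : R ≠ 0 := Finset.prod_ne_zero_iff.2 fun j hj =>
    pow_ne_zero _ ((p j).res_ne_zero hq0 (hqj j hj))
  have hG00 : G.coeff 0 ≠ 0 := by
    rw [hG0]; exact mul_ne_zero (pow_ne_zero _ (by simp)) hR0
  have hcoeff : ∀ l, v.res (χ.coeff l : F) = if e ≤ l then G.coeff (l - e) else 0 := fun l => by
    have := congrArg (fun f => Polynomial.coeff f l) hχ
    simp only [Polynomial.coeff_map, Polynomial.coeff_X_pow_mul'] at this
    exact this
  let f : ℕ → K := fun l => algebraMap F K (χ.coeff l) * (q : K) ^ l / (q : K) ^ e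
  have hsum : ∑ l ∈ Finset.range (e + M + 1), f l = 0 := by
    have h1 : Polynomial.aeval q χ = 0 := aeval_charpoly_lmul q
    rw [Polynomial.aeval_eq_sum_range, hN] at h1
    have h2 := congrArg (algebraMap (integralClosure v.ring K) K) h1
    rw [map_sum, map_zero] at h2
    rw [← Finset.sum_div, div_eq_zero_iff]
    left
    rw [← h2]
    refine Finset.sum_congr rfl fun l _ => ?_
    rw [Algebra.smul_def, map_mul, map_pow]
    rfl
  -- For l < e the coefficient is divisible by `τ`, hence has order at least e at i, or is zero;
  -- adding l - e leaves at least l > 0. For l > e the power of `q` is positive. The degree l = 0 is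
  -- excluded: its residue is what is sought.
  have hterm : ∀ l, 1 ≤ l → 0 ≤ (p i).ord (f l) ∧
      (p i).res (f l) = if l = e then G.coeff 0 else 0 := fun l hl => by
    have hreg := hi _ (χ.coeff l).2
    rcases eq_or_ne l e with rfl | hle
    · have : f l = algebraMap F K (χ.coeff l) := mul_div_cancel_right₀ _ (pow_ne_zero _ hq0)
      rw [this]
      refine ⟨hreg.1, ?_⟩
      rw [hreg.2, hcoeff]
      simp
    · rw [if_neg hle]
      apply res_eq_zero_of_pos
      rcases eq_or_ne (χ.coeff l : F) 0 with h0 | h0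
      · left
        simp only [f, h0, map_zero, zero_mul, zero_div]
      · right
        have h0' : algebraMap F K (χ.coeff l) ≠ 0 := by simpa using h0
        have : (p i).ord (f l) = (p i).ord (algebraMap F K (χ.coeff l)) + l - e := by
          rw [(p i).ord_div (mul_ne_zero h0' (pow_ne_zero _ hq0)) (pow_ne_zero _ hq0),
            (p i).ord_mul h0' (pow_ne_zero _ hq0), ord_pow, ord_pow, hordi]
          ring
        rw [this]
        rcases lt_or_gt_of_ne hle with hlt | hgt
        · have h1 := hcoeff l
          rw [if_neg (by omega)] at h1
          have h2 := (v.res_eq_zero_iff h0 (χ.coeff l).2).1 h1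
          rw [hi.ord_eq hτ, ← ht, he]
          have : (e : ℤ) * 1 ≤ e * v.ord (χ.coeff l : F) := by gcongr; omega
          omega
        · have := hreg.1
          omega
  have hf0 : f 0 = -∑ l ∈ Finset.range (e + M), f (l + 1) := by
    rw [Finset.sum_range_succ'] at hsum
    linear_combination hsum
  have hres := (p i).res_sum (Finset.range (e + M)) (fun l => f (l + 1))
    fun l _ => (hterm (l + 1) (by omega)).1
  have hres0 : (p i).res (f 0) = -G.coeff 0 := by
    rw [hf0, (p i).res_neg hres.2, hres.1,
      Finset.sum_congr rfl fun l _ => (hterm (l + 1) (by omega)).2]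
    congr 1
    -- The sum runs over l + 1, so degree e occurs at index e - 1; ramification gives e ≥ 1.
    rw [Finset.sum_eq_single (e - 1)]
    · rw [if_pos (by omega)]
    · intro l _ hl
      rw [if_neg (by omega)]
    · intro h
      exact absurd (Finset.mem_range.2 (by omega)) h
  have hord0 : (p i).ord (f 0) = 0 := by
    apply (p i).ord_eq_zero_of_res_ne_zero
    · rw [hf0, ord_neg]; exact hres.2
    · rw [hres0, neg_ne_zero]; exact hG00
  have hf00 : f 0 ≠ 0 := by
    intro h
    rw [h, res_zero] at hres0
    exact hG00 (by simpa using hres0.symm)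
  have hnorm : Algebra.norm F (q : K) = (-1) ^ (e + M) * (χ.coeff 0 : F) := by
    rw [norm_coe_integralClosure, Algebra.norm_apply, LinearMap.det_eq_sign_charpoly_coeff,
      ← hN, LinearMap.charpoly_natDegree]
    rfl
  have hnormK : algebraMap F K (Algebra.norm F (q : K)) = (-1) ^ (e + M) * (f 0 * (q : K) ^ e) := by
    rw [hnorm]
    simp only [f, pow_zero, mul_one, map_mul, map_pow, map_neg, map_one,
      div_mul_cancel₀ _ (pow_ne_zero e hq0)]
  have hsign : ∀ n : ℕ, ((-1 : K)) ^ n ≠ 0 := fun n => pow_ne_zero _ (by simp)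
  -- At i the norm has order e because `f 0` has order 0 and `q` has order 1; dividing by the
  -- ramification index gives 1.
  have hordN : v.ord (Algebra.norm F (q : K)) = 1 := by
    have h1 := hi.ord_eq hτ (Algebra.norm F (q : K))
    rw [hnormK, (p i).ord_mul (hsign _) (mul_ne_zero hf00 (pow_ne_zero _ hq0)),
      (p i).ord_mul hf00 (pow_ne_zero _ hq0), ord_pow, ord_pow, ord_neg, ord_one, hord0, hordi,
      ← ht, he] at h1
    have h2 : (e : ℤ) ≠ 0 := by rw [he] at hpos; simpa using hpos.ne'
    apply mul_left_cancel₀ h2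
    simpa using h1.symm
  refine ⟨?_, ?_⟩
  · rw [hordN, ← Finset.add_sum_erase _ _ his, Finset.sum_eq_zero hqj, hordi, add_zero]
  · have hN0 : Algebra.norm F (q : K) ≠ 0 := v.ne_zero_of_ord_ne (by omega)
    have hτ0 : τ ≠ 0 := v.ne_zero_of_ord_ne (by omega)
    have hw : (p i).ord (t / (q : K) ^ e) = 0 := by
      rw [(p i).ord_div ht0 (pow_ne_zero _ hq0), ord_pow, hordi, he]; simp
    have hvres : v.res (τ / Algebra.norm F (q : K)) =
        (-1) ^ (e + M) * ((p i).res (t / (q : K) ^ e) / -G.coeff 0) := by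
      have hdiv : v.ord (τ / Algebra.norm F (q : K)) = 0 := by
        rw [v.ord_div hτ0 hN0, hτ, hordN]; rfl
      rw [← (hi _ hdiv.ge).2, map_div₀, ← ht, hnormK, ← hres0, ← (p i).res_div hw.ge hord0]
      have : (-1 : k) ^ (e + M) = (p i).res ((-1) ^ (e + M)) := by
        rw [(p i).res_pow (by simp), (p i).res_neg (by simp), res_one]
      rw [this, ← (p i).res_mul]
      · congr 1
        rcases neg_one_pow_eq_or K (e + M) with h | h <;> rw [h] <;> field_simp
      · simp [ord_pow]
      · rw [(p i).ord_div (div_ne_zero ht0 (pow_ne_zero _ hq0)) hf00, hw, hord0]; rfl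
    have hti : (p i).tame t (q : K) = (-1) ^ e * (p i).res (t / (q : K) ^ e) := by
      rw [tame, hordi, he]; simp
    have htj : ∀ j ∈ (hp.over v).erase i,
        (p j).tame t (q : K) = ((p j).res (q : K) ^ ((p j).ord t).toNat)⁻¹ := fun j hj => by
      have hj' := hp.mem_over.1 (Finset.mem_of_mem_erase hj)
      rw [(p j).tame_swap hq0 ht0, tame_of_ord_left_eq_zero _ (hqj j hj), ← zpow_natCast,
        Int.toNat_of_nonneg (hj'.ord_pos hτ).le]
    rw [← Finset.mul_prod_erase _ _ his, hti, Finset.prod_congr rfl htj, Finset.prod_inv_distrib,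
      tame, hτ, hordN, zpow_one, zpow_one, hvres, hG0]
    change _ = (-1) ^ e * (p i).res (t / (q : K) ^ e) * R⁻¹
    -- The sign -1 of the symbol below, whose two orders are 1, cancels that of -G(0), and (-1)^M
    -- cancels that in G(0) = (-1)^M R. The sign (-1)^e of the symbol at i remains.
    rw [pow_add]
    rcases neg_one_pow_eq_or k M with h | h <;> rw [h] <;> field_simp <;> simp

/-- All orders of `u` vanish, so the symbol above is the residue of `u` to minus the ramification
index, and the formula is `Complete.res_norm` inverted. -/
lemma Complete.norm_isUnit {u : integralClosure v.ring K} (hu : IsUnit u) :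
    v.ord (Algebra.norm F (u : K)) = ∑ i ∈ hp.over v, (p i).ord (u : K) ∧
      v.tame τ (Algebra.norm F (u : K)) =
        ∏ i ∈ hp.over v, (p i).tame (algebraMap F K τ) (u : K) := by
  have hu0 : (u : K) ≠ 0 := fun h => hu.ne_zero (Subtype.ext h)
  have hτ0 : τ ≠ 0 := v.ne_zero_of_ord_ne (by omega)
  have hord : ∀ i ∈ hp.over v, (p i).ord (u : K) = 0 := fun i hi => by
    have hi := hp.mem_over.1 hi
    have h3 : hi.evalHom u ≠ 0 := (hu.map hi.evalHom).ne_zero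
    exact (p i).ord_eq_zero_of_res_ne_zero (hi.nonneg_of_isIntegral u.2) h3
  have hN : v.ord (Algebra.norm F (u : K)) = 0 := by
    rw [norm_coe_integralClosure]
    exact (v.isUnit_ring_iff.1 (hu.map (Algebra.norm v.ring))).2
  have hN0 : Algebra.norm F (u : K) ≠ 0 := by simpa [Algebra.norm_eq_zero_iff] using hu0
  refine ⟨by rw [hN, Finset.sum_eq_zero hord], ?_⟩
  rw [v.tame_swap hN0 hτ0, tame_of_ord_left_eq_zero _ hN, hτ, zpow_one, norm_coe_integralClosure,
    hp.res_norm hτ, ← Finset.prod_inv_distrib]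
  refine Finset.prod_congr rfl fun i hi => ?_
  rw [(p i).tame_swap hu0 (by simpa), tame_of_ord_left_eq_zero _ (hord i hi), ← zpow_natCast,
    Int.toNat_of_nonneg ((hp.mem_over.1 hi).ord_pos hτ).le]

/-- Both identities are multiplicative in `g`, and the units and primes of the integral closure
generate the multiplicative group of `K`. -/
lemma Complete.norm_uniformizer [Infinite k] {g : K} (hg : g ≠ 0) :
    v.ord (Algebra.norm F g) = ∑ i ∈ hp.over v, (p i).ord g ∧
      v.tame τ (Algebra.norm F g) = ∏ i ∈ hp.over v, (p i).tame (algebraMap F K τ) g := by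
  have hτ0 : τ ≠ 0 := v.ne_zero_of_ord_ne (by omega)
  have ht0 : algebraMap F K τ ≠ 0 := by simpa
  have hmul : ∀ {x y : K}, x ≠ 0 → y ≠ 0 →
      (v.ord (Algebra.norm F x) = ∑ i ∈ hp.over v, (p i).ord x ∧
        v.tame τ (Algebra.norm F x) = ∏ i ∈ hp.over v, (p i).tame (algebraMap F K τ) x) →
      (v.ord (Algebra.norm F y) = ∑ i ∈ hp.over v, (p i).ord y ∧
        v.tame τ (Algebra.norm F y) = ∏ i ∈ hp.over v, (p i).tame (algebraMap F K τ) y) →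
      (v.ord (Algebra.norm F (x * y)) = ∑ i ∈ hp.over v, (p i).ord (x * y) ∧
        v.tame τ (Algebra.norm F (x * y)) =
          ∏ i ∈ hp.over v, (p i).tame (algebraMap F K τ) (x * y)) := by
    intro x y hx hy h1 h2
    have hx' : Algebra.norm F x ≠ 0 := by simpa [Algebra.norm_eq_zero_iff] using hx
    have hy' : Algebra.norm F y ≠ 0 := by simpa [Algebra.norm_eq_zero_iff] using hy
    rw [map_mul, v.ord_mul hx' hy', v.tame_mul_right hτ0 hx' hy', h1.1, h1.2, h2.1, h2.2,
      ← Finset.sum_add_distrib, ← Finset.prod_mul_distrib]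
    exact ⟨Finset.sum_congr rfl fun i _ => ((p i).ord_mul hx hy).symm,
      Finset.prod_congr rfl fun i _ => ((p i).tame_mul_right ht0 hx hy).symm⟩
  have hint : ∀ b : integralClosure v.ring K, b ≠ 0 →
      (v.ord (Algebra.norm F (b : K)) = ∑ i ∈ hp.over v, (p i).ord (b : K) ∧
        v.tame τ (Algebra.norm F (b : K)) =
          ∏ i ∈ hp.over v, (p i).tame (algebraMap F K τ) (b : K)) := by
    intro b hb
    induction b using UniqueFactorizationMonoid.induction_on_prime with
    | h₁ => exact absurd rfl hb
    | h₂ u hu => exact hp.norm_isUnit hτ hu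
    | h₃ b q hb0 hq ih =>
      exact hmul (fun h => hq.ne_zero (Subtype.ext h)) (fun h => hb0 (Subtype.ext h))
        (hp.norm_prime hτ hq) (ih hb0)
  obtain ⟨a, b, hb, rfl⟩ := IsFractionRing.div_surjective (A := integralClosure v.ring K) g
  have hb0 : b ≠ 0 := nonZeroDivisors.ne_zero hb
  have ha0 : a ≠ 0 := by rintro rfl; simp at hg
  have hb0' : (b : K) ≠ 0 := fun h => hb0 (Subtype.ext h)
  obtain ⟨h1, h2⟩ := hint b hb0
  have hN : Algebra.norm F (b : K) ≠ 0 := by simpa [Algebra.norm_eq_zero_iff] using hb0'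
  rw [div_eq_mul_inv]
  refine hmul (fun h => ha0 (Subtype.ext h)) (inv_ne_zero hb0') (hint a ha0) ?_
  change v.ord (Algebra.norm F (b : K)⁻¹) = ∑ i ∈ hp.over v, (p i).ord (b : K)⁻¹ ∧
      v.tame τ (Algebra.norm F (b : K)⁻¹) =
        ∏ i ∈ hp.over v, (p i).tame (algebraMap F K τ) (b : K)⁻¹
  have hinv : Algebra.norm F (b : K)⁻¹ = (Algebra.norm F (b : K))⁻¹ := by
    apply eq_inv_of_mul_eq_one_left
    rw [← map_mul, inv_mul_cancel₀ hb0', map_one]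
  rw [hinv, v.ord_inv, v.tame_inv_right hτ0 hN, h1, h2, ← Finset.sum_neg_distrib,
    ← Finset.prod_inv_distrib]
  exact ⟨Finset.sum_congr rfl fun i _ => ((p i).ord_inv _).symm,
      Finset.prod_congr rfl fun i _ => ((p i).tame_inv_right ht0 hb0').symm⟩

omit hτ in
variable (v) in
/-- The order of the norm at a place is the sum of the orders at the places above it. -/
lemma Complete.ord_norm [Infinite k] {g : K} (hg : g ≠ 0) :
    v.ord (Algebra.norm F g) = ∑ i ∈ hp.over v, (p i).ord g := by
  obtain ⟨τ, hτ⟩ := v.exists_ord_one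
  exact (hp.norm_uniformizer hτ hg).1

omit hτ in
variable (v) in
/-- The projection formula for tame symbols. -/
theorem Complete.tame_norm [Infinite k] {a : F} {g : K} (ha : a ≠ 0) (hg : g ≠ 0) :
    v.tame a (Algebra.norm F g) = ∏ i ∈ hp.over v, (p i).tame (algebraMap F K a) g := by
  obtain ⟨τ, hτ⟩ := v.exists_ord_one
  have hτ0 : τ ≠ 0 := v.ne_zero_of_ord_ne (by omega)
  have hN : Algebra.norm F g ≠ 0 := by simpa [Algebra.norm_eq_zero_iff] using hg
  -- By bimultiplicativity `a` may be split into a power of `τ` and a unit `u` at `v`. The symbol of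
  -- a unit sees only the order of the norm, which is a sum over the places above.
  obtain ⟨u, hu, hu0, hau⟩ := ord_ring_eq hτ ha
  rw [hau, v.tame_mul_left (zpow_ne_zero _ hτ0) hu0 hN, v.tame_zpow_left hτ0 hN,
    (hp.norm_uniformizer hτ hg).2, tame_of_ord_left_eq_zero _ hu, hp.ord_norm v hg]
  have hsum : v.res u ^ (∑ i ∈ hp.over v, (p i).ord g) =
      ∏ i ∈ hp.over v, v.res u ^ (p i).ord g := by
    classical
    induction hp.over v using Finset.induction_on with
    | empty => simp
    | insert j s hj ih =>
      rw [Finset.sum_insert hj, Finset.prod_insert hj, zpow_add₀ (v.res_ne_zero hu0 hu), ih]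
  rw [hsum, ← Finset.prod_zpow, ← Finset.prod_mul_distrib]
  refine Finset.prod_congr rfl fun i hi => ?_
  have hi := hp.mem_over.1 hi
  rw [map_mul, map_zpow₀, (p i).tame_mul_left (zpow_ne_zero _ (by simpa)) (by simpa) hg,
    (p i).tame_zpow_left (by simpa) hg, (p i).tame_of_ord_left_eq_zero (hi.ord_eq_zero hu0 hu),
    (hi u hu.ge).2]

end

end Place

end RefinedParshin

end

noncomputable section

namespace RefinedParshin

namespace Place

/-! ### Places from discrete valuation rings -/

section ofDVR

variable (O : Type*) {K : Type*} [CommRing O] [IsDomain O] [IsDiscreteValuationRing O] [Field K]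
  [Algebra O K] [IsFractionRing O K]

/-- The order function of a discrete valuation ring, with value `0` at `0`. -/
def dvrOrd (x : K) : ℤ := Multiplicative.toAdd ((Ring.ordFrac O x).unzeroD 1)

variable {O}

lemma dvrOrd_zero : dvrOrd O (0 : K) = 0 := by simp [dvrOrd, WithZero.unzeroD]

lemma dvrOrd_of_ordFrac {x : K} {n : ℤ} (h : Ring.ordFrac O x = WithZero.exp n) :
    dvrOrd O x = n := by
  simp [dvrOrd, h, WithZero.exp, WithZero.unzeroD]

lemma ordFrac_eq {x : K} (hx : x ≠ 0) : Ring.ordFrac O x = WithZero.exp (dvrOrd O x) := by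
  obtain ⟨n, hn⟩ : ∃ n : ℤ, Ring.ordFrac O x = WithZero.exp n :=
    ⟨_, (WithZero.exp_log ((map_ne_zero _).2 hx)).symm⟩
  rw [hn, dvrOrd_of_ordFrac hn]

lemma dvrOrd_mul {x y : K} (hx : x ≠ 0) (hy : y ≠ 0) :
    dvrOrd O (x * y) = dvrOrd O x + dvrOrd O y :=
  dvrOrd_of_ordFrac (by rw [map_mul, ordFrac_eq hx, ordFrac_eq hy, WithZero.exp_add])

lemma dvrOrd_irreducible {ϖ : O} (hϖ : Irreducible ϖ) : dvrOrd O (algebraMap O K ϖ) = 1 :=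
  dvrOrd_of_ordFrac (Ring.ordFrac_irreducible hϖ)

lemma dvrOrd_unit (u : Oˣ) : dvrOrd O (algebraMap O K u) = 0 :=
  dvrOrd_of_ordFrac (by rw [Ring.ordFrac_of_isUnit u.isUnit, WithZero.exp_zero])

lemma dvrOrd_unit_mul_zpow (u : Oˣ) {ϖ : O} (hϖ : Irreducible ϖ) (n : ℤ) :
    dvrOrd O (algebraMap O K u * algebraMap O K ϖ ^ n) = n :=
  dvrOrd_of_ordFrac (by
    rw [map_mul, map_zpow₀, Ring.ordFrac_irreducible hϖ, Ring.ordFrac_of_isUnit u.isUnit, one_mul,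
      ← WithZero.exp_zsmul]; simp)

lemma exists_eq_unit_mul_zpow {ϖ : O} (hϖ : Irreducible ϖ) {x : K} (hx : x ≠ 0) :
    ∃ u : Oˣ, x = algebraMap O K u * algebraMap O K ϖ ^ dvrOrd O x := by
  obtain ⟨n, u, rfl⟩ := IsDiscreteValuationRing.exists_units_eq_smul_zpow_of_irreducible hϖ hx
  refine ⟨u, ?_⟩
  rw [Units.smul_def, Algebra.smul_def, dvrOrd_unit_mul_zpow u hϖ]

lemma dvrOrd_nonneg_iff {x : K} : 0 ≤ dvrOrd O x ↔ ∃ a : O, algebraMap O K a = x := by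
  obtain ⟨ϖ, hϖ⟩ := IsDiscreteValuationRing.exists_irreducible O
  constructor
  · intro h
    rcases eq_or_ne x 0 with rfl | hx
    · exact ⟨0, map_zero _⟩
    obtain ⟨u, hu⟩ := exists_eq_unit_mul_zpow hϖ hx
    lift dvrOrd O x to ℕ using h with n
    exact ⟨u * ϖ ^ n, by rw [hu]; simp⟩
  · rintro ⟨a, rfl⟩
    rcases eq_or_ne a 0 with rfl | ha
    · simp [dvrOrd_zero]
    obtain ⟨n, u, rfl⟩ := IsDiscreteValuationRing.eq_unit_mul_pow_irreducible ha hϖ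
    rw [map_mul, map_pow, ← zpow_natCast, dvrOrd_unit_mul_zpow u hϖ]
    positivity

lemma dvrOrd_eq_zero_iff {a : O} (ha : a ≠ 0) : dvrOrd O (algebraMap O K a) = 0 ↔ IsUnit a := by
  rw [Ring.isUnit_iff_ordFrac_one_of_isDiscreteValuationRing (K := K), ordFrac_eq (by simpa using ha),
    ← WithZero.exp_zero, WithZero.exp_inj]

variable {k : Type*} [Field k] [Algebra k O] [Algebra k K] [IsScalarTower k O K]

lemma ker_eq_maximalIdeal_of_algHom {O : Type*} [CommRing O] [IsLocalRing O] [Algebra k O]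
    (φ : O →ₐ[k] k) : RingHom.ker φ = IsLocalRing.maximalIdeal O := by
  have : (RingHom.ker φ).IsMaximal := RingHom.ker_isMaximal_of_surjective φ fun c =>
    ⟨algebraMap k O c, by simp⟩
  exact IsLocalRing.eq_maximalIdeal this

variable (K) in
open Classical in
/-- The place defined by a discrete valuation ring with residue field `k`. -/
def ofDVR (φ : O →ₐ[k] k) : Place k K where
  ord := dvrOrd O
  res x := if h : ∃ a : O, algebraMap O K a = x then φ h.choose else 0
  ord_zero := dvrOrd_zero
  ord_mul := dvrOrd_mul
  exists_ord_one := by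
    obtain ⟨ϖ, hϖ⟩ := IsDiscreteValuationRing.exists_irreducible O
    exact ⟨_, dvrOrd_irreducible hϖ⟩
  add_nonneg {x y} hx hy := by
    rw [dvrOrd_nonneg_iff] at *
    obtain ⟨a, rfl⟩ := hx; obtain ⟨b, rfl⟩ := hy
    exact ⟨a + b, map_add _ _ _⟩
  res_add {x y} hx hy := by
    rw [dvrOrd_nonneg_iff] at hx hy
    have hxy : ∃ c : O, algebraMap O K c = x + y :=
      ⟨hx.choose + hy.choose, by rw [map_add, hx.choose_spec, hy.choose_spec]⟩
    rw [dif_pos hx, dif_pos hy, dif_pos hxy, ← map_add]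
    congr 1
    apply IsFractionRing.injective O K
    rw [map_add, hx.choose_spec, hy.choose_spec, hxy.choose_spec]
  res_mul {x y} hx hy := by
    rw [dvrOrd_nonneg_iff] at hx hy
    have hxy : ∃ c : O, algebraMap O K c = x * y :=
      ⟨hx.choose * hy.choose, by rw [map_mul, hx.choose_spec, hy.choose_spec]⟩
    rw [dif_pos hx, dif_pos hy, dif_pos hxy, ← map_mul]
    congr 1
    apply IsFractionRing.injective O K
    rw [map_mul, hx.choose_spec, hy.choose_spec, hxy.choose_spec]
  ord_algebraMap c := by
    rcases eq_or_ne c 0 with rfl | hc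
    · simp [dvrOrd_zero]
    rw [IsScalarTower.algebraMap_apply k O K]
    exact dvrOrd_unit ((Units.mk0 c hc).map (algebraMap k O).toMonoidHom)
  res_algebraMap c := by
    have h : ∃ a : O, algebraMap O K a = algebraMap k K c :=
      ⟨algebraMap k O c, (IsScalarTower.algebraMap_apply k O K c).symm⟩
    rw [dif_pos h]
    have : h.choose = algebraMap k O c := by
      apply IsFractionRing.injective O K
      rw [h.choose_spec, IsScalarTower.algebraMap_apply k O K]
    rw [this]; simp
  res_eq_zero_iff {x} hx0 hx := by
    have h := dvrOrd_nonneg_iff.1 hx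
    rw [dif_pos h]
    have ha : h.choose ≠ 0 := fun h0 => hx0 (by rw [← h.choose_spec, h0, map_zero])
    have h1 := dvrOrd_eq_zero_iff (K := K) ha
    rw [h.choose_spec] at h1
    have h2 : φ h.choose = 0 ↔ ¬ IsUnit h.choose := by
      rw [← RingHom.mem_ker, ker_eq_maximalIdeal_of_algHom φ, IsLocalRing.mem_maximalIdeal, mem_nonunits_iff]
    rw [h2, ← h1]; omega

lemma ofDVR_ord (φ : O →ₐ[k] k) (x : K) : (ofDVR K φ).ord x = dvrOrd O x := rfl

lemma ofDVR_res (φ : O →ₐ[k] k) (a : O) : (ofDVR K φ).res (algebraMap O K a) = φ a := by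
  have h : ∃ b : O, algebraMap O K b = algebraMap O K a := ⟨a, rfl⟩
  simp only [ofDVR]
  rw [dif_pos h, IsFractionRing.injective O K h.choose_spec]

lemma ofDVR_nonneg_iff (φ : O →ₐ[k] k) {x : K} :
    0 ≤ (ofDVR K φ).ord x ↔ ∃ a : O, algebraMap O K a = x := dvrOrd_nonneg_iff

end ofDVR

/-- Pull-back of a place along an unramified embedding. -/
def comap {k F K : Type*} [Field k] [Field F] [Field K] [Algebra k F] [Algebra k K]
    (P : Place k K) (φ : F →ₐ[k] K) (h : ∃ x, P.ord (φ x) = 1) : Place k F where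
  ord x := P.ord (φ x)
  res x := P.res (φ x)
  ord_zero := by simp [P.ord_zero]
  ord_mul hx hy := by rw [map_mul, P.ord_mul (by simpa using hx) (by simpa using hy)]
  exists_ord_one := h
  add_nonneg hx hy := by rw [map_add]; exact P.add_nonneg hx hy
  res_add hx hy := by rw [map_add]; exact P.res_add hx hy
  res_mul hx hy := by rw [map_mul]; exact P.res_mul hx hy
  ord_algebraMap c := by rw [AlgHom.commutes, P.ord_algebraMap]
  res_algebraMap c := by rw [AlgHom.commutes, P.res_algebraMap]
  res_eq_zero_iff hx h := P.res_eq_zero_iff (by simpa using hx) h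

lemma comap_ord {k F K : Type*} [Field k] [Field F] [Field K] [Algebra k F] [Algebra k K]
    (P : Place k K) (φ : F →ₐ[k] K) (h : ∃ x, P.ord (φ x) = 1) (x : F) :
    (P.comap φ h).ord x = P.ord (φ x) := rfl

end Place

/-! ### The projective line -/

section RatFunc

variable {k : Type*} [Field k]

/-- The `k`-embedding of `k(X)` sending `X` to a transcendental element. -/
def ratFuncHom {K : Type*} [Field K] [Algebra k K] {t : K} (ht : Transcendental k t) :
    RatFunc k →ₐ[k] K :=
  RatFunc.liftAlgHom (Polynomial.aeval t) (nonZeroDivisors_le_comap_nonZeroDivisors_of_injective _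
    (transcendental_iff_injective.1 ht))

lemma ratFuncHom_algebraMap {K : Type*} [Field K] [Algebra k K] {t : K} (ht : Transcendental k t)
    (f : Polynomial k) : ratFuncHom ht (algebraMap _ _ f) = Polynomial.aeval t f := by
  have := RatFunc.liftAlgHom_apply_div (Polynomial.aeval (R := k) t)
    (nonZeroDivisors_le_comap_nonZeroDivisors_of_injective _ (transcendental_iff_injective.1 ht)) f 1
  simpa [ratFuncHom] using this

@[simp] lemma ratFuncHom_X {K : Type*} [Field K] [Algebra k K] {t : K} (ht : Transcendental k t) :
    ratFuncHom ht RatFunc.X = t := by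
  rw [← RatFunc.algebraMap_X, ratFuncHom_algebraMap]; simp

/-- This embeds k(X) into the Laurent series, from which the place X = 0 is pulled back; the other
places of the line come from it by X ↦ X + c and X ↦ 1/X. -/
lemma transcendental_powerSeries_X :
    Transcendental k (algebraMap (PowerSeries k) (FractionRing (PowerSeries k)) PowerSeries.X) := by
  have h : Transcendental k (PowerSeries.X (R := k)) := by
    rw [transcendental_iff_injective]
    have : Polynomial.aeval (PowerSeries.X (R := k)) = Polynomial.coeToPowerSeries.algHom (R := k) k := by
      ext1; simp
    rw [this]
    intro a b hab
    exact Polynomial.coe_injective k (by simpa using hab)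
  exact (transcendental_algebraMap_iff (IsFractionRing.injective _ _)).2 h

variable (k) in
/-- The place `t = 0` of Laurent series. -/
def laurentPlace : Place k (FractionRing (PowerSeries k)) :=
  Place.ofDVR (O := PowerSeries k) _
    { PowerSeries.constantCoeff (R := k) with
      commutes' := fun c => by simp }

lemma laurentPlace_ord_X :
    (laurentPlace k).ord (algebraMap (PowerSeries k) _ PowerSeries.X) = 1 := by
  rw [laurentPlace, Place.ofDVR_ord]
  exact Place.dvrOrd_irreducible PowerSeries.X_irreducible

lemma transcendental_X_add (c : k) : Transcendental k (RatFunc.X + algebraMap k (RatFunc k) c) :=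
  fun h => RatFunc.transcendental_X (by simpa using h.sub (isAlgebraic_algebraMap c))

lemma transcendental_X_inv : Transcendental k (RatFunc.X (K := k))⁻¹ :=
  fun h => RatFunc.transcendental_X (K := k) (by simpa using h.inv)

variable (k) in
/-- The place `X = 0` of the projective line. -/
def ratFuncZero : Place k (RatFunc k) :=
  (laurentPlace k).comap (ratFuncHom transcendental_powerSeries_X)
    ⟨RatFunc.X, by rw [ratFuncHom_X, laurentPlace_ord_X]⟩

lemma ratFuncZero_X : (ratFuncZero k).ord RatFunc.X = 1 := by
  rw [ratFuncZero, Place.comap_ord, ratFuncHom_X, laurentPlace_ord_X]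

variable (k) in
/-- The places of the projective line; `none` is the point at infinity. -/
def ratFuncPlace : Option k → Place k (RatFunc k)
  | none => (ratFuncZero k).comap (ratFuncHom transcendental_X_inv)
      ⟨RatFunc.X⁻¹, by rw [map_inv₀, ratFuncHom_X, inv_inv, ratFuncZero_X]⟩
  | some c => (ratFuncZero k).comap (ratFuncHom (transcendental_X_add c))
      ⟨RatFunc.X - algebraMap k _ c, by
        rw [map_sub, ratFuncHom_X, AlgHom.commutes, add_sub_cancel_right, ratFuncZero_X]⟩

lemma ratFuncPlace_none_ord_X : (ratFuncPlace k none).ord RatFunc.X = -1 := by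
  rw [ratFuncPlace, Place.comap_ord, ratFuncHom_X, Place.ord_inv, ratFuncZero_X]

lemma ratFuncPlace_some_ord (c : k) :
    (ratFuncPlace k (some c)).ord (RatFunc.X - algebraMap k _ c) = 1 := by
  rw [ratFuncPlace, Place.comap_ord, map_sub, ratFuncHom_X, AlgHom.commutes, add_sub_cancel_right, ratFuncZero_X]

namespace Place

variable {K : Type*} [Field K] [Algebra k K] (P : Place k K)

lemma aeval_mem {t : K} (ht : 0 ≤ P.ord t) (f : Polynomial k) :
    0 ≤ P.ord (Polynomial.aeval t f) ∧ P.res (Polynomial.aeval t f) = f.eval (P.res t) := by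
  induction f using Polynomial.induction_on' with
  | add p q hp hq =>
    rw [map_add, Polynomial.eval_add, P.res_add hp.1 hq.1, hp.2, hq.2]
    exact ⟨P.add_nonneg hp.1 hq.1, rfl⟩
  | monomial n a =>
    have h1 : 0 ≤ P.ord (algebraMap k K a) := (P.ord_algebraMap a).ge
    have h2 : 0 ≤ P.ord (t ^ n) := by rw [ord_pow]; positivity
    rw [Polynomial.aeval_monomial, Polynomial.eval_monomial, P.res_mul h1 h2, P.res_algebraMap,
      P.res_pow ht]
    exact ⟨P.mul_nonneg h1 h2, rfl⟩

lemma ord_aeval_eq_zero {t : K} (ht : 0 ≤ P.ord t) {f : Polynomial k} (hf : f.eval (P.res t) ≠ 0) :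
    P.ord (Polynomial.aeval t f) = 0 :=
  P.ord_eq_zero_of_res_ne_zero (P.aeval_mem ht f).1 (by rwa [(P.aeval_mem ht f).2])

/-- A place of `K` lies over a place of a rational subfield `k(s)` at which the coordinate `s` is
regular as soon as the two agree on `s`. -/
lemma liesOver_of_coordinate {F : Type*} [Field F] [Algebra k F] [Algebra F K] [IsScalarTower k F K]
    {v : Place k F} {s : F} (hs : ∀ x : F, ∃ f g : Polynomial k, IsCoprime f g ∧
      x = Polynomial.aeval s f / Polynomial.aeval s g)
    (hv : 0 ≤ v.ord s) (hP : 0 ≤ P.ord (algebraMap F K s))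
    (h : P.res (algebraMap F K s) = v.res s) : P.LiesOver v := by
  intro x hx
  obtain ⟨f, g, hfg, rfl⟩ := hs x
  -- A denominator vanishing at `v` has a numerator that does not, by coprimality; then x would have
  -- a pole at `v`, unless the denominator is identically zero and x is 0.
  by_cases hg : g.eval (v.res s) = 0
  · have hf : f.eval (v.res s) ≠ 0 := by
      obtain ⟨a, b, hab⟩ := hfg
      intro hf
      have := congrArg (Polynomial.eval (v.res s)) hab
      simp [hf, hg] at this
    have hf' := v.ord_aeval_eq_zero hv hf
    have hf0 : Polynomial.aeval s f ≠ 0 := fun h0 => hf (by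
      rw [← (v.aeval_mem hv f).2, h0, res_zero])
    rcases eq_or_ne (Polynomial.aeval s g) 0 with h0 | h0
    · simp [h0, P.ord_zero]
    have hg' : 0 < v.ord (Polynomial.aeval s g) :=
      (v.res_eq_zero_iff h0 (v.aeval_mem hv g).1).1 (by rw [(v.aeval_mem hv g).2, hg])
    rw [ord_div _ hf0 h0] at hx
    omega
  · have hg1 := v.ord_aeval_eq_zero hv hg
    have hg2 := P.ord_aeval_eq_zero hP (h ▸ hg)
    have hf1 := v.aeval_mem hv f
    have hf2 := P.aeval_mem hP f
    have hv0 : v.res (Polynomial.aeval s g) ≠ 0 := by rwa [(v.aeval_mem hv g).2]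
    have hP0 : P.res (Polynomial.aeval (algebraMap F K s) g) ≠ 0 := by
      rwa [(P.aeval_mem hP g).2, h]
    rw [map_div₀, ← Polynomial.aeval_algebraMap_apply, ← Polynomial.aeval_algebraMap_apply]
    constructor
    · rw [div_eq_mul_inv]
      exact P.mul_nonneg hf2.1 (by rw [ord_inv, hg2]; rfl)
    · have e1 := P.res_mul (x := Polynomial.aeval (algebraMap F K s) f)
        (y := (Polynomial.aeval (algebraMap F K s) g)⁻¹) hf2.1 (by rw [ord_inv, hg2]; rfl)
      have e2 := v.res_mul (x := Polynomial.aeval s f) (y := (Polynomial.aeval s g)⁻¹) hf1.1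
        (by rw [ord_inv, hg1]; rfl)
      rw [div_eq_mul_inv, div_eq_mul_inv, e1, e2, P.res_inv hg2, v.res_inv hg1, hf2.2,
        hf1.2, (P.aeval_mem hP g).2, (v.aeval_mem hv g).2, h]

end Place

lemma ratFunc_algebraMap_eq_aeval (f : Polynomial k) :
    algebraMap _ (RatFunc k) f = Polynomial.aeval RatFunc.X f := by
  rw [← RatFunc.algebraMap_X, Polynomial.aeval_algebraMap_apply, Polynomial.aeval_X_left_apply]

lemma ratFunc_eq_aeval_X_div (x : RatFunc k) : ∃ f g : Polynomial k, IsCoprime f g ∧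
    x = Polynomial.aeval RatFunc.X f / Polynomial.aeval RatFunc.X g :=
  ⟨x.num, x.denom, x.isCoprime_num_denom, by
    rw [← ratFunc_algebraMap_eq_aeval, ← ratFunc_algebraMap_eq_aeval, x.num_div_denom]⟩

/-- The involution X ↦ 1/X carries a reduced fraction to a reduced fraction in 1/X, the coordinate
that is regular at infinity. -/
lemma ratFunc_eq_aeval_X_inv_div (x : RatFunc k) : ∃ f g : Polynomial k, IsCoprime f g ∧
    x = Polynomial.aeval RatFunc.X⁻¹ f / Polynomial.aeval RatFunc.X⁻¹ g := by
  set φ : RatFunc k →ₐ[k] RatFunc k := ratFuncHom transcendental_X_inv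
  have hφ : φ (φ x) = x := by
    obtain ⟨f, g, -, rfl⟩ := ratFunc_eq_aeval_X_div x
    simp only [map_div₀, ← Polynomial.aeval_algHom_apply, φ, ratFuncHom_X, map_inv₀, inv_inv]
  obtain ⟨f, g, hfg, h⟩ := ratFunc_eq_aeval_X_div (φ x)
  refine ⟨f, g, hfg, ?_⟩
  rw [← hφ, h]
  simp only [map_div₀, ← Polynomial.aeval_algHom_apply, φ, ratFuncHom_X]

lemma ratFuncPlace_some_X (c : k) :
    0 ≤ (ratFuncPlace k (some c)).ord RatFunc.X ∧ (ratFuncPlace k (some c)).res RatFunc.X = c := by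
  have h := ratFuncPlace_some_ord c
  have h0 := Place.ne_zero_of_ord_ne (P := ratFuncPlace k (some c)) (by rw [h]; simp)
  have hc := (ratFuncPlace k (some c)).ord_algebraMap c
  have e : (RatFunc.X : RatFunc k) = (RatFunc.X - algebraMap k _ c) + algebraMap k _ c := by ring
  constructor
  · rw [e]; exact Place.add_nonneg _ (by omega) hc.ge
  · rw [e, Place.res_add _ (by omega) hc.ge, Place.res_algebraMap,
      (Place.res_eq_zero_iff _ h0 (by omega)).2 (by omega), zero_add]

lemma ratFuncPlace_some_ord_sub {c a : k} (h : c ≠ a) :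
    (ratFuncPlace k (some c)).ord (RatFunc.X - algebraMap k _ a) = 0 ∧
    (ratFuncPlace k (some c)).res (RatFunc.X - algebraMap k _ a) = c - a := by
  have hX := ratFuncPlace_some_X c
  have ha := (ratFuncPlace k (some c)).ord_algebraMap (-a)
  rw [sub_eq_add_neg, ← map_neg]
  have hr : (ratFuncPlace k (some c)).res (RatFunc.X + algebraMap k _ (-a)) = c - a := by
    rw [Place.res_add _ hX.1 ha.ge, hX.2, Place.res_algebraMap]; ring
  exact ⟨Place.ord_eq_zero_of_res_ne_zero _ (Place.add_nonneg _ hX.1 ha.ge)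
    (by rw [hr]; exact sub_ne_zero.2 h), hr⟩

lemma ratFuncPlace_some_ord_X {c : k} (h : c ≠ 0) : (ratFuncPlace k (some c)).ord RatFunc.X = 0 := by
  simpa using (ratFuncPlace_some_ord_sub h).1

lemma ratFuncPlace_zero_ord_X : (ratFuncPlace k (some 0)).ord RatFunc.X = 1 := by
  simpa using ratFuncPlace_some_ord (0 : k)

lemma ratFuncPlace_none_ord_sub (a : k) :
    (ratFuncPlace k none).ord (RatFunc.X - algebraMap k _ a) = -1 ∧
    (ratFuncPlace k none).res ((RatFunc.X - algebraMap k _ a) / RatFunc.X) = 1 := by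
  set P := ratFuncPlace k none
  have hX : P.ord RatFunc.X = -1 := ratFuncPlace_none_ord_X
  have hX0 : (RatFunc.X : RatFunc k) ≠ 0 := RatFunc.X_ne_zero
  have h1 : 0 < P.ord (RatFunc.X)⁻¹ := by rw [Place.ord_inv, hX]; simp
  have ha := P.ord_algebraMap (-a)
  have e : (RatFunc.X - algebraMap k (RatFunc k) a) / RatFunc.X =
      1 + algebraMap k _ (-a) * (RatFunc.X)⁻¹ := by
    field_simp
    simp [sub_eq_add_neg]
  have h2 : 0 ≤ P.ord (algebraMap k (RatFunc k) (-a) * (RatFunc.X)⁻¹) :=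
    P.mul_nonneg ha.ge h1.le
  have h3 : P.res ((RatFunc.X - algebraMap k (RatFunc k) a) / RatFunc.X) = 1 := by
    rw [e, P.res_add (by simp) h2, P.res_mul ha.ge h1.le,
      (P.res_eq_zero_iff (inv_ne_zero hX0) h1.le).2 h1]
    simp
  have h4 : P.ord ((RatFunc.X - algebraMap k (RatFunc k) a) / RatFunc.X) = 0 := by
    apply P.ord_eq_zero_of_res_ne_zero
    · rw [e]; exact P.add_nonneg (by simp) h2
    · rw [h3]; simp
  refine ⟨?_, h3⟩
  have hne : RatFunc.X - algebraMap k (RatFunc k) a ≠ 0 := by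
    intro h
    rw [h, zero_div, P.res_zero] at h3
    exact zero_ne_one h3
  rw [P.ord_div hne hX0, hX] at h4
  omega

/-- The reciprocity law for the tame symbols `(X, h)` on the projective line. -/
def RatFuncReciprocity (h : RatFunc k) : Prop :=
  (Function.mulSupport fun o => (ratFuncPlace k o).tame RatFunc.X h).Finite ∧
    ∏ᶠ o, (ratFuncPlace k o).tame RatFunc.X h = 1

lemma RatFuncReciprocity.of_finset {h : RatFunc k} (s : Finset (Option k))
    (h1 : ∀ o ∉ s, (ratFuncPlace k o).tame RatFunc.X h = 1)
    (h2 : ∏ o ∈ s, (ratFuncPlace k o).tame RatFunc.X h = 1) : RatFuncReciprocity h := by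
  have hs : (Function.mulSupport fun o => (ratFuncPlace k o).tame RatFunc.X h) ⊆ s := fun o ho => by
    by_contra hos
    exact ho (h1 o hos)
  exact ⟨s.finite_toSet.subset hs, by rw [finprod_eq_prod_of_mulSupport_subset _ hs, h2]⟩

lemma RatFuncReciprocity.mul {h h' : RatFunc k} (h0 : h ≠ 0) (h0' : h' ≠ 0)
    (H : RatFuncReciprocity h) (H' : RatFuncReciprocity h') : RatFuncReciprocity (h * h') := by
  have e : (fun o => (ratFuncPlace k o).tame RatFunc.X (h * h')) = fun o =>
      (ratFuncPlace k o).tame RatFunc.X h * (ratFuncPlace k o).tame RatFunc.X h' := by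
    ext o; exact Place.tame_mul_right _ RatFunc.X_ne_zero h0 h0'
  unfold RatFuncReciprocity
  rw [e, finprod_mul_distrib H.1 H'.1, H.2, H'.2, one_mul]
  exact ⟨(H.1.union H'.1).subset (Function.mulSupport_mul _ _), rfl⟩

lemma RatFuncReciprocity.inv {h : RatFunc k} (h0 : h ≠ 0)
    (H : RatFuncReciprocity h) : RatFuncReciprocity h⁻¹ := by
  have e : (fun o => (ratFuncPlace k o).tame RatFunc.X h⁻¹) = fun o =>
      ((ratFuncPlace k o).tame RatFunc.X h)⁻¹ := by
    ext o; exact Place.tame_inv_right _ RatFunc.X_ne_zero h0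
  unfold RatFuncReciprocity
  rw [e, finprod_inv_distrib, H.2, inv_one]
  exact ⟨by simpa [Function.mulSupport_fun_inv] using H.1, rfl⟩

/-- The product is `a` to minus the degree of the divisor of X, and X has one simple zero and one
simple pole. -/
lemma ratFuncReciprocity_algebraMap {a : k} (ha : a ≠ 0) :
    RatFuncReciprocity (algebraMap k (RatFunc k) a) := by
  classical
  have ha' : algebraMap k (RatFunc k) a ≠ 0 := by simpa using ha
  have e : ∀ o, (ratFuncPlace k o).tame RatFunc.X (algebraMap k _ a) =
      (a ^ (ratFuncPlace k o).ord RatFunc.X)⁻¹ := fun o => by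
    rw [Place.tame_swap _ ha' RatFunc.X_ne_zero,
      Place.tame_of_ord_left_eq_zero _ (Place.ord_algebraMap _ _), Place.res_algebraMap]
  refine .of_finset {none, some 0} ?_ ?_
  · rintro (_ | c) ho
    · simp at ho
    · rw [e, ratFuncPlace_some_ord_X (by simpa using ho)]; simp
  · rw [Finset.prod_pair (by simp), e, e, ratFuncPlace_none_ord_X, ratFuncPlace_zero_ord_X]
    simp [ha]

lemma ratFuncReciprocity_X : RatFuncReciprocity (RatFunc.X (K := k)) := by
  classical
  refine .of_finset {none, some 0} ?_ ?_
  · rintro (_ | c) ho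
    · simp at ho
    · have := ratFuncPlace_some_ord_X (k := k) (c := c) (by simpa using ho)
      exact Place.tame_of_ord_eq_zero _ this this
  · rw [Finset.prod_pair (by simp), Place.tame, Place.tame, ratFuncPlace_none_ord_X,
      ratFuncPlace_zero_ord_X, div_self (zpow_ne_zero _ RatFunc.X_ne_zero),
      div_self (zpow_ne_zero _ RatFunc.X_ne_zero)]
    simp

/-- For a ≠ 0 the points ∞, 0 and a contribute -1, (-a)⁻¹ and a; elsewhere both functions have order
0. -/
lemma ratFuncReciprocity_X_sub (a : k) : RatFuncReciprocity (RatFunc.X - algebraMap k (RatFunc k) a) := by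
  classical
  rcases eq_or_ne a 0 with rfl | ha
  · simpa using ratFuncReciprocity_X
  have hne : RatFunc.X - algebraMap k (RatFunc k) a ≠ 0 :=
    (ratFuncPlace k none).ne_zero_of_ord_ne (by rw [(ratFuncPlace_none_ord_sub a).1]; simp)
  refine .of_finset {none, some 0, some a} ?_ ?_
  · rintro (_ | c) ho
    · simp at ho
    · simp only [Finset.mem_insert, Finset.mem_singleton, Option.some.injEq, not_or] at ho
      exact Place.tame_of_ord_eq_zero _ (ratFuncPlace_some_ord_X ho.2.1)
        (ratFuncPlace_some_ord_sub ho.2.2).1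
  · have e1 : (ratFuncPlace k none).tame RatFunc.X (RatFunc.X - algebraMap k _ a) = -1 := by
      rw [Place.tame, (ratFuncPlace_none_ord_sub a).1, ratFuncPlace_none_ord_X, zpow_neg_one,
        zpow_neg_one, inv_div_inv, (ratFuncPlace_none_ord_sub a).2]
      simp
    have e2 : (ratFuncPlace k (some 0)).tame RatFunc.X (RatFunc.X - algebraMap k _ a) = (-a)⁻¹ := by
      have := ratFuncPlace_some_ord_sub (k := k) (c := 0) (a := a) ha.symm
      rw [Place.tame_swap _ hne RatFunc.X_ne_zero, Place.tame_of_ord_left_eq_zero _ this.1,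
        ratFuncPlace_zero_ord_X, this.2]
      simp
    have e3 : (ratFuncPlace k (some a)).tame RatFunc.X (RatFunc.X - algebraMap k _ a) = a := by
      rw [Place.tame_of_ord_left_eq_zero _ (ratFuncPlace_some_ord_X ha), ratFuncPlace_some_ord,
        (ratFuncPlace_some_X a).2, zpow_one]
    rw [Finset.prod_insert (by simp), Finset.prod_pair (by simpa using ha.symm), e1, e2, e3]
    field_simp

/-- Reciprocity for the tame symbols `(X, h)` on the projective line. -/
theorem ratFuncReciprocity [IsAlgClosed k] {h : RatFunc k} (hh : h ≠ 0) : RatFuncReciprocity h := by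
  -- The law is multiplicative in h, and over an algebraically closed field constants and linear
  -- factors generate.
  have key : ∀ p : Polynomial k, p ≠ 0 → RatFuncReciprocity (algebraMap _ (RatFunc k) p) := by
    intro p hp
    rw [(IsAlgClosed.splits p).eq_prod_roots, map_mul]
    have hinj := RatFunc.algebraMap_injective k
    have h1 : ∀ s : Multiset k, (s.map fun a => Polynomial.X - Polynomial.C a).prod ≠ 0 := fun s =>
      (Polynomial.monic_multiset_prod_of_monic _ _ fun a _ => Polynomial.monic_X_sub_C a).ne_zero
    have h2 : ∀ s : Multiset k, RatFuncReciprocity (algebraMap _ (RatFunc k)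
        (s.map fun a => Polynomial.X - Polynomial.C a).prod) := fun s => by
      induction s using Multiset.induction with
      | empty => simpa using ratFuncReciprocity_algebraMap (k := k) one_ne_zero
      | cons a s ih =>
        rw [Multiset.map_cons, Multiset.prod_cons, map_mul]
        refine .mul ((map_ne_zero_iff _ hinj).2 (Polynomial.X_sub_C_ne_zero a))
          ((map_ne_zero_iff _ hinj).2 (h1 s)) ?_ ih
        simpa using ratFuncReciprocity_X_sub a
    refine .mul (by simpa using hp) ((map_ne_zero_iff _ hinj).2 (h1 _)) ?_ (h2 _)
    simpa using ratFuncReciprocity_algebraMap (Polynomial.leadingCoeff_ne_zero.2 hp)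
  have := (key h.num (RatFunc.num_ne_zero hh)).mul (by simpa using hh)
    (by simpa using h.denom_ne_zero) ((key h.denom h.denom_ne_zero).inv
      (by simpa using h.denom_ne_zero))
  rwa [← div_eq_mul_inv, h.num_div_denom] at this

end RatFunc
end RefinedParshin

end

noncomputable section

namespace RefinedParshin

/-! ### Weil reciprocity -/

section Reciprocity

variable {k K ι : Type*} [Field k] [Field K] [Algebra k K]

/-- In transcendence degree one a single transcendental element is a transcendence basis. -/
lemma isAlgebraic_ratFunc (htr : Algebra.trdeg k K = 1) {t : K} (ht : Transcendental k t)
    [Algebra (RatFunc k) K] (h : ∀ x, algebraMap (RatFunc k) K x = ratFuncHom ht x) :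
    Algebra.IsAlgebraic (RatFunc k) K := by
  have h1 : IsTranscendenceBasis k (fun _ : Unit => t) :=
    (algebraicIndependent_unique_type_iff.2 ht).isTranscendenceBasis_of_lift_trdeg_le_of_finite
      (by rw [htr]; simp)
  have h2 := h1.isAlgebraic
  rw [Set.range_const] at h2
  refine Algebra.IsAlgebraic.ringHom_of_comp_eq
    (((algebraMap (Polynomial k) (RatFunc k)).comp
      (Polynomial.algEquivOfTranscendental k t ht).symm.toRingEquiv.toRingHom))
    (RingHom.id K) ?_ Function.surjective_id ?_ (R := Algebra.adjoin k {t})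
  · exact (RatFunc.algebraMap_injective k).comp (AlgEquiv.injective _)
  · ext x
    obtain ⟨f, rfl⟩ := (Polynomial.algEquivOfTranscendental k t ht).surjective x
    change algebraMap (RatFunc k) K (algebraMap (Polynomial k) (RatFunc k)
      ((Polynomial.algEquivOfTranscendental k t ht).symm _)) = _
    rw [AlgEquiv.symm_apply_apply, h, ratFuncHom_algebraMap]
    simp [← Polynomial.aeval_algebraMap_apply]

namespace Place

lemma liesOver_ratFuncPlace_unique {P : Place k K} [Algebra (RatFunc k) K]
    {o o' : Option k} (h : P.LiesOver (ratFuncPlace k o))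
    (h' : P.LiesOver (ratFuncPlace k o')) : o = o' := by
  have key : ∀ c, P.LiesOver (ratFuncPlace k (some c)) →
      0 ≤ P.ord (algebraMap (RatFunc k) K RatFunc.X) ∧
        P.res (algebraMap (RatFunc k) K RatFunc.X) = c := fun c hc => by
    have := hc _ (ratFuncPlace_some_X c).1
    rwa [(ratFuncPlace_some_X c).2] at this
  have key2 : P.LiesOver (ratFuncPlace k none) →
      P.ord (algebraMap (RatFunc k) K RatFunc.X) < 0 := fun hc => by
    have := hc.ord_pos (τ := RatFunc.X⁻¹) (by rw [ord_inv, ratFuncPlace_none_ord_X, neg_neg])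
    rw [map_inv₀, ord_inv] at this
    omega
  rcases o with _ | c <;> rcases o' with _ | c'
  · rfl
  · exact absurd (key c' h').1 (not_le.2 (key2 h))
  · exact absurd (key c h).1 (not_le.2 (key2 h'))
  · rw [← (key c h).2, (key c' h').2]

/-- The point below is the value of X at `P`, or infinity if X has a pole there. -/
lemma exists_liesOver_ratFuncPlace (P : Place k K) [Algebra (RatFunc k) K]
    [IsScalarTower k (RatFunc k) K] : ∃ o, P.LiesOver (ratFuncPlace k o) := by
  by_cases hX : 0 ≤ P.ord (algebraMap (RatFunc k) K RatFunc.X)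
  · refine ⟨some (P.res (algebraMap (RatFunc k) K RatFunc.X)), ?_⟩
    exact P.liesOver_of_coordinate ratFunc_eq_aeval_X_div (ratFuncPlace_some_X _).1 hX
      (ratFuncPlace_some_X _).2.symm
  · have h1 : 0 < P.ord (algebraMap (RatFunc k) K RatFunc.X⁻¹) := by
      rw [map_inv₀, ord_inv]; omega
    have h2 : 0 < (ratFuncPlace k none).ord RatFunc.X⁻¹ := by
      rw [ord_inv, ratFuncPlace_none_ord_X]; simp
    refine ⟨none, P.liesOver_of_coordinate ratFunc_eq_aeval_X_inv_div h2.le h1.le ?_⟩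
    rw [(P.res_eq_zero_of_pos (.inr h1)).2, (res_eq_zero_of_pos _ (.inr h2)).2]

end Place

open Place

variable [IsAlgClosed k] [CharZero k] [Algebra.EssFiniteType k K]

/-- The set of zeros and poles of a transcendental function is finite, and the reciprocity law
holds for it. -/
lemma Place.Complete.reciprocity_of_transcendental {p : ι → Place k K} (hp : Complete p)
    (htr : Algebra.trdeg k K = 1) {t : K} (ht : Transcendental k t) :
    {i | (p i).ord t ≠ 0}.Finite ∧ ∀ g : K, g ≠ 0 →
      {i | (p i).ord g ≠ 0}.Finite → ∏ᶠ i, (p i).tame t g = 1 := by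
  classical
  let : Algebra (RatFunc k) K := (ratFuncHom ht).toRingHom.toAlgebra
  have halg : ∀ x, algebraMap (RatFunc k) K x = ratFuncHom ht x := fun x => rfl
  have : IsScalarTower k (RatFunc k) K := .of_algebraMap_eq fun c => by
    rw [halg, AlgHom.commutes]
  have := isAlgebraic_ratFunc htr ht halg
  have : Algebra.EssFiniteType (RatFunc k) K := Algebra.EssFiniteType.of_comp k _ _
  have : FiniteDimensional (RatFunc k) K := Algebra.finite_of_essFiniteType_of_isAlgebraic
  -- Characteristic zero supplies the separability that the projection formula needs.
  have : CharZero (RatFunc k) := charZero_of_injective_algebraMap (algebraMap k _).injective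
  have : Infinite k := IsAlgClosed.instInfinite
  have htX : algebraMap (RatFunc k) K RatFunc.X = t := by rw [halg, ratFuncHom_X]
  have hfin : {i | (p i).ord t ≠ 0}.Finite := by
    refine ((hp.over (ratFuncPlace k none)) ∪ (hp.over (ratFuncPlace k (some 0)))).finite_toSet.subset
      fun i hi => ?_
    obtain ⟨o, ho⟩ := (p i).exists_liesOver_ratFuncPlace
    rw [Finset.coe_union, Set.mem_union, Finset.mem_coe, Finset.mem_coe, hp.mem_over, hp.mem_over]
    rcases o with _ | c
    · exact .inl ho
    · rcases eq_or_ne c 0 with rfl | hc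
      · exact .inr ho
      · refine absurd ?_ hi
        rw [← htX]
        exact ho.ord_eq_zero RatFunc.X_ne_zero (ratFuncPlace_some_ord_X hc)
  refine ⟨hfin, fun g hg hgfin => ?_⟩
  have hN : Algebra.norm (RatFunc k) g ≠ 0 := by simpa [Algebra.norm_eq_zero_iff] using hg
  obtain ⟨hs, hprod⟩ := ratFuncReciprocity hN
  have hsupp : (Function.mulSupport fun i => (p i).tame t g).Finite := by
    refine (hfin.union hgfin).subset fun i hi => ?_
    by_contra h
    simp only [Set.mem_union, Set.mem_ofPred_eq, not_or, not_not] at h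
    exact hi (tame_of_ord_eq_zero _ h.1 h.2)
  choose o ho using fun i => (p i).exists_liesOver_ratFuncPlace (k := k)
  -- `S` contains the support on the line and the image of the support above, so that both products
  -- become finite products over `S` and can be compared fibre by fibre.
  set S : Finset (Option k) := hs.toFinset ∪ hsupp.toFinset.image o
  have h1 : (Function.mulSupport fun i => (p i).tame t g) ⊆
      (S.biUnion fun w => hp.over (ratFuncPlace k w) : Finset ι) := fun i hi => by
    rw [Finset.mem_coe, Finset.mem_biUnion]
    refine ⟨o i, Finset.mem_union_right _ (Finset.mem_image_of_mem _ ?_), hp.mem_over.2 (ho i)⟩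
    exact hsupp.mem_toFinset.2 hi
  rw [finprod_eq_prod_of_mulSupport_subset _ h1, Finset.prod_biUnion]
  · rw [← hprod, finprod_eq_prod_of_mulSupport_subset (s := S)]
    · refine Finset.prod_congr rfl fun w _ => ?_
      rw [hp.tame_norm _ RatFunc.X_ne_zero hg, htX]
    · intro w hw
      exact Finset.mem_coe.2 (Finset.mem_union_left _ (hs.mem_toFinset.2 hw))
  · intro w _ w' _ hww'
    rw [Function.onFun, Finset.disjoint_left]
    intro i hi hi'
    exact hww' (liesOver_ratFuncPlace_unique (hp.mem_over.1 hi) (hp.mem_over.1 hi'))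

-- An element algebraic over an algebraically closed field is a constant.
omit [CharZero k] [Algebra.EssFiniteType k K] in
lemma Place.ord_eq_zero_of_not_transcendental (P : Place k K) {f : K}
    (hf : ¬ Transcendental k f) : P.ord f = 0 := by
  rw [Transcendental, not_not] at hf
  obtain ⟨c, rfl⟩ := minpoly.mem_range_of_degree_eq_one k f
    (IsAlgClosed.degree_eq_one_of_irreducible k (minpoly.irreducible hf.isIntegral))
  exact P.ord_algebraMap c

lemma Place.Complete.finite_ord_ne_zero {p : ι → Place k K} (hp : Complete p)
    (htr : Algebra.trdeg k K = 1) (f : K) : {i | (p i).ord f ≠ 0}.Finite := by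
  by_cases hf : Transcendental k f
  · exact (hp.reciprocity_of_transcendental htr hf).1
  · simp [Place.ord_eq_zero_of_not_transcendental _ hf]

lemma Place.Complete.finite_mulSupport_tame {p : ι → Place k K} (hp : Complete p)
    (htr : Algebra.trdeg k K = 1) (f g : K) :
    (Function.mulSupport fun i => (p i).tame f g).Finite := by
  refine ((hp.finite_ord_ne_zero htr f).union (hp.finite_ord_ne_zero htr g)).subset fun i hi => ?_
  by_contra h
  simp only [Set.mem_union, Set.mem_ofPred_eq, not_or, not_not] at h
  exact hi (tame_of_ord_eq_zero _ h.1 h.2)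

/-- **Weil reciprocity** for a complete family of places of a function field in one variable. -/
theorem Place.Complete.finprod_tame {p : ι → Place k K} (hp : Complete p)
    (htr : Algebra.trdeg k K = 1) {f g : K} (hf : f ≠ 0) (hg : g ≠ 0) :
    ∏ᶠ i, (p i).tame f g = 1 := by
  by_cases hft : Transcendental k f
  · exact (hp.reciprocity_of_transcendental htr hft).2 g hg (hp.finite_ord_ne_zero htr g)
  by_cases hgt : Transcendental k g
  · have := (hp.reciprocity_of_transcendental htr hgt).2 f hf (hp.finite_ord_ne_zero htr f)
    rw [← inv_inj, ← finprod_inv_distrib, inv_one, ← this]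
    exact finprod_congr fun i => ((p i).tame_swap hf hg).symm
  · rw [← finprod_one]
    exact finprod_congr fun i => tame_of_ord_eq_zero _ (ord_eq_zero_of_not_transcendental _ hft)
      (ord_eq_zero_of_not_transcendental _ hgt)

end Reciprocity
end RefinedParshin

end

noncomputable section

namespace RefinedParshin

/-! ### Commutative algebra -/

section CommAlg

open IsLocalRing

/-- Flatness keeps a non-zero element of `R` a non-zero-divisor on `T`, so it cannot map to 0. -/
lemma algebraMap_injective_of_flat (R T : Type*) [CommRing R] [IsDomain R] [CommRing T] [Nontrivial T]
    [Algebra R T] [Module.Flat R T] : Function.Injective (algebraMap R T) := by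
  rw [injective_iff_map_eq_zero]
  intro r hr
  by_contra hr0
  have hreg : IsSMulRegular T (algebraMap R T r) :=
    (IsSMulRegular.of_ne_zero hr0 : IsSMulRegular R r).of_flat
  exact one_ne_zero (α := T) (hreg (by simp [hr]))

/-- A one-dimensional Noetherian local domain that is flat over a unique factorization domain `R`
and whose maximal ideal is generated by its contraction to `R` is a discrete valuation ring. -/
lemma isDiscreteValuationRing_of_map_comap_maximalIdeal {R T : Type*} [CommRing R] [IsDomain R]
    [UniqueFactorizationMonoid R] [CommRing T] [IsDomain T] [IsLocalRing T] [IsNoetherianRing T]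
    [Ring.KrullDimLE 1 T] (hT : ¬ IsField T) [Algebra R T] [Module.Flat R T]
    (h : ((maximalIdeal T).comap (algebraMap R T)).map (algebraMap R T) = maximalIdeal T) :
    IsDiscreteValuationRing T := by
  have hmax : maximalIdeal T ≠ ⊥ := isField_iff_maximalIdeal_eq.not.mp hT
  have hne : (maximalIdeal T).comap (algebraMap R T) ≠ ⊥ := fun h0 => hmax (by
    rw [← h, h0, Ideal.map_bot])
  obtain ⟨ϖ, hϖ, hprime⟩ := Ideal.IsPrime.exists_mem_prime_of_ne_bot inferInstance hne
  have hsp : (Ideal.span {ϖ}).IsPrime := (Ideal.span_singleton_prime hprime.ne_zero).2 hprime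
  have hlo : (maximalIdeal T).LiesOver ((maximalIdeal T).comap (algebraMap R T)) := ⟨rfl⟩
  -- Going down for the flat map gives a prime over `(ϖ)` inside the maximal ideal. It is non-zero,
  -- hence maximal in dimension one, so the contraction is `(ϖ)` and the maximal ideal is generated
  -- by `ϖ`.
  obtain ⟨P, hP, hPp, hPo⟩ := Ideal.exists_ideal_le_liesOver_of_le (p := Ideal.span {ϖ})
    (q := (maximalIdeal T).comap (algebraMap R T)) (maximalIdeal T)
    ((Ideal.span_singleton_le_iff_mem _).2 hϖ)
  have hinj := algebraMap_injective_of_flat R T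
  have hPb : P ≠ ⊥ := by
    rintro rfl
    have h1 : ϖ ∈ Ideal.span {ϖ} := Ideal.mem_span_singleton_self ϖ
    rw [hPo.over, Ideal.under_def, Ideal.mem_comap, Ideal.mem_bot, map_eq_zero_iff _ hinj] at h1
    exact hprime.ne_zero h1
  have hPm : P = maximalIdeal T := eq_maximalIdeal (hPp.isMaximal_of_ne_bot hPb)
  have hprin : (maximalIdeal T).IsPrincipal := by
    have h2 := hPo.over
    rw [hPm, Ideal.under_def] at h2
    rw [← h, ← h2, Ideal.map_span, Set.image_singleton]
    exact ⟨_, rfl⟩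
  exact ((IsDiscreteValuationRing.TFAE T hT).out 0 4).2 hprin

/-- The maximal ideal of a local ring of an unramified algebra is generated by its contraction. -/
lemma map_comap_maximalIdeal_of_unramified {A B T : Type*} [CommRing A] [CommRing B] [CommRing T]
    [IsLocalRing T] [Algebra A B] [Algebra B T] [Algebra A T] [IsScalarTower A B T]
    [Algebra.EssFiniteType A B] [Algebra.FormallyUnramified A B] (q : Ideal B) [q.IsPrime]
    [IsLocalization.AtPrime T q] :
    ((maximalIdeal T).comap (algebraMap A T)).map (algebraMap A T) = maximalIdeal T := by
  have hq : (maximalIdeal T).comap (algebraMap B T) = q :=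
    IsLocalization.AtPrime.under_maximalIdeal T q
  have hp : (maximalIdeal T).comap (algebraMap A T) = q.under A := by
    rw [IsScalarTower.algebraMap_eq A B T, ← Ideal.comap_comap, hq]
  let := Localization.AtPrime.algebraOfLiesOver (q.under A) q
  have : Algebra.FormallyUnramified A (Localization.AtPrime q) :=
    .comp A B (Localization.AtPrime q)
  have h1 : (q.under A).map (algebraMap A (Localization.AtPrime q)) = maximalIdeal _ :=
    ((Algebra.isUnramifiedAt_iff_map_eq A (q.under A) q).1 this).2
  let e : Localization.AtPrime q ≃ₐ[B] T := IsLocalization.algEquiv q.primeCompl _ _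
  have he : (e : Localization.AtPrime q →+* T).comp (algebraMap A (Localization.AtPrime q)) =
      algebraMap A T := by
    ext a
    simp [IsScalarTower.algebraMap_apply A B (Localization.AtPrime q), IsScalarTower.algebraMap_apply A B T]
  rw [hp, ← he, ← Ideal.map_map, h1]
  exact map_maximalIdeal_of_surjective _ e.surjective

/-- A Noetherian local domain with a prime element modulo which it is a principal ideal ring
is a unique factorization domain. -/
lemma uniqueFactorizationMonoid_of_isPrincipalIdealRing_quotient {A D : Type*} [CommRing A]
    [IsDomain A] [IsLocalRing A] [IsNoetherianRing A] [CommRing D] [IsPrincipalIdealRing D] (φ : A →+* D)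
    (hφ : Function.Surjective φ) {x : A} (hx : Prime x) (hker : RingHom.ker φ = Ideal.span {x}) :
    UniqueFactorizationMonoid A := by
  refine UniqueFactorizationMonoid.iff_exists_prime_mem_of_isPrime.2 fun Q hQ0 hQ => ?_
  by_cases hxQ : x ∈ Q
  · exact ⟨x, hxQ, hx⟩
  obtain ⟨d, hd⟩ := (IsPrincipalIdealRing.principal (Q.map φ)).principal
  obtain ⟨y, hyQ, hy⟩ : ∃ y ∈ Q, φ y = d := by
    rw [← Ideal.mem_map_iff_of_surjective φ hφ, hd]
    exact Submodule.mem_span_singleton_self d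
  -- `y` lifts a generator of the image of `Q`. As `x` is not in the prime `Q`, the error term lies
  -- in `xQ` and not merely in `(x)`; Nakayama then gives Q = (y).
  have hle : Q ≤ Ideal.span {y} ⊔ Ideal.span {x} • Q := by
    intro z hz
    have h1 : φ z ∈ Q.map φ := Ideal.mem_map_of_mem φ hz
    rw [hd, ← hy] at h1
    obtain ⟨c, hc⟩ := Submodule.mem_span_singleton.1 h1
    obtain ⟨a, rfl⟩ := hφ c
    have h2 : z - a * y ∈ RingHom.ker φ := by
      rw [RingHom.mem_ker, map_sub, map_mul, ← hc, smul_eq_mul, sub_self]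
    rw [hker, Ideal.mem_span_singleton] at h2
    obtain ⟨b, hb⟩ := h2
    have hbQ : b ∈ Q := by
      have : x * b ∈ Q := hb ▸ Q.sub_mem hz (Q.mul_mem_left a hyQ)
      exact (hQ.mem_or_mem this).resolve_left hxQ
    rw [show z = a * y + x * b by rw [← hb]; ring]
    exact Submodule.add_mem_sup (Ideal.mul_mem_left _ _ (Ideal.mem_span_singleton_self y))
      (Submodule.smul_mem_smul (Ideal.mem_span_singleton_self x) hbQ)
  have hxm : Ideal.span {x} ≤ Ideal.jacobson ⊥ := by
    rw [IsLocalRing.jacobson_eq_maximalIdeal _ bot_ne_top, Ideal.span_singleton_le_iff_mem]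
    exact hx.not_isUnit
  have hQy : Q = Ideal.span {y} := le_antisymm
    (Submodule.le_of_le_smul_of_le_jacobson_bot (IsNoetherian.noetherian Q) hxm hle)
    ((Ideal.span_singleton_le_iff_mem _).2 hyQ)
  have hy0 : y ≠ 0 := fun h0 => hQ0 (by rw [hQy, h0]; simp)
  exact ⟨y, hyQ, (Ideal.span_singleton_prime hy0).1 (hQy ▸ hQ)⟩

/-- The fraction field of a domain that is étale over `k[X]` has transcendence degree one. -/
lemma trdeg_eq_one_of_etale {k B L : Type} [Field k] [CommRing B] [IsDomain B] [Field L]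
    [Algebra (MvPolynomial (Fin 1) k) B] [Algebra.Etale (MvPolynomial (Fin 1) k) B] [Algebra B L]
    [IsFractionRing B L] [Algebra k L] [Algebra (MvPolynomial (Fin 1) k) L]
    [IsScalarTower (MvPolynomial (Fin 1) k) B L]
    [IsScalarTower k (MvPolynomial (Fin 1) k) L] :
    Algebra.trdeg k L = 1 ∧ Algebra.EssFiniteType k L := by
  set A := MvPolynomial (Fin 1) k
  have hBL : Algebra.EssFiniteType B L := .of_isLocalization L (nonZeroDivisors B)
  have hAL : Algebra.EssFiniteType A L := .comp A B L
  have hess : Algebra.EssFiniteType k L := .comp k A L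
  have : Module.Flat A B := inferInstance
  have : Module.Flat B L := IsLocalization.flat L (nonZeroDivisors B)
  have : Module.Flat A L := .trans A B L
  have hinj := algebraMap_injective_of_flat A L
  have : FaithfulSMul A L := (faithfulSMul_iff_algebraMap_injective A L).2 hinj
  let := FractionRing.liftAlgebra A L
  have : IsScalarTower A (FractionRing A) L := inferInstance
  have : Algebra.FormallyUnramified B L := .of_isLocalization (nonZeroDivisors B)
  have : Algebra.FormallyUnramified A L := .comp A B L
  have : Algebra.FormallyUnramified (FractionRing A) L := .of_restrictScalars A _ _
  have : Algebra.EssFiniteType (FractionRing A) L := .of_comp A _ _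
  -- An unramified extension of fields of essentially finite type is separable algebraic, so the
  -- transcendence degree is that of the polynomial ring.
  have : Algebra.IsSeparable (FractionRing A) L := Algebra.FormallyUnramified.isSeparable _ _
  have halg : Algebra.IsAlgebraic (FractionRing A) L := inferInstance
  have hAL2 : Algebra.IsAlgebraic A L :=
    (IsFractionRing.comap_isAlgebraic_iff (A := A) (K := FractionRing A) (C := L)).2 halg
  refine ⟨?_, hess⟩
  have h := trdeg_add_eq k A (A := L)
  rw [trdeg_eq_zero (R := A) (A := L), add_zero, MvPolynomial.trdeg_of_isDomain] at h
  simpa using h.symm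

end CommAlg
end RefinedParshin

end

noncomputable section

namespace RefinedParshin

/-! ### Local rings of smooth complex schemes -/

section Stalks

variable (Y : Scheme.{0}) [Y.Over SpecC]

/-- The structure homomorphism to the ring of global sections. -/
def scalars : CommRingCat.of ℂ ⟶ Γ(Y, ⊤) :=
  (Scheme.ΓSpecIso (CommRingCat.of ℂ)).inv ≫ (Y ↘ SpecC).appTop

/-- The local rings of a complex scheme are complex algebras. -/
instance stalkAlgebra (y : Y) : Algebra ℂ (Y.presheaf.stalk y) :=
  (scalars Y ≫ Y.presheaf.germ ⊤ y (TopologicalSpace.Opens.mem_top y)).hom.toAlgebra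

variable {Y}

lemma algebraMap_stalk_eq (y : Y) :
    algebraMap ℂ (Y.presheaf.stalk y) = (scalars Y ≫ Y.presheaf.germ ⊤ y (TopologicalSpace.Opens.mem_top y)).hom := rfl

lemma stalkSpecializes_algebraMap {x y : Y} (h : x ⤳ y) (c : ℂ) :
    (Y.presheaf.stalkSpecializes h).hom (algebraMap ℂ _ c) = algebraMap ℂ _ c := by
  rw [algebraMap_stalk_eq, algebraMap_stalk_eq, ← CommRingCat.comp_apply, Category.assoc,
    TopCat.Presheaf.germ_stalkSpecializes]

instance stalk_isScalarTower [IsIntegral Y] (y : Y) :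
    IsScalarTower ℂ (Y.presheaf.stalk y) Y.functionField :=
  .of_algebraMap_eq fun c => (stalkSpecializes_algebraMap _ c).symm

lemma stalkMap_algebraMap {Z : Scheme.{0}} [Z.Over SpecC] (f : Z ⟶ Y) (hf : f ≫ Y ↘ SpecC = Z ↘ SpecC)
    (z : Z) (c : ℂ) :
    (f.stalkMap z).hom (algebraMap ℂ (Y.presheaf.stalk (f z)) c) = algebraMap ℂ _ c := by
  rw [algebraMap_stalk_eq, algebraMap_stalk_eq, ← CommRingCat.comp_apply, Category.assoc,
    Scheme.Hom.germ_stalkMap]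
  congr 2
  simp only [scalars, ← hf, Scheme.Hom.comp_appTop, Category.assoc]
  rfl

open MvPolynomial in
/-- Étale coordinates. -/
lemma exists_etale_coordinates (n : ℕ) [h : SmoothOfRelativeDimension n (Y ↘ SpecC)] (y : Y) :
    ∃ (V : Y.Opens) (_ : IsAffineOpen V) (_ : y ∈ V) (g : MvPolynomial (Fin n) ℂ →+* Γ(Y, V)),
      g.Etale ∧ ∀ (x : Y) (hx : x ∈ V) (c : ℂ),
        Y.presheaf.germ V x hx (g (C c)) = algebraMap ℂ (Y.presheaf.stalk x) c := by
  obtain ⟨U, hU, V, hV, hy, e, hs⟩ := h.exists_isStandardSmoothOfRelativeDimension y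
  -- Spec ℂ is a single point.
  have hUtop : U = ⊤ := by
    have : Subsingleton SpecC := inferInstanceAs (Subsingleton (PrimeSpectrum ℂ))
    ext x
    simp only [TopologicalSpace.Opens.coe_top, Set.mem_univ, iff_true]
    rw [Subsingleton.elim x ((Y ↘ SpecC) y)]
    exact e hy
  subst hUtop
  have hs' := (RingHom.isStandardSmoothOfRelativeDimension_respectsIso (n := n)).2 _
    (Scheme.ΓSpecIso (CommRingCat.of ℂ)).symm.commRingCatIsoToRingEquiv hs
  obtain ⟨g, hg, hge⟩ := hs'.exists_etale_mvPolynomial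
  refine ⟨V, hV, hy, g, hge, fun x hx c => ?_⟩
  have h1 : g (C c) = ((Y ↘ SpecC).appLE ⊤ V e).hom
      ((Scheme.ΓSpecIso (CommRingCat.of ℂ)).inv.hom c) := by
    rw [← RingHom.comp_apply, hg]; rfl
  rw [h1, algebraMap_stalk_eq, scalars, Scheme.Hom.appLE]
  change ((Scheme.ΓSpecIso (CommRingCat.of ℂ)).inv ≫ ((Y ↘ SpecC).app ⊤ ≫ Y.presheaf.map _) ≫
    Y.presheaf.germ V x hx).hom c = _
  rw [Category.assoc, TopCat.Presheaf.germ_res]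
  rfl

variable [IsIntegral Y]

/-- On a smooth integral complex scheme the local rings at points of codimension one are discrete
valuation rings. -/
lemma isDiscreteValuationRing_stalk (n : ℕ) [SmoothOfRelativeDimension n (Y ↘ SpecC)] {y : Y}
    (hy : Order.coheight y = 1) : IsDiscreteValuationRing (Y.presheaf.stalk y) := by
  obtain ⟨V, hV, hyV, g, hg, -⟩ := exists_etale_coordinates n y
  have : Smooth (Y ↘ SpecC) := SmoothOfRelativeDimension.smooth n _
  have hdim := ringKrullDim_stalk_eq_coheight y
  rw [hy] at hdim
  have : Ring.KrullDimLE 1 (Y.presheaf.stalk y) := krullDimLE_of_coheight_le hy.le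
  have hF : ¬ IsField (Y.presheaf.stalk y) := fun hF => by
    have := ringKrullDim_eq_zero_of_isField hF
    rw [this] at hdim
    exact zero_ne_one hdim
  let := Y.presheaf.algebra_section_stalk ⟨y, hyV⟩
  let := g.toAlgebra
  let : Algebra (MvPolynomial (Fin n) ℂ) (Y.presheaf.stalk y) :=
    ((algebraMap Γ(Y, V) (Y.presheaf.stalk y)).comp g).toAlgebra
  have : IsScalarTower (MvPolynomial (Fin n) ℂ) Γ(Y, V) (Y.presheaf.stalk y) :=
    .of_algebraMap_eq fun _ => rfl
  have hloc := hV.isLocalization_stalk ⟨y, hyV⟩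
  have : Algebra.Etale (MvPolynomial (Fin n) ℂ) Γ(Y, V) := hg
  have : Module.Flat Γ(Y, V) (Y.presheaf.stalk y) :=
    IsLocalization.flat _ (hV.primeIdealOf ⟨y, hyV⟩).asIdeal.primeCompl
  have : Module.Flat (MvPolynomial (Fin n) ℂ) (Y.presheaf.stalk y) := .trans _ Γ(Y, V) _
  -- Étaleness over the factorial polynomial ring supplies both flatness and the generation of the
  -- maximal ideal by its contraction.
  exact isDiscreteValuationRing_of_map_comap_maximalIdeal (R := MvPolynomial (Fin n) ℂ) hF
    (map_comap_maximalIdeal_of_unramified (B := Γ(Y, V)) (hV.primeIdealOf ⟨y, hyV⟩).asIdeal)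

/-- The function field of a smooth integral complex curve has transcendence degree one. -/
lemma trdeg_functionField [SmoothOfRelativeDimension 1 (Y ↘ SpecC)] :
    Algebra.trdeg ℂ Y.functionField = 1 ∧ Algebra.EssFiniteType ℂ Y.functionField := by
  obtain ⟨V, hV, hyV, g, hg, hgC⟩ := exists_etale_coordinates 1 (genericPoint Y)
  have : Nonempty V := ⟨⟨_, hyV⟩⟩
  let := g.toAlgebra
  let : Algebra (MvPolynomial (Fin 1) ℂ) Y.functionField :=
    ((algebraMap Γ(Y, V) Y.functionField).comp g).toAlgebra
  have : IsScalarTower (MvPolynomial (Fin 1) ℂ) Γ(Y, V) Y.functionField :=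
    .of_algebraMap_eq fun _ => rfl
  have : Algebra.Etale (MvPolynomial (Fin 1) ℂ) Γ(Y, V) := hg
  have : IsScalarTower ℂ (MvPolynomial (Fin 1) ℂ) Y.functionField :=
    .of_algebraMap_eq fun c => (hgC _ hyV c).symm
  have := functionField_isFractionRing_of_isAffineOpen Y V hV
  exact trdeg_eq_one_of_etale (B := Γ(Y, V))

omit [Y.Over SpecC] in
lemma ord_eq_dvrOrd [IsLocallyNoetherian Y] {y : Y} (hy : Order.coheight y = 1)
    [IsDiscreteValuationRing (Y.presheaf.stalk y)] (f : Y.functionField) :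
    Scheme.ord f y = Place.dvrOrd (Y.presheaf.stalk y) f := by
  rw [Scheme.ord_eq_ordHom_of_coheight_eq_one hy]
  rfl

omit [Y.Over SpecC] in
lemma coheight_eq_one_of_ord_ne_zero [IsLocallyNoetherian Y] {y : Y} {f : Y.functionField}
    (h : Scheme.ord f y ≠ 0) : Order.coheight y = 1 := by
  by_contra h'
  exact h (Scheme.ord_eq_zero_of_coheight_neq_one h' f)

end Stalks

end RefinedParshin

end

noncomputable section

namespace RefinedParshin

/-! ### The places of a smooth complete curve -/

lemma generic_specializes {Y : Scheme.{0}} [IsIntegral Y] (y : Y) : genericPoint Y ⤳ y :=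
  (genericPoint_spec Y).specializes trivial

section Evaluation

variable {Y : Scheme.{0}} [Y.Over SpecC]

lemma fromSpecStalk_over (y : Y) : Y.fromSpecStalk y ≫ (Y ↘ SpecC) =
    Spec.map (CommRingCat.ofHom (algebraMap ℂ (Y.presheaf.stalk y))) := by
  apply ext_of_isAffine
  rw [Scheme.Hom.comp_appTop, Scheme.fromSpecStalk_appTop]
  have h := Scheme.ΓSpecIso_inv_naturality (CommRingCat.ofHom (algebraMap ℂ (Y.presheaf.stalk y)))
  rw [← cancel_epi (Scheme.ΓSpecIso (CommRingCat.of ℂ)).inv, ← h]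
  have h2 : CommRingCat.ofHom (algebraMap ℂ (Y.presheaf.stalk y)) =
    scalars Y ≫ Y.presheaf.germ ⊤ y (TopologicalSpace.Opens.mem_top y) := rfl
  rw [h2, scalars]
  simp

variable [LocallyOfFiniteType (Y ↘ SpecC)]

/-- Evaluation at a closed point. -/
def stalkEval (P : closedPoints Y) : Y.presheaf.stalk (P : Y) →ₐ[ℂ] ℂ where
  __ := (residueFieldIsoBase (Y ↘ SpecC) (P : Y) P.2).hom.hom.comp (Y.residue (P : Y)).hom
  commutes' c := by
    have h1 : (residueFieldIsoBase (Y ↘ SpecC) (P : Y) P.2).inv =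
        CommRingCat.ofHom (algebraMap ℂ (Y.presheaf.stalk (P : Y))) ≫ Y.residue (P : Y) := by
      apply Spec.map_injective
      refine (SpecMap_residueFieldIsoBase_inv (Y ↘ SpecC) (P : Y) P.2).trans ?_
      rw [Spec.map_comp, ← fromSpecStalk_over, Scheme.fromSpecResidueField, Category.assoc]
    have h2 := (residueFieldIsoBase (Y ↘ SpecC) (P : Y) P.2).inv_hom_id
    rw [h1] at h2
    exact ConcreteCategory.congr_hom h2 c

lemma valueAt_algebraMap [IsIntegral Y] (P : closedPoints Y) (a : Y.presheaf.stalk (P : Y)) :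
    valueAt P (algebraMap _ Y.functionField a) = stalkEval P a := by
  have h : ∃ b : Y.presheaf.stalk (P : Y), algebraMap _ Y.functionField b =
    algebraMap _ Y.functionField a := ⟨a, rfl⟩
  rw [valueAt, dif_pos h, IsFractionRing.injective _ Y.functionField h.choose_spec]
  rfl

end Evaluation

section Places

variable {Y : Scheme.{0}} [Y.Over SpecC] [IsIntegral Y] [SmoothOfRelativeDimension 1 (Y ↘ SpecC)]
  [LocallyOfFiniteType (Y ↘ SpecC)] {P : closedPoints Y} (hP : Order.coheight (P : Y) = 1)

/-- The place of the function field of a smooth curve defined by a closed point. -/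
def closedPlace : Place ℂ Y.functionField :=
  haveI := isDiscreteValuationRing_stalk 1 hP
  Place.ofDVR Y.functionField (stalkEval P)

lemma closedPlace_nonneg_iff {x : Y.functionField} :
    0 ≤ (closedPlace hP).ord x ↔
      ∃ a : Y.presheaf.stalk (P : Y), algebraMap _ Y.functionField a = x :=
  haveI := isDiscreteValuationRing_stalk 1 hP
  Place.ofDVR_nonneg_iff (stalkEval P)

lemma closedPlace_ord (x : Y.functionField) :
    (closedPlace hP).ord x = Scheme.ord x (P : Y) := by
  have := isDiscreteValuationRing_stalk 1 hP
  rw [ord_eq_dvrOrd hP]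
  rfl

lemma closedPlace_res_algebraMap (a : Y.presheaf.stalk (P : Y)) :
    (closedPlace hP).res (algebraMap _ Y.functionField a) = stalkEval P a :=
  haveI := isDiscreteValuationRing_stalk 1 hP
  Place.ofDVR_res (stalkEval P) a

lemma closedPlace_res {x : Y.functionField} (hx : 0 ≤ (closedPlace hP).ord x) :
    (closedPlace hP).res x = valueAt P x := by
  obtain ⟨a, rfl⟩ := (closedPlace_nonneg_iff hP).1 hx
  rw [closedPlace_res_algebraMap, valueAt_algebraMap]

/-- A valuation ring containing the ring of a place is that ring or the whole field. -/
lemma Place.valuationSubring_eq_of_le {k K : Type*} [Field k] [Field K] [Algebra k K]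
    (P : Place k K) {V : ValuationSubring K} (h : ∀ x, 0 ≤ P.ord x → x ∈ V) (hV : V ≠ ⊤) :
    P.valuationSubring = V := by
  refine le_antisymm (fun x hx => h x hx) fun x hx => ?_
  rw [Place.mem_valuationSubring]
  by_contra hneg
  refine hV (eq_top_iff.2 fun y _ => ?_)
  have hx0 : x ≠ 0 := P.ne_zero_of_ord_ne (by omega)
  rcases eq_or_ne y 0 with rfl | hy0
  · exact V.zero_mem
  -- An element x of V with a pole absorbs every other pole: y divided by a high enough power of x
  -- is regular at `P`, so V contains y.
  have hmem : y * (x ^ (P.ord y).natAbs)⁻¹ ∈ V := by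
    apply h
    rw [P.ord_mul hy0 (inv_ne_zero (pow_ne_zero _ hx0)), P.ord_inv, P.ord_pow]
    have h1 : ((P.ord y).natAbs : ℤ) ≤ -((P.ord y).natAbs * P.ord x) := by nlinarith
    omega
  have := V.mul_mem _ _ hmem (V.pow_mem hx (P.ord y).natAbs)
  rwa [inv_mul_cancel_right₀ (pow_ne_zero _ hx0)] at this

section Valuative

variable (V : ValuationSubring Y.functionField) (hV : ∀ c : ℂ, algebraMap ℂ Y.functionField c ∈ V)

/-- The map of spectra of complex algebras defined by a valuation ring of the function field. -/
def valuationScalars : CommRingCat.of ℂ ⟶ CommRingCat.of V :=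
  CommRingCat.ofHom ((algebraMap ℂ Y.functionField).codRestrict V hV)

/-- The valuative square defined by a valuation ring of the function field. -/
def valuativeSquare : ValuativeCommSq (Y ↘ SpecC) where
  R := V
  K := Y.functionField
  i₁ := Y.fromSpecStalk (genericPoint Y)
  i₂ := Spec.map (valuationScalars V hV)
  commSq := ⟨by
    rw [fromSpecStalk_over, ← Spec.map_comp]
    rfl⟩

end Valuative

variable [IsProper (Y ↘ SpecC)] (hY : ∀ P : closedPoints Y, Order.coheight (P : Y) = 1)

/-- The closed points of a smooth complete curve form a complete family of places. -/
lemma complete_closedPlace : Place.Complete fun P : closedPoints Y => closedPlace (hY P) := by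
  have hval : ValuativeCriterion (Y ↘ SpecC) := by
    have h : IsProper (Y ↘ SpecC) := inferInstance
    rw [IsProper.eq_valuativeCriterion] at h
    exact h.1.1.1
  constructor
  · intro P Q hPQ
    set V := (closedPlace (hY P)).valuationSubring with hVdef
    have hV : ∀ c : ℂ, algebraMap ℂ Y.functionField c ∈ V := fun c =>
      (Place.ord_algebraMap _ c).ge
    -- A point whose local ring is V yields a lift of the valuative square sending the closed point
    -- of Spec V to it. Lifts are unique, so two such points coincide.
    have key : ∀ R : closedPoints Y, (closedPlace (hY R)).valuationSubring = V →
        ∃ l : (valuativeSquare V hV).commSq.LiftStruct,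
          l.l (IsLocalRing.closedPoint V) = (R : Y) := by
      intro R hR
      have hmem : ∀ a : Y.presheaf.stalk (R : Y), algebraMap _ Y.functionField a ∈ V := fun a => by
        rw [← hR]; exact (closedPlace_nonneg_iff (hY R)).2 ⟨a, rfl⟩
      let φ : Y.presheaf.stalk (R : Y) →+* V :=
        (algebraMap (Y.presheaf.stalk (R : Y)) Y.functionField).codRestrict V hmem
      have hφ : Function.Bijective φ := by
        constructor
        · intro a b hab
          exact IsFractionRing.injective _ Y.functionField (congrArg Subtype.val hab)
        · rintro ⟨x, hx⟩
          rw [← hR] at hx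
          obtain ⟨a, ha⟩ := (closedPlace_nonneg_iff (hY R)).1 hx
          exact ⟨a, Subtype.ext ha⟩
      have hloc : IsLocalHom φ := ⟨fun a ha => by
        obtain ⟨b, hb⟩ := ha.exists_right_inv
        obtain ⟨c, rfl⟩ := hφ.2 b
        rw [← map_mul] at hb
        exact IsUnit.of_mul_eq_one c (hφ.1 (by rw [hb, map_one]))⟩
      have hfac : Spec.map (CommRingCat.ofHom (algebraMap V Y.functionField)) ≫
          Spec.map (CommRingCat.ofHom φ) ≫ Y.fromSpecStalk R =
          Y.fromSpecStalk (genericPoint Y) := by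
        rw [← Scheme.SpecMap_stalkSpecializes_fromSpecStalk (generic_specializes (R : Y)),
          ← Spec.map_comp_assoc]
        rfl
      refine ⟨⟨Spec.map (CommRingCat.ofHom φ) ≫ Y.fromSpecStalk R, ?_, ?_⟩, ?_⟩
      · exact hfac
      · change _ = Spec.map (valuationScalars V hV)
        rw [Category.assoc, fromSpecStalk_over, ← Spec.map_comp]
        congr 1
        ext c
        exact Subtype.ext (IsScalarTower.algebraMap_apply ℂ (Y.presheaf.stalk (R : Y))
          Y.functionField c).symm
      · change Y.fromSpecStalk R (Spec.map (CommRingCat.ofHom φ) (IsLocalRing.closedPoint V)) = R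
        have : Spec.map (CommRingCat.ofHom φ) (IsLocalRing.closedPoint V) =
          IsLocalRing.closedPoint (Y.presheaf.stalk (R : Y)) := IsLocalRing.comap_closedPoint φ
        rw [this, Scheme.fromSpecStalk_closedPoint]
    obtain ⟨l, hl⟩ := key P rfl
    obtain ⟨l', hl'⟩ := key Q hPQ.symm
    have := hval.uniqueness (valuativeSquare V hV)
    rw [Subsingleton.elim l l', hl'] at hl
    exact Subtype.ext hl.symm
  · intro V hV hVtop
    obtain ⟨⟨l, hl1, -⟩⟩ := (hval.existence (valuativeSquare V hV)).exists_lift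
    change Spec (CommRingCat.of V) ⟶ Y at l
    change Spec.map (CommRingCat.ofHom (algebraMap V Y.functionField)) ≫ l =
      Y.fromSpecStalk (genericPoint Y) at hl1
    set P' : Y := l (IsLocalRing.closedPoint V)
    have : CompactSpace Y := by
      have : QuasiCompact (Y ↘ SpecC) := inferInstance
      exact QuasiCompact.compactSpace_of_compactSpace (Y ↘ SpecC)
    -- The centre of V need not be known to be closed. It specializes to a closed point Q, whose
    -- local ring is still contained in V and, being a discrete valuation ring, equals V.
    obtain ⟨Q, hQ, hQc⟩ := (isClosed_closure (s := {P'})).exists_closed_singleton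
      ⟨P', subset_closure rfl⟩
    have hspec : P' ⤳ Q := specializes_iff_mem_closure.2 hQ
    refine ⟨⟨Q, hQc⟩, Place.valuationSubring_eq_of_le _ (fun x hx => ?_) hVtop⟩
    obtain ⟨a, rfl⟩ := (closedPlace_nonneg_iff (hY _)).1 hx
    have hmaps : Y.presheaf.stalkSpecializes hspec ≫ Scheme.stalkClosedPointTo l ≫
        CommRingCat.ofHom (algebraMap V Y.functionField) =
        Y.presheaf.stalkSpecializes (generic_specializes Q) := by
      apply Spec.map_injective
      rw [← cancel_mono (Y.fromSpecStalk Q)]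
      rw [Spec.map_comp, Spec.map_comp, Category.assoc, Category.assoc,
        Scheme.SpecMap_stalkSpecializes_fromSpecStalk,
        Scheme.SpecMap_stalkSpecializes_fromSpecStalk,
        Scheme.Spec_stalkClosedPointTo_fromSpecStalk, hl1]
    have h2 := ConcreteCategory.congr_hom hmaps a
    change algebraMap V Y.functionField ((Y.presheaf.stalkSpecializes hspec ≫
      Scheme.stalkClosedPointTo l).hom a) = algebraMap _ Y.functionField a at h2
    rw [← h2]
    exact Subtype.property _

end Places

end RefinedParshin

end

noncomputable section

namespace RefinedParshin

/-! ### Restriction of rational functions to a curve -/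

lemma Place.dvrOrd_zpow {O K : Type*} [CommRing O] [IsDomain O] [IsDiscreteValuationRing O] [Field K]
    [Algebra O K] [IsFractionRing O K] {x : K} (hx : x ≠ 0) (n : ℤ) :
    dvrOrd O (x ^ n) = n * dvrOrd O x := by
  apply dvrOrd_of_ordFrac
  rw [map_zpow₀, ordFrac_eq hx, ← WithZero.exp_zsmul, smul_eq_mul]

lemma map_units_zpow {R K : Type*} [CommRing R] [Field K] (φ : R →+* K) (u : Rˣ) (n : ℤ) :
    φ ((u ^ n : Rˣ) : R) = φ u ^ n := by
  have h : ∀ v : Rˣ, φ v = (Units.map φ.toMonoidHom v : Kˣ) := fun _ => rfl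
  rw [h, h, map_zpow, Units.val_zpow_eq_zpow_val]

section UnitAt

variable {Y : Scheme.{0}} [IsIntegral Y] {Q : Y} {f : Y.functionField}

lemma IsUnitAt.zpow (hf : IsUnitAt Q f) (n : ℤ) : IsUnitAt Q (f ^ n) := by
  obtain ⟨u, rfl⟩ := hf
  exact ⟨u ^ n, map_units_zpow _ u n⟩

end UnitAt

section Order

variable {Y : Scheme.{0}} [Y.Over SpecC] [IsIntegral Y] [LocallyOfFiniteType (Y ↘ SpecC)]
  (n : ℕ) [SmoothOfRelativeDimension n (Y ↘ SpecC)] {z : Y} (hz : Order.coheight z = 1)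
  {f g : Y.functionField}

include n hz

lemma ord_mul (hf : f ≠ 0) (hg : g ≠ 0) :
    Scheme.ord (f * g) z = Scheme.ord f z + Scheme.ord g z := by
  have := isDiscreteValuationRing_stalk n hz
  rw [ord_eq_dvrOrd hz, ord_eq_dvrOrd hz, ord_eq_dvrOrd hz, Place.dvrOrd_mul hf hg]

lemma ord_zpow (hf : f ≠ 0) (m : ℤ) : Scheme.ord (f ^ m) z = m * Scheme.ord f z := by
  have := isDiscreteValuationRing_stalk n hz
  rw [ord_eq_dvrOrd hz, ord_eq_dvrOrd hz, Place.dvrOrd_zpow hf]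

lemma isUnitAt_of_ord_eq_zero (hf : f ≠ 0) (h : Scheme.ord f z = 0) : IsUnitAt z f := by
  have := isDiscreteValuationRing_stalk n hz
  rw [ord_eq_dvrOrd hz] at h
  obtain ⟨a, rfl⟩ := Place.dvrOrd_nonneg_iff.1 h.ge
  have ha : a ≠ 0 := by rintro rfl; simp at hf
  obtain ⟨u, rfl⟩ := (Place.dvrOrd_eq_zero_iff ha).1 h
  exact ⟨u, rfl⟩

end Order

lemma ord_zero {Y : Scheme.{0}} [Y.Over SpecC] [IsIntegral Y] [LocallyOfFiniteType (Y ↘ SpecC)]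
    (n : ℕ) [SmoothOfRelativeDimension n (Y ↘ SpecC)] (z : Y) :
    Scheme.ord (0 : Y.functionField) z = 0 := by
  by_contra h
  have hz := coheight_eq_one_of_ord_ne_zero h
  have := isDiscreteValuationRing_stalk n hz
  rw [ord_eq_dvrOrd hz, Place.dvrOrd_zero] at h
  exact h rfl

namespace SmoothCurve

variable {X : Scheme.{0}} [X.Over SpecC] (c : SmoothCurve X)

instance [IsProper (X ↘ SpecC)] : IsProper (c.C ↘ SpecC) :=
  inferInstanceAs (IsProper (c.ι ≫ X ↘ SpecC))

variable [IsIntegral X]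

/-- The homomorphism from the local ring at the generic point of the curve to the function field
of the curve. -/
def restrictHom : X.presheaf.stalk c.genericPt →+* c.C.functionField :=
  (c.ι.stalkMap (genericPoint c.C)).hom

lemma restrict_algebraMap (a : X.presheaf.stalk c.genericPt) :
    c.restrict (algebraMap _ X.functionField a) = c.restrictHom a := by
  have h : ∃ b : X.presheaf.stalk (c.ι (genericPoint c.C)), algebraMap _ X.functionField b =
    algebraMap (X.presheaf.stalk c.genericPt) X.functionField a := ⟨a, rfl⟩
  have h' : h.choose = a := IsFractionRing.injective _ X.functionField h.choose_spec
  rw [restrict, dif_pos h, h']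
  rfl

lemma restrict_zero : c.restrict 0 = 0 := by
  simpa using c.restrict_algebraMap 0

variable {c} {f g : X.functionField}

lemma restrict_mul (hf : IsUnitAt c.genericPt f) (hg : IsUnitAt c.genericPt g) :
    c.restrict (f * g) = c.restrict f * c.restrict g := by
  obtain ⟨u, rfl⟩ := hf
  obtain ⟨v, rfl⟩ := hg
  rw [← map_mul, restrict_algebraMap, restrict_algebraMap, restrict_algebraMap, map_mul]

lemma restrict_ne_zero (hf : IsUnitAt c.genericPt f) : c.restrict f ≠ 0 := by
  obtain ⟨u, rfl⟩ := hf
  rw [restrict_algebraMap]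
  exact (u.isUnit.map c.restrictHom).ne_zero

lemma restrict_zpow (hf : IsUnitAt c.genericPt f) (n : ℤ) :
    c.restrict (f ^ n) = c.restrict f ^ n := by
  obtain ⟨u, rfl⟩ := hf
  have h1 : (algebraMap (X.presheaf.stalk c.genericPt) X.functionField u) ^ n =
      algebraMap (X.presheaf.stalk c.genericPt) X.functionField ((u ^ n : _ˣ)) :=
    (map_units_zpow _ u n).symm
  rw [h1, restrict_algebraMap, restrict_algebraMap, map_units_zpow]

end SmoothCurve

/-! ### The refined symbol and the tame symbol -/

/-- The quotient and the sign with exponent n₀n₂m₁ form the m₁-th power of the symbol of h₀ and h₂.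
The remaining sign has exponent -m₀m₂n₁ and is the symbol of the constant (-1)^{m₀m₂} with h₁. -/
lemma Place.symbolExpr_eq_tame {K : Type*} [Field K] [Algebra ℂ K] (P : Place ℂ K) {t : K}
    (ht : P.ord t = 1) (m : Fin 3 → ℤ) {h : Fin 3 → K} (hh : ∀ k, h k ≠ 0) :
    symbolExpr m (fun k => P.ord (h k)) (fun k => P.res (t ^ (-P.ord (h k)) * h k)) =
      P.tame (h 0 ^ m 1) (h 2) * P.tame ((-1) ^ (m 0 * m 2)) (h 1) := by
  have h1 : ((-1 : ℂ)) ≠ 0 := by norm_num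
  have hm : P.tame (-1) (h 1) = (-1) ^ P.ord (h 1) := by
    rw [P.tame_of_ord_left_eq_zero (by simp), P.res_neg (by simp), P.res_one]
  have h2 : (-1 : ℂ) ^ (P.ord (h 0) * P.ord (h 2) * m 1 - m 0 * m 2 * P.ord (h 1)) =
      ((-1) ^ (P.ord (h 0) * P.ord (h 2))) ^ m 1 * ((-1) ^ P.ord (h 1)) ^ (m 0 * m 2) := by
    rw [sub_eq_add_neg, zpow_add₀ h1, zpow_mul, ← zpow_mul _ (P.ord (h 1)), zpow_neg, ← inv_zpow,
      inv_neg, inv_one, mul_comm (m 0 * m 2)]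
  rw [P.tame_zpow_left (hh 0) (hh 2), P.tame_zpow_left (by simp) (hh 1), hm,
    P.tame_eq_of_uniformizer (hh 0) (hh 2) ht, symbolExpr, h2, mul_zpow]
  ring

section

variable {X : Scheme.{0}} [X.Over SpecC] [IsIntegral X] [LocallyOfFiniteType (X ↘ SpecC)]
  [SmoothOfRelativeDimension 2 (X ↘ SpecC)] {c : SmoothCurve X} {x₀ : X.functionField}
  (hx₀ : Scheme.ord x₀ c.genericPt = 1) {f : Fin 3 → X.functionField} (hf : ∀ k, f k ≠ 0)

include hx₀

omit [SmoothOfRelativeDimension 2 (X ↘ SpecC)] in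
lemma coheight_genericPt : Order.coheight c.genericPt = 1 :=
  coheight_eq_one_of_ord_ne_zero (hx₀.trans_ne one_ne_zero)

lemma ne_zero_of_ord_eq_one : x₀ ≠ 0 := by
  rintro rfl
  rw [ord_zero 2] at hx₀
  exact zero_ne_one hx₀

lemma isUnitAt_reduced {g : X.functionField} (hg : g ≠ 0) :
    IsUnitAt c.genericPt (x₀ ^ (-Scheme.ord g c.genericPt) * g) := by
  have hz := coheight_genericPt hx₀
  have h0 := ne_zero_of_ord_eq_one hx₀
  apply isUnitAt_of_ord_eq_zero 2 hz (mul_ne_zero (zpow_ne_zero _ h0) hg)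
  rw [ord_mul 2 hz (zpow_ne_zero _ h0) hg, ord_zpow 2 hz h0, hx₀]
  ring

include hf

/-- The refined symbol at a point of the curve is expressed by tame symbols of the reduced
functions on the curve. -/
lemma refinedSymbol_eq_tame {y : X.functionField} {P : closedPoints c.C}
    (hP : Order.coheight (P : c.C) = 1)
    (hy0 : Scheme.ord y c.genericPt = 0) (hy : Scheme.ord (c.restrict y) (P : c.C) = 1)
    {h : Fin 3 → c.C.functionField}
    (hh : ∀ k, h k = c.restrict (x₀ ^ (-Scheme.ord (f k) c.genericPt) * f k)) :
    refinedSymbol c x₀ f y P =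
      (closedPlace hP).tame (h 0 ^ Scheme.ord (f 1) c.genericPt) (h 2) *
      (closedPlace hP).tame
        ((-1) ^ (Scheme.ord (f 0) c.genericPt * Scheme.ord (f 2) c.genericPt)) (h 1) := by
  have hz := coheight_genericPt hx₀
  have hyne : y ≠ 0 := by
    rintro rfl
    rw [c.restrict_zero, ord_zero 1] at hy
    exact zero_ne_one hy
  have hyu := isUnitAt_of_ord_eq_zero 2 hz hyne hy0
  have hu k := isUnitAt_reduced hx₀ (hf k)
  have hne k : h k ≠ 0 := by rw [hh]; exact SmoothCurve.restrict_ne_zero (hu k)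
  have ht : (closedPlace hP).ord (c.restrict y) = 1 := by rw [closedPlace_ord, hy]
  rw [← (closedPlace hP).symbolExpr_eq_tame ht (fun k => Scheme.ord (f k) c.genericPt) hne]
  have hn k : Scheme.ord (c.restrict (x₀ ^ (-Scheme.ord (f k) c.genericPt) * f k)) (P : c.C) =
      (closedPlace hP).ord (h k) := by rw [closedPlace_ord, hh]
  simp only [refinedSymbol, hn]
  congr 1
  funext k
  have h1 : x₀ ^ (-Scheme.ord (f k) c.genericPt) * y ^ (-(closedPlace hP).ord (h k)) * f k =
      y ^ (-(closedPlace hP).ord (h k)) * (x₀ ^ (-Scheme.ord (f k) c.genericPt) * f k) := by ring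
  rw [h1, SmoothCurve.restrict_mul (hyu.zpow _) (hu k), SmoothCurve.restrict_zpow hyu, ← hh,
    closedPlace_res]
  rw [Place.ord_mul _ (zpow_ne_zero _ (SmoothCurve.restrict_ne_zero hyu)) (hne k), Place.ord_zpow,
    ht]
  simp

/-- Reciprocity for the refined symbols along a complete curve. -/
theorem refinedSymbol_reciprocity [IsProper (X ↘ SpecC)] (y : closedPoints c.C → X.functionField)
    (hy : ∀ P, Scheme.ord (y P) c.genericPt = 0 ∧
      Scheme.ord (c.restrict (y P)) (P : c.C) = 1) :
    {P | refinedSymbol c x₀ f (y P) P ≠ 1}.Finite ∧ ∏ᶠ P, refinedSymbol c x₀ f (y P) P = 1 := by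
  -- `Scheme.ord` is 0 at points that are not of codimension one, so the order 1 of the second
  -- coordinate forces codimension one.
  have hY : ∀ P : closedPoints c.C, Order.coheight (P : c.C) = 1 := fun P =>
    coheight_eq_one_of_ord_ne_zero ((hy P).2.trans_ne one_ne_zero)
  set h : Fin 3 → c.C.functionField :=
    fun k => c.restrict (x₀ ^ (-Scheme.ord (f k) c.genericPt) * f k) with hh
  have hne k : h k ≠ 0 := SmoothCurve.restrict_ne_zero (isUnitAt_reduced hx₀ (hf k))
  have heq : ∀ P, refinedSymbol c x₀ f (y P) P =
      (closedPlace (hY P)).tame (h 0 ^ Scheme.ord (f 1) c.genericPt) (h 2) *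
      (closedPlace (hY P)).tame
        ((-1) ^ (Scheme.ord (f 0) c.genericPt * Scheme.ord (f 2) c.genericPt)) (h 1) := fun P =>
    refinedSymbol_eq_tame hx₀ hf (hY P) (hy P).1 (hy P).2 fun k => rfl
  obtain ⟨htr, hess⟩ := trdeg_functionField (Y := c.C)
  have hcomp := complete_closedPlace hY
  have hfin1 := hcomp.finite_mulSupport_tame htr (h 0 ^ Scheme.ord (f 1) c.genericPt) (h 2)
  have hfin2 := hcomp.finite_mulSupport_tame htr
    ((-1) ^ (Scheme.ord (f 0) c.genericPt * Scheme.ord (f 2) c.genericPt)) (h 1)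
  simp only [heq]
  refine ⟨(hfin1.union hfin2).subset fun P hP => ?_, ?_⟩
  · by_contra hcon
    simp only [Set.mem_union, Function.mem_mulSupport, not_or, not_not] at hcon
    exact hP (by rw [hcon.1, hcon.2, mul_one])
  · rw [finprod_mul_distrib hfin1 hfin2, hcomp.finprod_tame htr (zpow_ne_zero _ (hne 0)) (hne 2),
      hcomp.finprod_tame htr (zpow_ne_zero _ (by simp)) (hne 1), mul_one]

end

end RefinedParshin

end

noncomputable section

namespace RefinedParshin

/-! ### Points of codimension one and prime elements of a factorial local ring -/

section Generization

variable {Y : Scheme.{0}} {z z' Q : Y}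

/-- The prime ideal of a local ring defined by a generization of the point. -/
def generizationIdeal (h : z ⤳ Q) : Ideal (Y.presheaf.stalk Q) :=
  (IsLocalRing.maximalIdeal (Y.presheaf.stalk z)).comap (Y.presheaf.stalkSpecializes h).hom

instance (h : z ⤳ Q) : (generizationIdeal h).IsPrime :=
  inferInstanceAs (Ideal.comap _ _).IsPrime

lemma isUnit_stalkSpecializes (h : z ⤳ Q) {a : Y.presheaf.stalk Q} :
    IsUnit ((Y.presheaf.stalkSpecializes h).hom a) ↔ a ∉ generizationIdeal h := by
  rw [generizationIdeal, Ideal.mem_comap, IsLocalRing.mem_maximalIdeal, mem_nonunits_iff, not_not]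

lemma fromSpecStalk_generizationIdeal (h : z ⤳ Q) :
    Y.fromSpecStalk Q (⟨generizationIdeal h, inferInstance⟩ : PrimeSpectrum _) = z := by
  have h1 := Scheme.SpecMap_stalkSpecializes_fromSpecStalk h
  have h2 := congrArg (fun k => k (IsLocalRing.closedPoint (Y.presheaf.stalk z))) h1
  exact h2.trans Scheme.fromSpecStalk_closedPoint

lemma eq_of_generizationIdeal_eq (h : z ⤳ Q) (h' : z' ⤳ Q)
    (heq : generizationIdeal h = generizationIdeal h') : z = z' := by
  rw [← fromSpecStalk_generizationIdeal h, ← fromSpecStalk_generizationIdeal h']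
  congr 1
  exact PrimeSpectrum.ext heq

/-- The spectrum of the local ring at Q is the set of generizations of Q. With
`eq_of_generizationIdeal_eq` this turns irreducible closed subsets through Q into primes of the
local ring. -/
lemma exists_generizationIdeal_eq (p : Ideal (Y.presheaf.stalk Q)) [hp : p.IsPrime] :
    ∃ (z : Y) (h : z ⤳ Q), generizationIdeal h = p := by
  let x : Spec (Y.presheaf.stalk Q) := (⟨p, hp⟩ : PrimeSpectrum _)
  have hx : Y.fromSpecStalk Q x ∈ Set.range (Y.fromSpecStalk Q) := ⟨x, rfl⟩
  rw [Scheme.range_fromSpecStalk] at hx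
  refine ⟨_, hx, ?_⟩
  have h := (Y.fromSpecStalk Q).isEmbedding.injective (fromSpecStalk_generizationIdeal hx)
  exact congrArg PrimeSpectrum.asIdeal h

/-- Every germ at a generization is a fraction of germs at the point. -/
lemma exists_mul_stalkSpecializes_eq (h : z ⤳ Q) (t : Y.presheaf.stalk z) :
    ∃ r s : Y.presheaf.stalk Q, s ∉ generizationIdeal h ∧
      t * (Y.presheaf.stalkSpecializes h).hom s = (Y.presheaf.stalkSpecializes h).hom r := by
  obtain ⟨V, hV, hQ, -⟩ := Y.isBasis_affineOpens.exists_subset_of_mem_open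
    (Set.mem_univ Q) isOpen_univ
  have hz : z ∈ (V : Set Y) := h.mem_open (by obtain ⟨V, hV, rfl⟩ := hV; exact V.2) hQ
  obtain ⟨V, hV, rfl⟩ := hV
  let := Y.presheaf.algebra_section_stalk (⟨z, hz⟩ : V)
  have := IsAffineOpen.isLocalization_stalk hV ⟨z, hz⟩
  obtain ⟨⟨a, b⟩, hab⟩ := IsLocalization.surj
    (IsAffineOpen.primeIdealOf hV ⟨z, hz⟩).asIdeal.primeCompl (S := Y.presheaf.stalk z) t
  have hu := IsLocalization.map_units (Y.presheaf.stalk z) b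
  have hgerm : ∀ c : Γ(Y, V), (Y.presheaf.stalkSpecializes h).hom (Y.presheaf.germ V Q hQ c) =
      algebraMap Γ(Y, V) (Y.presheaf.stalk z) c := fun c =>
    ConcreteCategory.congr_hom (Y.presheaf.germ_stalkSpecializes hQ h) c
  refine ⟨Y.presheaf.germ V Q hQ a, Y.presheaf.germ V Q hQ b, ?_, ?_⟩
  · rw [← isUnit_stalkSpecializes, hgerm]
    exact hu
  · rw [hgerm, hgerm]
    exact hab

variable [IsIntegral Y]

lemma algebraMap_stalkSpecializes (h : z ⤳ Q) (a : Y.presheaf.stalk Q) :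
    algebraMap _ Y.functionField ((Y.presheaf.stalkSpecializes h).hom a) =
      algebraMap _ Y.functionField a :=
  ConcreteCategory.congr_hom (Y.presheaf.stalkSpecializes_comp (generic_specializes z) h) a

lemma IsUnitAt.generize {g : Y.functionField} (hg : IsUnitAt Q g) (h : z ⤳ Q) : IsUnitAt z g := by
  obtain ⟨u, rfl⟩ := hg
  exact ⟨Units.map (Y.presheaf.stalkSpecializes h).hom.toMonoidHom u,
    algebraMap_stalkSpecializes h u⟩

/-- The local ring at a generization whose ideal is generated by a prime element is a discrete
valuation ring with that prime element as a uniformizer. -/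
lemma irreducible_stalkSpecializes [IsLocallyNoetherian Y] (h : z ⤳ Q) {q : Y.presheaf.stalk Q} (hq : Prime q)
    (hspan : generizationIdeal h = Ideal.span {q}) :
    IsDiscreteValuationRing (Y.presheaf.stalk z) ∧
      Irreducible ((Y.presheaf.stalkSpecializes h).hom q) := by
  have hmax : IsLocalRing.maximalIdeal (Y.presheaf.stalk z) =
      Ideal.span {(Y.presheaf.stalkSpecializes h).hom q} := by
    apply le_antisymm
    · intro t ht
      obtain ⟨r, s, hs, hrs⟩ := exists_mul_stalkSpecializes_eq h t
      have hr : r ∈ generizationIdeal h := by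
        rw [generizationIdeal, Ideal.mem_comap, ← hrs]
        exact Ideal.mul_mem_right _ _ ht
      rw [hspan, Ideal.mem_span_singleton] at hr
      rw [Ideal.mem_span_singleton, ← ((isUnit_stalkSpecializes h).2 hs).dvd_mul_right, hrs]
      exact map_dvd _ hr
    · rw [Ideal.span_singleton_le_iff_mem]
      have : q ∈ generizationIdeal h := hspan ▸ Ideal.mem_span_singleton_self q
      exact this
  have hne : (Y.presheaf.stalkSpecializes h).hom q ≠ 0 := by
    intro h0
    have h1 := algebraMap_stalkSpecializes h q
    rw [h0, map_zero] at h1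
    exact hq.ne_zero (IsFractionRing.injective _ Y.functionField (by rw [← h1, map_zero]))
  have hnf : ¬ IsField (Y.presheaf.stalk z) := by
    rw [IsLocalRing.isField_iff_maximalIdeal_eq, hmax, Ideal.span_singleton_eq_bot]
    exact hne
  have hprin : (IsLocalRing.maximalIdeal (Y.presheaf.stalk z)).IsPrincipal := ⟨⟨_, hmax⟩⟩
  have hdvr : IsDiscreteValuationRing (Y.presheaf.stalk z) :=
    ((IsDiscreteValuationRing.TFAE (Y.presheaf.stalk z) hnf).out 0 4).2 hprin
  exact ⟨hdvr, (IsDiscreteValuationRing.irreducible_iff_uniformizer _).2 hmax⟩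

lemma coheight_eq_one_of_isDiscreteValuationRing [IsDiscreteValuationRing (Y.presheaf.stalk z)] :
    Order.coheight z = 1 := by
  have h := ringKrullDim_stalk_eq_coheight z
  rw [IsDiscreteValuationRing.ringKrullDim_eq_one] at h
  exact_mod_cast h.symm

lemma ord_prime_eq_one [IsLocallyNoetherian Y] (h : z ⤳ Q) {q : Y.presheaf.stalk Q} (hq : Prime q)
    (hspan : generizationIdeal h = Ideal.span {q}) :
    Scheme.ord (algebraMap _ Y.functionField q) z = 1 := by
  obtain ⟨hdvr, hirr⟩ := irreducible_stalkSpecializes h hq hspan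
  rw [ord_eq_dvrOrd coheight_eq_one_of_isDiscreteValuationRing, ← algebraMap_stalkSpecializes h,
    Place.dvrOrd_irreducible hirr]

variable [Y.Over SpecC] [LocallyOfFiniteType (Y ↘ SpecC)]
  (n : ℕ) [SmoothOfRelativeDimension n (Y ↘ SpecC)]

include n in
lemma ord_eq_zero_of_isUnitAt {g : Y.functionField} (hg : IsUnitAt z g) : Scheme.ord g z = 0 := by
  by_contra hne
  have hz := coheight_eq_one_of_ord_ne_zero hne
  have := isDiscreteValuationRing_stalk n hz
  obtain ⟨u, rfl⟩ := hg
  rw [ord_eq_dvrOrd hz, Place.dvrOrd_unit] at hne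
  exact hne rfl

include n in
lemma ord_eq_zero_of_notMem (h : z ⤳ Q) {a : Y.presheaf.stalk Q} (ha : a ∉ generizationIdeal h) :
    Scheme.ord (algebraMap _ Y.functionField a) z = 0 :=
  ord_eq_zero_of_isUnitAt n ⟨((isUnit_stalkSpecializes h).2 ha).unit,
    algebraMap_stalkSpecializes h a⟩

include n in
lemma ord_ne_zero_of_mem (h : z ⤳ Q) (hz : Order.coheight z = 1) {a : Y.presheaf.stalk Q}
    (ha0 : a ≠ 0) (ha : a ∈ generizationIdeal h) :
    Scheme.ord (algebraMap _ Y.functionField a) z ≠ 0 := by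
  have := isDiscreteValuationRing_stalk n hz
  have hne : (Y.presheaf.stalkSpecializes h).hom a ≠ 0 := by
    intro h0
    have h1 := algebraMap_stalkSpecializes h a
    rw [h0, map_zero] at h1
    exact ha0 (IsFractionRing.injective _ Y.functionField (by rw [← h1, map_zero]))
  rw [ord_eq_dvrOrd hz, ← algebraMap_stalkSpecializes h, Ne, Place.dvrOrd_eq_zero_iff hne,
    isUnit_stalkSpecializes, not_not]
  exact ha

include n in
/-- The ideal of a generization at which some function has a zero or a pole is not zero. -/
lemma generizationIdeal_ne_bot (h : z ⤳ Q) {g : Y.functionField} (hg : Scheme.ord g z ≠ 0) :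
    generizationIdeal h ≠ ⊥ := by
  intro hbot
  have hg0 : g ≠ 0 := by
    rintro rfl
    exact hg (ord_zero n z)
  obtain ⟨r, s, hs, rfl⟩ := IsFractionRing.div_surjective (Y.presheaf.stalk Q) g
  have hunit : ∀ a : Y.presheaf.stalk Q, a ≠ 0 → Scheme.ord (algebraMap _ Y.functionField a) z = 0 :=
    fun a ha => ord_eq_zero_of_notMem n h (by rwa [hbot, Ideal.mem_bot])
  have hz := coheight_eq_one_of_ord_ne_zero hg
  have hs0 : algebraMap _ Y.functionField s ≠ 0 := fun h0 => hg0 (by rw [h0, div_zero])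
  have hr0 : algebraMap _ Y.functionField r ≠ 0 := fun h0 => hg0 (by rw [h0, zero_div])
  have h1 := ord_mul n hz hg0 hs0
  rw [div_mul_cancel₀ _ hs0, hunit r fun h0 => hr0 (by rw [h0, map_zero]),
    hunit s fun h0 => hs0 (by rw [h0, map_zero]), add_zero] at h1
  exact hg h1.symm

include n in
/-- On a factorial local ring a rational function without zeros and poles is a unit. -/
lemma isUnitAt_of_forall_ord_eq_zero [UniqueFactorizationMonoid (Y.presheaf.stalk Q)]
    {g : Y.functionField} (hg : g ≠ 0)
    (hord : ∀ (z : Y) (h : z ⤳ Q) (q : Y.presheaf.stalk Q), Prime q →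
      generizationIdeal h = Ideal.span {q} → Scheme.ord g z = 0) : IsUnitAt Q g := by
  obtain ⟨r, s, hrs, hg'⟩ := IsFractionRing.exists_reduced_fraction (A := Y.presheaf.stalk Q) g
  have hs0 : algebraMap (Y.presheaf.stalk Q) Y.functionField s ≠ 0 :=
    IsFractionRing.to_map_ne_zero_of_mem_nonZeroDivisors s.2
  have hmul : g * algebraMap (Y.presheaf.stalk Q) Y.functionField s =
      algebraMap (Y.presheaf.stalk Q) Y.functionField r := by
    rw [← hg', IsLocalization.mk'_spec]
  have hr0 : r ≠ 0 := by
    rintro rfl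
    rw [map_zero] at hmul
    exact mul_ne_zero hg hs0 hmul
  have hs0' : (s : Y.presheaf.stalk Q) ≠ 0 := nonZeroDivisors.ne_zero s.2
  -- Where g has order 0 its numerator and denominator have equal order, so a prime divides both or
  -- neither. In a reduced fraction it divides neither, and both are units.
  have key : ∀ q : Y.presheaf.stalk Q, Prime q → (q ∣ r ↔ q ∣ s) := by
    intro q hq
    have : (Ideal.span {q}).IsPrime := (Ideal.span_singleton_prime hq.ne_zero).2 hq
    obtain ⟨z, h, hz⟩ := exists_generizationIdeal_eq (Ideal.span {q})
    have hdvr := (irreducible_stalkSpecializes h hq hz).1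
    have hz1 : Order.coheight z = 1 := coheight_eq_one_of_isDiscreteValuationRing
    have hdvd : ∀ a : Y.presheaf.stalk Q, a ≠ 0 →
        (q ∣ a ↔ Scheme.ord (algebraMap _ Y.functionField a) z ≠ 0) := fun a ha => by
      rw [← Ideal.mem_span_singleton, ← hz]
      refine ⟨ord_ne_zero_of_mem n h hz1 ha, fun hne => ?_⟩
      by_contra hmem
      exact hne (ord_eq_zero_of_notMem n h hmem)
    rw [hdvd r hr0, hdvd s hs0', ← hmul, ord_mul n hz1 hg hs0, hord z h q hq hz, zero_add]
  have hunit : ∀ a : Y.presheaf.stalk Q, a ≠ 0 →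
      (∀ q, Prime q → ¬ q ∣ a) → IsUnit a := fun a ha hq => by
    by_contra hu
    obtain ⟨q, hirr, hqa⟩ := WfDvdMonoid.exists_irreducible_factor hu ha
    exact hq q hirr.prime hqa
  have hr := hunit r hr0 fun q hq hqr => hq.not_isUnit (hrs hqr ((key q hq).1 hqr))
  have hs := hunit s hs0' fun q hq hqs => hq.not_isUnit (hrs ((key q hq).2 hqs) hqs)
  refine ⟨hr.unit * hs.unit⁻¹, ?_⟩
  rw [← mul_left_inj' hs0, hmul, ← map_mul]
  congr 1
  rw [Units.val_mul, mul_assoc, IsUnit.val_inv_mul, mul_one]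
  rfl

end Generization

end RefinedParshin

end

noncomputable section

namespace RefinedParshin

/-! ### The refined symbol at a crossing point -/

section LocalEquation

variable {Y : Scheme.{0}} [IsIntegral Y] {z w Q : Y} [Y.Over SpecC]
  [LocallyOfFiniteType (Y ↘ SpecC)] (n : ℕ) [SmoothOfRelativeDimension n (Y ↘ SpecC)]

include n in
-- Non-associated primes do not divide each other, so an equation of one curve is a unit along the
-- other.
lemma ord_prime_eq_zero (h : z ⤳ Q) (h' : w ⤳ Q) (hne : z ≠ w) {q a : Y.presheaf.stalk Q}
    (hq : Prime q) (ha : Prime a) (hspan : generizationIdeal h = Ideal.span {q})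
    (hspan' : generizationIdeal h' = Ideal.span {a}) :
    Scheme.ord (algebraMap _ Y.functionField a) z = 0 := by
  apply ord_eq_zero_of_notMem n h
  rw [hspan, Ideal.mem_span_singleton]
  intro hqa
  refine hne (eq_of_generizationIdeal_eq h h' ?_)
  rw [hspan, hspan', Ideal.span_singleton_eq_span_singleton]
  exact hq.associated_of_dvd ha hqa

include n in
-- The function `g` with a zero or pole at `z` only serves to exclude the zero ideal.
lemma prime_of_generizationIdeal_eq (h : z ⤳ Q) {g : Y.functionField} (hg : Scheme.ord g z ≠ 0)
    {q : Y.presheaf.stalk Q} (hspan : generizationIdeal h = Ideal.span {q}) : Prime q := by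
  have hbot := generizationIdeal_ne_bot n h hg
  have hprime : (generizationIdeal h).IsPrime := inferInstance
  rw [hspan] at hbot hprime
  exact (Ideal.span_singleton_prime fun h0 => hbot (Ideal.span_singleton_eq_bot.2 h0)).1 hprime

end LocalEquation

namespace SmoothCurve

variable {X : Scheme.{0}} [X.Over SpecC] (c : SmoothCurve X)

/-- Restriction to the curve of germs of functions on the surface. -/
def restrictGerm (P : c.C) : X.presheaf.stalk (c.ι P) →+* c.C.presheaf.stalk P :=
  (c.ι.stalkMap P).hom

instance (P : c.C) : IsLocalHom (c.restrictGerm P) :=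
  inferInstanceAs (IsLocalHom (c.ι.stalkMap P).hom)

lemma restrictGerm_surjective (P : c.C) : Function.Surjective (c.restrictGerm P) :=
  c.ι.stalkMap_surjective P

lemma restrictHom_stalkSpecializes {P : c.C} (h : c.genericPt ⤳ c.ι P)
    (a : X.presheaf.stalk (c.ι P)) :
    c.restrictHom ((X.presheaf.stalkSpecializes h).hom a) =
      algebraMap _ c.C.functionField (c.restrictGerm P a) :=
  c.ι.stalkSpecializes_stalkMap_apply _ _ (generic_specializes P) a

/-- Restriction at the generic point of the curve is a local homomorphism into a field: a germ
restricts to zero exactly when it is not a unit there. -/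
lemma ker_restrictGerm {P : c.C} (h : c.genericPt ⤳ c.ι P) :
    RingHom.ker (c.restrictGerm P) = generizationIdeal h := by
  ext a
  have hloc : IsLocalHom c.restrictHom :=
    inferInstanceAs (IsLocalHom (c.ι.stalkMap (genericPoint c.C)).hom)
  rw [RingHom.mem_ker, ← not_iff_not, ← isUnit_stalkSpecializes h,
    ← isUnit_map_iff c.restrictHom, restrictHom_stalkSpecializes, isUnit_iff_ne_zero, Ne,
    map_eq_zero_iff _ (IsFractionRing.injective _ c.C.functionField)]

lemma map_maximalIdeal_restrictGerm (P : c.C) :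
    (IsLocalRing.maximalIdeal (X.presheaf.stalk (c.ι P))).map (c.restrictGerm P) =
      IsLocalRing.maximalIdeal (c.C.presheaf.stalk P) := by
  have h : (IsLocalRing.maximalIdeal (c.C.presheaf.stalk P)).comap (c.restrictGerm P) =
      IsLocalRing.maximalIdeal (X.presheaf.stalk (c.ι P)) :=
    IsLocalRing.maximalIdeal_comap (c.restrictGerm P)
  rw [← h, Ideal.map_comap_of_surjective _ (c.restrictGerm_surjective P)]

/-- Two ℂ-algebra homomorphisms from a local ring to ℂ have the same kernel, the maximal ideal, and
therefore agree. -/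
lemma stalkEval_restrictGerm [LocallyOfFiniteType (X ↘ SpecC)] (P : closedPoints c.C)
    (hQ : c.ι P ∈ closedPoints X) (a : X.presheaf.stalk (c.ι P)) :
    stalkEval P (c.restrictGerm P a) = stalkEval (⟨c.ι P, hQ⟩ : closedPoints X) a := by
  let ψ : X.presheaf.stalk (c.ι P) →ₐ[ℂ] ℂ :=
    (stalkEval P).comp { c.restrictGerm P with commutes' := stalkMap_algebraMap c.ι rfl (P : c.C) }
  let θ : X.presheaf.stalk (c.ι P) →ₐ[ℂ] ℂ := stalkEval (⟨c.ι P, hQ⟩ : closedPoints X)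
  have hker : RingHom.ker ψ = RingHom.ker θ :=
    (Place.ker_eq_maximalIdeal_of_algHom ψ).trans (Place.ker_eq_maximalIdeal_of_algHom θ).symm
  have hmem : a - algebraMap ℂ _ (θ a) ∈ RingHom.ker θ := by
    rw [RingHom.mem_ker, map_sub, AlgHom.commutes]
    exact sub_self _
  rw [← hker, RingHom.mem_ker, map_sub, AlgHom.commutes] at hmem
  exact sub_eq_zero.1 hmem

variable [IsIntegral X]

lemma restrict_algebraMap_stalk {P : c.C} (h : c.genericPt ⤳ c.ι P)
    (a : X.presheaf.stalk (c.ι P)) :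
    c.restrict (algebraMap _ X.functionField a) =
      algebraMap _ c.C.functionField (c.restrictGerm P a) := by
  rw [← algebraMap_stalkSpecializes h, restrict_algebraMap, restrictHom_stalkSpecializes]

end SmoothCurve

section Crossing

variable {X : Scheme.{0}} [X.Over SpecC] [IsIntegral X] [LocallyOfFiniteType (X ↘ SpecC)]
  [SmoothOfRelativeDimension 2 (X ↘ SpecC)] {c d : SmoothCurve X} {x₀ x : X.functionField}
  (hx₀ : Scheme.ord x₀ c.genericPt = 1) {f : Fin 3 → X.functionField} (hf : ∀ k, f k ≠ 0)
  {P : closedPoints c.C} (hP : Order.coheight (P : c.C) = 1)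
  (hloc : c.IsLocalEquation (c.ι P) x₀)

include hx₀ hP hloc in
/-- The local ring of the surface at a point of the curve is factorial. -/
lemma uniqueFactorizationMonoid_stalk :
    UniqueFactorizationMonoid (X.presheaf.stalk (c.ι P)) := by
  obtain ⟨h, a, -, hspan⟩ := hloc
  have := isDiscreteValuationRing_stalk 1 hP
  -- The quotient by the local equation is the local ring of the curve at P, a discrete valuation
  -- ring.
  exact uniqueFactorizationMonoid_of_isPrincipalIdealRing_quotient (c.restrictGerm P)
    (c.restrictGerm_surjective P)
    (prime_of_generizationIdeal_eq 2 h (hx₀.trans_ne one_ne_zero) hspan)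
    ((c.ker_restrictGerm h).trans hspan)

-- Along `c` the power of `x₀` cancels the order of `f k`. Along any other curve through the point
-- `f k` has order 0, and so has `x₀`, being a local equation of `c`. Factoriality turns this into a
-- unit.
include hx₀ hf hP hloc in
lemma isUnitAt_reduced_of_forall (hother : ∀ k z, z ⤳ c.ι P → Scheme.ord (f k) z ≠ 0 →
    z = c.genericPt) (k : Fin 3) :
    IsUnitAt (c.ι P) (x₀ ^ (-Scheme.ord (f k) c.genericPt) * f k) := by
  have := uniqueFactorizationMonoid_stalk hx₀ hP hloc
  obtain ⟨h₀, a, ha, hspan⟩ := hloc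
  have hprime := prime_of_generizationIdeal_eq 2 h₀ (hx₀.trans_ne one_ne_zero) hspan
  have hx0 := ne_zero_of_ord_eq_one hx₀
  refine isUnitAt_of_forall_ord_eq_zero 2 (mul_ne_zero (zpow_ne_zero _ hx0) (hf k))
    fun z h q hq hz => ?_
  have hdvr := (irreducible_stalkSpecializes h hq hz).1
  have hz1 : Order.coheight z = 1 := coheight_eq_one_of_isDiscreteValuationRing
  rw [ord_mul 2 hz1 (zpow_ne_zero _ hx0) (hf k), ord_zpow 2 hz1 hx0]
  by_cases hzc : z = c.genericPt
  · rw [hzc, hx₀]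
    ring
  · have h1 : Scheme.ord (f k) z = 0 := by
      by_contra hne
      exact hzc (hother k z h hne)
    rw [h1, ← ha, ord_prime_eq_zero 2 h h₀ hzc hq hprime hz hspan]
    ring

include hx₀ hf hP hloc in
/-- The refined symbol is trivial at a point that lies on no other component. -/
theorem refinedSymbol_eq_one {y : X.functionField} (hy0 : Scheme.ord y c.genericPt = 0)
    (hy : Scheme.ord (c.restrict y) (P : c.C) = 1)
    (hother : ∀ k z, z ⤳ c.ι P → Scheme.ord (f k) z ≠ 0 → z = c.genericPt) :
    refinedSymbol c x₀ f y P = 1 := by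
  have hu := isUnitAt_reduced_of_forall hx₀ hf hP hloc hother
  obtain ⟨h₀, -⟩ := hloc
  have hord : ∀ k, (closedPlace hP).ord
      (c.restrict (x₀ ^ (-Scheme.ord (f k) c.genericPt) * f k)) = 0 := fun k => by
    obtain ⟨u, hu⟩ := hu k
    rw [closedPlace_ord]
    refine ord_eq_zero_of_isUnitAt 1 ⟨Units.map (c.restrictGerm P).toMonoidHom u, ?_⟩
    rw [← hu, c.restrict_algebraMap_stalk h₀]
    rfl
  rw [refinedSymbol_eq_tame hx₀ hf hP hy0 hy fun k => rfl,
    Place.tame_of_ord_eq_zero _ (by rw [Place.ord_zpow, hord, mul_zero]) (hord 2),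
    Place.tame_of_ord_eq_zero _ (by rw [Place.ord_zpow]; simp) (hord 1), mul_one]

variable (hlocd : d.IsLocalEquation (c.ι P) x) (hcd : c.genericPt ≠ d.genericPt)
  (hd : ∃ k, Scheme.ord (f k) d.genericPt ≠ 0)

include hx₀ hf hP hloc hlocd hcd hd

/-- The orders along `c` and `d` are cancelled by `x₀` and `x`, each a unit along the other curve,
and no further curve through the point matters. The hypothesis `hd` makes the ideal of `d` non-zero,
so that `x` is a prime element there. -/
lemma isUnitAt_cofactor (hother : ∀ k z, z ⤳ c.ι P → Scheme.ord (f k) z ≠ 0 →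
    z = c.genericPt ∨ z = d.genericPt) (k : Fin 3) :
    IsUnitAt (c.ι P) (cofactor c d x₀ x f k) := by
  have := uniqueFactorizationMonoid_stalk hx₀ hP hloc
  obtain ⟨h₀, a, ha, hspan⟩ := hloc
  obtain ⟨h₁, b, hb, hspan₁⟩ := hlocd
  obtain ⟨l, hl⟩ := hd
  have hpa := prime_of_generizationIdeal_eq 2 h₀ (hx₀.trans_ne one_ne_zero) hspan
  have hpb := prime_of_generizationIdeal_eq 2 h₁ hl hspan₁
  have hx0 := ne_zero_of_ord_eq_one hx₀
  have hx1 : Scheme.ord x d.genericPt = 1 := by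
    rw [← hb]; exact ord_prime_eq_one h₁ hpb hspan₁
  have hx := ne_zero_of_ord_eq_one hx1
  refine isUnitAt_of_forall_ord_eq_zero 2
    (mul_ne_zero (mul_ne_zero (zpow_ne_zero _ hx0) (zpow_ne_zero _ hx)) (hf k))
    fun z h q hq hz => ?_
  have hdvr := (irreducible_stalkSpecializes h hq hz).1
  have hz1 : Order.coheight z = 1 := coheight_eq_one_of_isDiscreteValuationRing
  have hxa : z ≠ c.genericPt → Scheme.ord x₀ z = 0 := fun hne => by
    rw [← ha]; exact ord_prime_eq_zero 2 h h₀ hne hq hpa hz hspan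
  have hxb : z ≠ d.genericPt → Scheme.ord x z = 0 := fun hne => by
    rw [← hb]; exact ord_prime_eq_zero 2 h h₁ hne hq hpb hz hspan₁
  rw [cofactor, ord_mul 2 hz1 (mul_ne_zero (zpow_ne_zero _ hx0) (zpow_ne_zero _ hx)) (hf k),
    ord_mul 2 hz1 (zpow_ne_zero _ hx0) (zpow_ne_zero _ hx), ord_zpow 2 hz1 hx0,
    ord_zpow 2 hz1 hx]
  by_cases hzc : z = c.genericPt
  · rw [hxb (hzc.trans_ne hcd), hzc, hx₀]
    ring
  by_cases hzd : z = d.genericPt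
  · rw [hxa hzc, hzd, hx1]
    ring
  · have h1 : Scheme.ord (f k) z = 0 := by
      by_contra hne
      exact (hother k z h hne).elim hzc hzd
    rw [h1, hxa hzc, hxb hzd]
    ring

/-- The refined symbol at a crossing point is computed on the surface. -/
theorem refinedSymbol_eq_crossingSymbol {y : X.functionField}
    (hy0 : Scheme.ord y c.genericPt = 0) (hy : Scheme.ord (c.restrict y) (P : c.C) = 1)
    (hother : ∀ k z, z ⤳ c.ι P → Scheme.ord (f k) z ≠ 0 → z = c.genericPt ∨ z = d.genericPt)
    (htrans : ∀ (h : c.genericPt ⤳ c.ι P) (h' : d.genericPt ⤳ c.ι P),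
      c.idealAt h ⊔ d.idealAt h' = IsLocalRing.maximalIdeal (X.presheaf.stalk (c.ι P)))
    (hQ : c.ι P ∈ closedPoints X) :
    refinedSymbol c x₀ f y P = crossingSymbol c d x₀ x f ⟨c.ι P, hQ⟩ := by
  have hu := isUnitAt_cofactor hx₀ hf hP hloc hlocd hcd hd hother
  obtain ⟨h₀, a, ha, hspan⟩ := hloc
  obtain ⟨h₁, b, hb, hspan₁⟩ := hlocd
  obtain ⟨l, hl⟩ := hd
  have hpa := prime_of_generizationIdeal_eq 2 h₀ (hx₀.trans_ne one_ne_zero) hspan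
  have hpb := prime_of_generizationIdeal_eq 2 h₁ hl hspan₁
  have hx0 := ne_zero_of_ord_eq_one hx₀
  have hxne : x ≠ 0 := ne_zero_of_ord_eq_one (c := d) (by
    rw [← hb]; exact ord_prime_eq_one h₁ hpb hspan₁)
  have hxu : IsUnitAt c.genericPt x :=
    isUnitAt_of_ord_eq_zero 2 (coheight_genericPt hx₀) hxne (by
      rw [← hb]; exact ord_prime_eq_zero 2 h₀ h₁ hcd hpa hpb hspan hspan₁)
  have hdvr := isDiscreteValuationRing_stalk 1 hP
  -- Transversality: the equations of `c` and `d` generate the maximal ideal of the surface at the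
  -- point. Restriction to `c` kills the first, so the second generates the maximal ideal of the
  -- curve.
  have hirr : Irreducible (c.restrictGerm P b) := by
    rw [IsDiscreteValuationRing.irreducible_iff_uniformizer,
      ← c.map_maximalIdeal_restrictGerm, ← htrans h₀ h₁, hspan, hspan₁, Ideal.map_sup,
      Ideal.map_span, Ideal.map_span, Set.image_singleton, Set.image_singleton]
    have ha0 : c.restrictGerm P a = 0 := by
      rw [← RingHom.mem_ker, c.ker_restrictGerm h₀]
      exact hspan.ge (Ideal.mem_span_singleton_self a)
    rw [ha0, Ideal.span_singleton_eq_bot.2 rfl, bot_sup_eq]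
  have ht : (closedPlace hP).ord (c.restrict x) = 1 := by
    rw [closedPlace_ord, ord_eq_dvrOrd hP, ← hb, c.restrict_algebraMap_stalk h₀,
      Place.dvrOrd_irreducible hirr]
  have hres : ∀ k, (closedPlace hP).ord (c.restrict (cofactor c d x₀ x f k)) = 0 ∧
      (closedPlace hP).res (c.restrict (cofactor c d x₀ x f k)) =
        valueAt ⟨c.ι P, hQ⟩ (cofactor c d x₀ x f k) := fun k => by
    obtain ⟨u, hu⟩ := hu k
    rw [← hu, c.restrict_algebraMap_stalk h₀]
    refine ⟨?_, ?_⟩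
    · rw [closedPlace_ord]
      exact ord_eq_zero_of_isUnitAt 1 ⟨Units.map (c.restrictGerm P).toMonoidHom u, rfl⟩
    · rw [closedPlace_res_algebraMap, c.stalkEval_restrictGerm P hQ]
      exact (valueAt_algebraMap (⟨c.ι P, hQ⟩ : closedPoints X) _).symm
  -- On the curve the reduced function is this power of a uniformizer times a unit, so its order n_k
  -- at P is the order of `f k` along `d`.
  have hred : ∀ k, c.restrict (x₀ ^ (-Scheme.ord (f k) c.genericPt) * f k) =
      c.restrict x ^ Scheme.ord (f k) d.genericPt * c.restrict (cofactor c d x₀ x f k) :=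
    fun k => by
      rw [← SmoothCurve.restrict_zpow hxu,
        ← SmoothCurve.restrict_mul (hxu.zpow _) ((hu k).generize h₀), cofactor, zpow_neg x]
      congr 1
      field_simp
  have hxr : c.restrict x ≠ 0 := SmoothCurve.restrict_ne_zero hxu
  have hne : ∀ k, c.restrict (x₀ ^ (-Scheme.ord (f k) c.genericPt) * f k) ≠ 0 := fun k =>
    SmoothCurve.restrict_ne_zero (isUnitAt_reduced hx₀ (hf k))
  have hord : ∀ k, (closedPlace hP).ord
      (c.restrict (x₀ ^ (-Scheme.ord (f k) c.genericPt) * f k)) =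
        Scheme.ord (f k) d.genericPt := fun k => by
    rw [hred, Place.ord_mul _ (zpow_ne_zero _ hxr)
      (SmoothCurve.restrict_ne_zero ((hu k).generize h₀)), Place.ord_zpow, ht, (hres k).1]
    ring
  -- Passing through tame symbols exchanges the uniformizer `y` for the restriction of `x`.
  rw [refinedSymbol_eq_tame hx₀ hf hP hy0 hy fun k => rfl,
    ← (closedPlace hP).symbolExpr_eq_tame ht (fun k => Scheme.ord (f k) c.genericPt)
      (h := fun k => c.restrict (x₀ ^ (-Scheme.ord (f k) c.genericPt) * f k)) hne, crossingSymbol]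
  simp only [hord]
  congr 1
  funext k
  rw [hred, ← mul_assoc, ← zpow_add₀ hxr, neg_add_cancel, zpow_zero, one_mul, (hres k).2]

end Crossing

end RefinedParshin

end

/-! ### The theorem -/

open RefinedParshin in
theorem theorem0p3 (X : Scheme.{0}) [X.Over SpecC] [IsIntegral X] [IsProper (X ↘ SpecC)]
    [SmoothOfRelativeDimension 2 (X ↘ SpecC)]
    (f : Fin 3 → X.functionField) (hf : ∀ k, f k ≠ 0)
    (N : ℕ) (C : Fin (N + 1) → SmoothCurve X)
    (hC : AreComponents C f) (hNC : NormalCrossings C)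
    (x₀ : X.functionField) (hx₀ : Scheme.ord x₀ (C 0).genericPt = 1) :
    -- reciprocity, for any choice of second coordinates along `C 0`
    (∀ y : closedPoints (C 0).C → X.functionField,
      (∀ P, Scheme.ord (y P) (C 0).genericPt = 0 ∧
        Scheme.ord ((C 0).restrict (y P)) (P : (C 0).C) = 1) →
      {P | refinedSymbol (C 0) x₀ f (y P) P ≠ 1}.Finite ∧
      ∏ᶠ P, refinedSymbol (C 0) x₀ f (y P) P = 1) ∧
    -- where `x₀` is a local equation of `C 0`: at a crossing point with `C j` the symbol is given
    -- by the decompositions `f_k = x₀^{m_k} x_j^{n_k} g_k` on the surface, with `m_k = ord_{C 0} f_k`,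
    -- `n_k = ord_{C j} f_k`, and at a point on no other component it is trivial
    (∀ P : closedPoints (C 0).C, ∀ Q : closedPoints X, (C 0).ι P = Q →
      (C 0).IsLocalEquation Q x₀ → ∀ y : X.functionField,
      Scheme.ord y (C 0).genericPt = 0 → Scheme.ord ((C 0).restrict y) (P : (C 0).C) = 1 →
      (∀ j, j ≠ 0 → ∀ xj : X.functionField, (C j).IsLocalEquation Q xj →
        (∀ k, IsUnitAt (Q : X) (cofactor (C 0) (C j) x₀ xj f k)) ∧
        refinedSymbol (C 0) x₀ f y P = crossingSymbol (C 0) (C j) x₀ xj f Q) ∧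
      ((∀ j, j ≠ 0 → ¬ (C j).genericPt ⤳ (Q : X)) → refinedSymbol (C 0) x₀ f y P = 1)) := by
  refine ⟨fun y hy => refinedSymbol_reciprocity hx₀ hf y hy, ?_⟩
  rintro P ⟨Q, hQ⟩ (rfl : (C 0).ι P = Q) hloc y hy0 hy
  have hP : Order.coheight (P : (C 0).C) = 1 :=
    coheight_eq_one_of_ord_ne_zero (hy.trans_ne one_ne_zero)
  have h₀ : (C 0).genericPt ⤳ (C 0).ι P := hloc.choose
  refine ⟨fun j hj xj hlocj => ?_, fun hnone => ?_⟩
  · have hne : (C 0).genericPt ≠ (C j).genericPt := fun h => hj (hC.1 h).symm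
    have hcomp := (hC.2 _).2 ⟨j, rfl⟩
    have h₁ : (C j).genericPt ⤳ (C 0).ι P := hlocj.choose
    have hother : ∀ k z, z ⤳ (C 0).ι P → Scheme.ord (f k) z ≠ 0 →
        z = (C 0).genericPt ∨ z = (C j).genericPt := fun k z hz hk => by
      obtain ⟨i, rfl⟩ := (hC.2 z).1 ⟨k, hk⟩
      exact ((hNC 0 j _ h₀ h₁ hj.symm).2 i hz).imp (fun h => by rw [h]) fun h => by rw [h]
    exact ⟨isUnitAt_cofactor hx₀ hf hP hloc hlocj hne hcomp hother,
      refinedSymbol_eq_crossingSymbol hx₀ hf hP hloc hlocj hne hcomp hy0 hy hother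
        (fun h h' => (hNC 0 j _ h h' hj.symm).1) hQ⟩
  · refine refinedSymbol_eq_one hx₀ hf hP hloc hy0 hy fun k z hz hk => ?_
    obtain ⟨i, rfl⟩ := (hC.2 z).1 ⟨k, hk⟩
    by_contra hi
    exact hnone i (fun h => hi (by rw [h])) hz
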